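/- **Weaknesses.** A weakness is one of $s$ (strict), $p$ (pseudo), $l$ (lax), $c$ (colax). They are partially ordered by $s\le p\le l$ and $s\le p\le c$, and $\overline{(-)}$ is the involution with $\overline s=s$, $\overline p=p$, $\overline l=c$, $\overline c=l$. For a square of $1$-cells in a $2$-category with composites $t$ (top, then right) and $b$ (left, then bottom), an $l$-cell is a $2$-cell $t\Rightarrow b$, a $c$-cell is a $2$-cell $b\Rightarrow t$, a $p$-cell is an invertible $2$-cell $t\cong b$, and an $s$-cell is an equality $t=b$. For $w'\le w$, a $w$-cell is said to be a $w'$-cell if it is an identity (when $w'=s$), invertible (when $w'=p$), or without condition (when $w'=w$). **$\mathscr F$-categories.** Everything below is small with respect to a fixed universe. An $\mathscr F$-category is a (strict) $2$-category, whose $1$-cells are called loose, with a class of $1$-cells, called tight, which contains the identities and is closed under composition. An $\mathscr F$-functor is a $2$-functor preserving tightness. For $\mathscr F$-functors $F,G:\mathbb A\to\mathbb B$ and $w'\le w$, a loose $(w',w)$-natural transformation $\varphi:F\Rightarrow G$ consists of $1$-cells $\varphi_A:FA\to GA$ and, for each $f:A\to A'$ in $\mathbb A$, a $w$-cell $\varphi_f$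 in the square with top $\varphi_A$, right $Gf$, left $Ff$, bottom $\varphi_{A'}$, which is a $w'$-cell if $f$ is tight; these cells are compatible with identities, composition and $2$-cells of $\mathbb A$. It is tight if each $\varphi_A$ is tight and each $\varphi_f$ is a $w'$-cell. A modification $\varphi\Rrightarrow\psi$ is a family of $2$-cells $\varphi_A\Rightarrow\psi_A$ compatible with the cells $\varphi_f,\psi_f$. The $\mathscr F$-functors $\mathbb A\to\mathbb B$, loose and tight $(w',w)$-natural transformations, and modifications form an $\mathscr F$-category $\mathrm{Fun}_{w',w}(\mathbb A,\mathbb B)$. It is functorial in $\mathbb A$ (contravariantly) and $\mathbb B$ by composition with $\mathscr F$-functors. **The multicategory $\mathscr F\text{-}\mathrm{CAT}_{w',w}$.** Let $w'\le w$. A $(w',w)$-natural $\mathscr F$-multifunctor $M:\mathbb S_1,\dots,\mathbb S_n\to\mathbb C$, $n>0$, consists of an object $M(S_1,\dots,S_n)$ of $\mathbb C$ for each tuple of objects $S_i\in\mathbb S_i$; the structure of an $\mathscr F$-functor $\mathbb S_i\to\mathbb C$ on each assignment $M(S_1,\dots,-_i,\dots,S_n)$; and, for $i<j$, loose morphisms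 $s_i:S_i\to S_i'$, $s_j:S_j\to S_j'$ and objects $S_k$ for $k\ne i,j$, a $w$-cell $M(\dots,s_i,\dots,s_j,\dots)$ in the square whose top and bottom are the values at $s_i$ and whose left and right are the values at $s_j$. These satisfy: the cell is a $w'$-cell if $s_i$ or $s_j$ is tight; for fixed $s_i$ the cells form a loose $w$-natural transformation in the $j$-th variable; for fixed $s_j$ they form a loose $\overline w$-natural transformation in the $i$-th variable; and for $i<j<k$ and $s_i,s_j,s_k$ the two pastings of the faces of the cube of cells agree. A nullary $\mathscr F$-multifunctor to $\mathbb C$ is an object of $\mathbb C$. With composition by substitution (the cells being composed by pasting), small $\mathscr F$-categories and $(w',w)$-natural $\mathscr F$-multifunctors form a multicategory $\mathscr F\text{-}\mathrm{CAT}_{w',w}$. **The multicategory $\mathscr F\text{-}\mathrm{SK}_{w',w}$.** Let $\mathbb F$ be the $\mathscr F$-category of full embeddings $A_\tau\hookrightarrow A_\lambda$ of categories, with loose morphisms the functors $A_\lambda\to B_\lambda$, tight morphisms those that restrict to $A_\tau\to B_\tau$, and $2$-cells the natural transformations. A weighted cone in an $\mathscr F$-category $\mathbb S$ consists of a small $\mathscr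 F$-category $\mathbb J$, $\mathscr F$-functors $W:\mathbb J\to\mathbb F$ and $D:\mathbb J\to\mathbb S$, an object $X$ of $\mathbb S$, and an $\mathscr F$-natural transformation (strictly natural, with tight components) $W\Rightarrow\mathbb S(X,D-)$. An $\mathscr F$-sketch $\mathcal S$ is a small $\mathscr F$-category $\mathbb S$ with a set of weighted cones in it. A model of $\mathcal S$ in $\mathcal C$ is an $\mathscr F$-functor $\mathbb S\to\mathbb C$ sending the cones of $\mathcal S$ to cones of $\mathcal C$. A $(w',w)$-natural multimodel $\mathcal S_1,\dots,\mathcal S_n\to\mathcal C$ is a $(w',w)$-natural $\mathscr F$-multifunctor $M$ for which each $M(S_1,\dots,-_i,\dots,S_n)$ is a model of $\mathcal S_i$ in $\mathcal C$. $\mathscr F$-sketches and $(w',w)$-natural multimodels form a multicategory $\mathscr F\text{-}\mathrm{SK}_{w',w}$. The $\mathscr F$-sketch $\mathrm{Mod}_{w',w}(\mathcal S,\mathcal C)$ has as $\mathscr F$-category the full sub-$\mathscr F$-category of $\mathrm{Fun}_{w',w}(\mathbb S,\mathbb C)$ on the models, and as cones those weighted cones that every evaluation $\mathscr F$-functor $\mathrm{ev}_S:\mathrm{Mod}_{w',w}(\mathcal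 S,\mathcal C)\to\mathbb C$, $S\in\mathbb S$, sends to a cone of $\mathcal C$. It is functorial in $\mathcal S$ (contravariantly) and $\mathcal C$ by composition with models. **Closedness.** A multicategory $\mathscr M$ is left-closed with internal homs $[X,Z]_l$ if there are bijections $$\mathscr M(X,Y_1,\dots,Y_n;Z)\;\cong\;\mathscr M(Y_1,\dots,Y_n;[X,Z]_l)\qquad(n\ge 0)$$ natural in $X,Y_1,\dots,Y_n,Z$, and right-closed with internal homs $[Y,Z]_r$ if there are bijections $$\mathscr M(X_1,\dots,X_n,Y;Z)\;\cong\;\mathscr M(X_1,\dots,X_n;[Y,Z]_r)\qquad(n\ge 0)$$ natural in $X_1,\dots,X_n,Y,Z$. Here naturality in the $Y_j$ (respectively $X_j$) is with respect to substitution of arbitrary multimorphisms, and naturality in $X$ (respectively $Y$) and $Z$ is with respect to unary multimorphisms and the given functoriality of the internal homs. **Proposition.** Let $w'\le w$ be weaknesses. 1. $\mathscr F\text{-}\mathrm{CAT}_{w',w}$ is left-closed with internal homs $\mathrm{Fun}_{\overline{w'},\overline w}(-,-)$, and right-closed with internal homs $\mathrm{Fun}_{w',w}(-,-)$. 2. $\mathscr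 F\text{-}\mathrm{SK}_{w',w}$ is left-closed with internal homs $\mathrm{Mod}_{\overline{w'},\overline w}(-,-)$, and right-closed with internal homs $\mathrm{Mod}_{w',w}(-,-)$. Moreover, the closed structures can be chosen so that the bijections of (2) are restrictions of those of (1): the $\mathscr F$-multifunctor to $\mathrm{Fun}$ that corresponds under (1) to the $\mathscr F$-multifunctor underlying a multimodel $M$ is the composite of the multimodel to $\mathrm{Mod}$ that corresponds to $M$ under (2) with the inclusion $\mathrm{Mod}\hookrightarrow\mathrm{Fun}$. -/

import Mathlib

open CategoryTheory Bicategory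

attribute [-instance] catToReflQuiver StrictBicategory.category

universe w v u w₁ v₁ u₁ w₂ v₂ u₂ w₃ v₃ u₃ w₄ v₄ u₄

/-- The set of weaknesses: strict, pseudo, lax, colax. -/
inductive Weakness
  | s | p | l | c

namespace Weakness

/-- The involution exchanging lax and colax. -/
def bar : Weakness → Weakness
  | s => s
  | p => p
  | l => c
  | c => l

/-- The partial order generated by `s ≤ p`, `p ≤ l` and `p ≤ c`. -/
instance : LE Weakness where
  le a b := a = b ∨ a = s ∨ (a = p ∧ b ≠ s)

end Weakness

/-- A `w`-cell between two objects `a`, `b` of a category. In the applications this category is the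
category of `1`-cells `X ⟶ Y` of a `2`-category, and `a` (top, then right) and `b` (left, then
bottom) are the two sides of a square. -/
inductive WCell {A : Type u} [Category.{v} A] : Weakness → A → A → Type (max u v)
  | strict {a b : A} (h : a = b) : WCell .s a b
  | pseudo {a b : A} (α : a ≅ b) : WCell .p a b
  | lax {a b : A} (α : a ⟶ b) : WCell .l a b
  | colax {a b : A} (α : b ⟶ a) : WCell .c a b

section

variable {B : Type u} [Bicategory.{w₁, v₁} B] [Bicategory.Strict B] {X Y Z V : B}

/-! Whiskering in strict `2`-categories. -/

theorem strict_comp_whiskerLeft (f : X ⟶ Y) (g : Y ⟶ Z) {a b : Z ⟶ V} (α : a ⟶ b) :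
    (f ≫ g) ◁ α = eqToHom (Strict.assoc _ _ _) ≫ (f ◁ g ◁ α) ≫
      eqToHom (Strict.assoc _ _ _).symm := by
  simp [Strict.associator_eqToIso]

theorem strict_whiskerRight_comp {a b : X ⟶ Y} (α : a ⟶ b) (f : Y ⟶ Z) (g : Z ⟶ V) :
    α ▷ (f ≫ g) = eqToHom (Strict.assoc _ _ _).symm ≫ ((α ▷ f) ▷ g) ≫
      eqToHom (Strict.assoc _ _ _) := by
  simp [Strict.associator_eqToIso]

theorem strict_whisker_assoc (f : X ⟶ Y) {a b : Y ⟶ Z} (α : a ⟶ b) (g : Z ⟶ V) :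
    (f ◁ α) ▷ g = eqToHom (Strict.assoc _ _ _) ≫ (f ◁ (α ▷ g)) ≫
      eqToHom (Strict.assoc _ _ _).symm := by
  simp [Strict.associator_eqToIso]

theorem strict_id_whiskerLeft {a b : X ⟶ Y} (α : a ⟶ b) :
    𝟙 X ◁ α = eqToHom (Strict.id_comp _) ≫ α ≫ eqToHom (Strict.id_comp _).symm := by
  simp [Strict.leftUnitor_eqToIso]

theorem strict_whiskerRight_id {a b : X ⟶ Y} (α : a ⟶ b) :
    α ▷ 𝟙 Y = eqToHom (Strict.comp_id _) ≫ α ≫ eqToHom (Strict.comp_id _).symm := by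
  simp [Strict.rightUnitor_eqToIso]

end

namespace WCell

section

variable {w w' : Weakness} {A : Type u} [Category.{v} A] {B : Type u₁} [Category.{v₁} B]

/-- The identity `w`-cell given by an equality. -/
def ofEq : {w : Weakness} → {a b : A} → (h : a = b) → WCell w a b
  | .s, _, _, h => strict h
  | .p, _, _, h => pseudo (eqToIso h)
  | .l, _, _, h => lax (eqToHom h)
  | .c, _, _, h => colax (eqToHom h.symm)

/-- Composition of `w`-cells. -/
def comp : {w : Weakness} → {a b d : A} → WCell w a b → WCell w b d → WCell w a d
  | _, _, _, _, strict h, strict h' => strict (h.trans h')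
  | _, _, _, _, pseudo α, pseudo β => pseudo (α ≪≫ β)
  | _, _, _, _, lax α, lax β => lax (α ≫ β)
  | _, _, _, _, colax α, colax β => colax (β ≫ α)

infixr:80 " ⊚ " => WCell.comp

/-- The image of a `w`-cell under a functor. -/
def map (F : A ⥤ B) : {w : Weakness} → {a b : A} → WCell w a b → WCell w (F.obj a) (F.obj b)
  | _, _, _, strict h => strict (congrArg F.obj h)
  | _, _, _, pseudo α => pseudo (F.mapIso α)
  | _, _, _, lax α => lax (F.map α)
  | _, _, _, colax α => colax (F.map α)

/-- For `w' ≤ w`, the property of a `w`-cell of being a `w'`-cell: it is an identity if `w' = s`,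
it is invertible if `w' = p`, and there is no condition if `w'` is `l` or `c` (so that `w' = w`). -/
def Is {a b : A} (x : WCell w a b) : Weakness → Prop
  | .s => ∃ h : a = b, x = ofEq h
  | .p => ∃ y : WCell w b a, x ⊚ y = ofEq rfl ∧ y ⊚ x = ofEq rfl
  | .l => True
  | .c => True

/-- Compatibility of `w`-cells `x` from `a` to `b` and `y` from `a'` to `b'` with `2`-cells
`P : a ⟶ a'` and `Q : b ⟶ b'`. -/
def Commutes : {w : Weakness} → {a b a' b' : A} → WCell w a b → WCell w a' b' → (a ⟶ a') →
    (b ⟶ b') → Prop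
  | _, _, _, _, _, strict h, strict h', P, Q => P ≫ eqToHom h' = eqToHom h ≫ Q
  | _, _, _, _, _, pseudo α, pseudo β, P, Q => P ≫ β.hom = α.hom ≫ Q
  | _, _, _, _, _, lax α, lax β, P, Q => P ≫ β = α ≫ Q
  | _, _, _, _, _, colax α, colax β, P, Q => Q ≫ β = α ≫ P

@[simp] theorem comp_assoc {a b d e : A} (x : WCell w a b) (y : WCell w b d) (z : WCell w d e) :
    (x ⊚ y) ⊚ z = x ⊚ y ⊚ z := by
  cases x <;> cases y <;> cases z <;> simp [comp]

@[simp] theorem ofEq_comp_ofEq {a b d : A} (h : a = b) (h' : b = d) :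
    (ofEq h : WCell w a b) ⊚ ofEq h' = ofEq (h.trans h') := by
  cases w <;> simp [comp, ofEq]

@[simp] theorem ofEq_comp_ofEq_assoc {a b d e : A} (h : a = b) (h' : b = d) (x : WCell w d e) :
    (ofEq h : WCell w a b) ⊚ ofEq h' ⊚ x = ofEq (h.trans h') ⊚ x := by
  rw [← comp_assoc, ofEq_comp_ofEq]

@[simp] theorem ofEq_rfl_comp {a b : A} (h : a = a) (x : WCell w a b) : ofEq h ⊚ x = x := by
  cases x <;> simp [comp, ofEq]

@[simp] theorem comp_ofEq_rfl {a b : A} (h : b = b) (x : WCell w a b) : x ⊚ ofEq h = x := by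
  cases x <;> simp [comp, ofEq]

@[simp] theorem map_comp (F : A ⥤ B) {a b d : A} (x : WCell w a b) (y : WCell w b d) :
    (x ⊚ y).map F = x.map F ⊚ y.map F := by
  cases x <;> cases y <;> simp [comp, map]

@[simp] theorem map_ofEq (F : A ⥤ B) {a b : A} (h : a = b) :
    (ofEq h : WCell w a b).map F = ofEq (congrArg F.obj h) := by
  subst h; cases w <;> simp [map, ofEq]

theorem map_congr {F G : A ⥤ B} (h : F = G) {a b : A} (x : WCell w a b) :
    x.map F = ofEq (by rw [h]) ⊚ x.map G ⊚ ofEq (by rw [h]) := by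
  subst h; simp

theorem map_map {D : Type u₂} [Category.{v₂} D] (F : A ⥤ B) (G : B ⥤ D) {a b : A}
    (x : WCell w a b) : (x.map F).map G = x.map (F ⋙ G) := by
  cases x <;> simp [map, Functor.mapIso]

theorem Is.ofEq {a b : A} (h : a = b) : (WCell.ofEq h : WCell w a b).Is w' := by
  subst h
  cases w'
  · exact ⟨rfl, rfl⟩
  · exact ⟨WCell.ofEq rfl, by simp, by simp⟩
  all_goals trivial

theorem Is.comp {a b d : A} {x : WCell w a b} {y : WCell w b d} (hx : x.Is w') (hy : y.Is w') :
    (x ⊚ y).Is w' := by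
  cases w'
  · obtain ⟨h, rfl⟩ := hx
    obtain ⟨h', rfl⟩ := hy
    exact ⟨h.trans h', by simp⟩
  · obtain ⟨x', h, h'⟩ := hx
    obtain ⟨y', k, k'⟩ := hy
    refine ⟨y' ⊚ x', ?_, ?_⟩
    · rw [comp_assoc, ← comp_assoc y, k, ofEq_rfl_comp, h]
    · rw [comp_assoc, ← comp_assoc x', h', ofEq_rfl_comp, k']
  all_goals trivial

theorem Is.map (F : A ⥤ B) {a b : A} {x : WCell w a b} (hx : x.Is w') : (x.map F).Is w' := by
  cases w'
  · obtain ⟨h, rfl⟩ := hx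
    exact ⟨congrArg F.obj h, by simp⟩
  · obtain ⟨x', h, h'⟩ := hx
    exact ⟨x'.map F, by rw [← map_comp, h, map_ofEq], by rw [← map_comp, h', map_ofEq]⟩
  all_goals trivial

theorem Commutes.refl {a b : A} (x : WCell w a b) : Commutes x x (𝟙 a) (𝟙 b) := by
  cases x <;> simp [Commutes]

theorem Commutes.comp_horiz {a b d a' b' d' : A} {x : WCell w a b} {y : WCell w a' b'}
    {x₂ : WCell w b d} {y₂ : WCell w b' d'} {P : a ⟶ a'} {Q : b ⟶ b'} {R : d ⟶ d'}
    (h : Commutes x y P Q) (h₂ : Commutes x₂ y₂ Q R) : Commutes (x ⊚ x₂) (y ⊚ y₂) P R := by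
  cases x <;> cases y <;> cases x₂ <;> cases y₂ <;> simp only [Commutes, WCell.comp] at *
  · rename_i h₃ h₄ h₅ h₆
    subst h₃ h₄ h₅ h₆
    simp_all
  · rw [Iso.trans_hom, Iso.trans_hom, ← Category.assoc, h, Category.assoc, h₂, Category.assoc]
  · rw [← Category.assoc, h, Category.assoc, h₂, Category.assoc]
  · rw [← Category.assoc, h₂, Category.assoc, h, Category.assoc]

theorem Commutes.comp_vert {a b a' b' a'' b'' : A} {x : WCell w a b} {y : WCell w a' b'}
    {z : WCell w a'' b''} {P : a ⟶ a'} {Q : b ⟶ b'} {P' : a' ⟶ a''} {Q' : b' ⟶ b''}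
    (h : Commutes x y P Q) (h' : Commutes y z P' Q') :
    Commutes x z (P ≫ P') (Q ≫ Q') := by
  cases x <;> cases y <;> cases z <;> simp only [Commutes, Category.assoc] at * <;>
    rw [h', ← Category.assoc, h, Category.assoc]

theorem Commutes.map (F : A ⥤ B) {a b a' b' : A} {x : WCell w a b} {y : WCell w a' b'}
    {P : a ⟶ a'} {Q : b ⟶ b'} (h : Commutes x y P Q) :
    Commutes (x.map F) (y.map F) (F.map P) (F.map Q) := by
  cases x <;> cases y <;> simp only [Commutes, WCell.map, Functor.mapIso_hom] at *
  · rename_i h₁ h₂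
    subst h₁ h₂
    simp_all
  all_goals rw [← F.map_comp, h, F.map_comp]

theorem Commutes.natural {F G : A ⥤ B} (τ : F ⟶ G) {a b : A} (x : WCell w a b) :
    Commutes (x.map F) (x.map G) (τ.app a) (τ.app b) := by
  cases x <;> simp [Commutes, WCell.map]
  rename_i h
  subst h
  simp

theorem Commutes.ofEq {a b a' b' : A} (h : a = b) (h' : a' = b') {P : a ⟶ a'} {Q : b ⟶ b'}
    (e : P ≫ eqToHom h' = eqToHom h ≫ Q) :
    Commutes (WCell.ofEq h : WCell w a b) (WCell.ofEq h') P Q := by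
  subst h h'
  cases w <;> simp_all [Commutes, WCell.ofEq]

/-- `2`-cells given by equalities commute with a `w`-cell transported along these. -/
theorem Commutes.eqToHom {a b a' b' : A} {x : WCell w a b} {y : WCell w a' b'}
    (h : a = a') (h' : b = b') (e : x ⊚ WCell.ofEq h' = WCell.ofEq h ⊚ y) :
    Commutes x y (eqToHom h) (eqToHom h') := by
  subst h h'
  simp only [comp_ofEq_rfl, ofEq_rfl_comp] at e
  subst e
  exact Commutes.refl x

end

section

variable {w w' : Weakness} {B : Type u} [Bicategory.{w₁, v₁} B]

/-- Whiskering of a `w`-cell by a `1`-cell on the left. -/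
def whiskerLeft {X Y Z : B} (f : X ⟶ Y) {a b : Y ⟶ Z} (x : WCell w a b) :
    WCell w (f ≫ a) (f ≫ b) := x.map (precomp Z f)

/-- Whiskering of a `w`-cell by a `1`-cell on the right. -/
def whiskerRight {X Y Z : B} {a b : X ⟶ Y} (x : WCell w a b) (g : Y ⟶ Z) :
    WCell w (a ≫ g) (b ≫ g) := x.map (postcomp X g)

infixr:81 " ◃ " => WCell.whiskerLeft
infixl:81 " ▹ " => WCell.whiskerRight

variable {X Y Z V : B}

theorem Is.whiskerLeft (f : X ⟶ Y) {a b : Y ⟶ Z} {x : WCell w a b} (h : x.Is w') :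
    (f ◃ x).Is w' := Is.map _ h

theorem Is.whiskerRight {a b : X ⟶ Y} {x : WCell w a b} (h : x.Is w') (g : Y ⟶ Z) :
    (x ▹ g).Is w' := Is.map _ h

@[simp] theorem whiskerLeft_comp (f : X ⟶ Y) {a b d : Y ⟶ Z} (x : WCell w a b) (y : WCell w b d) :
    f ◃ (x ⊚ y) = (f ◃ x) ⊚ (f ◃ y) := map_comp _ _ _

@[simp] theorem comp_whiskerRight {a b d : X ⟶ Y} (x : WCell w a b) (y : WCell w b d) (g : Y ⟶ Z) :
    (x ⊚ y) ▹ g = (x ▹ g) ⊚ (y ▹ g) := map_comp _ _ _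

@[simp] theorem whiskerLeft_ofEq (f : X ⟶ Y) {a b : Y ⟶ Z} (h : a = b) :
    f ◃ (ofEq h : WCell w a b) = ofEq (by rw [h]) := map_ofEq _ _

@[simp] theorem ofEq_whiskerRight {a b : X ⟶ Y} (h : a = b) (g : Y ⟶ Z) :
    (ofEq h : WCell w a b) ▹ g = ofEq (by rw [h]) := map_ofEq _ _

theorem exchange {a a' : X ⟶ Y} {b b' : Y ⟶ Z} (x : WCell w a a') (y : WCell w b b') :
    (x ▹ b) ⊚ (a' ◃ y) = (a ◃ y) ⊚ (x ▹ b') := by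
  cases x <;> cases y
  · rfl
  · exact congrArg pseudo (Iso.ext (whisker_exchange _ _).symm)
  · exact congrArg lax (whisker_exchange _ _).symm
  · exact congrArg colax (whisker_exchange _ _)

theorem whiskerLeft_congr {f g : X ⟶ Y} (h : f = g) {a b : Y ⟶ Z} (x : WCell w a b) :
    f ◃ x = ofEq (by rw [h]) ⊚ (g ◃ x) ⊚ ofEq (by rw [h]) := by
  subst h; simp

theorem whiskerRight_congr {f g : Y ⟶ Z} (h : f = g) {a b : X ⟶ Y} (x : WCell w a b) :
    x ▹ f = ofEq (by rw [h]) ⊚ (x ▹ g) ⊚ ofEq (by rw [h]) := by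
  subst h; simp

theorem Commutes.whiskerLeft {a b a' b' : Y ⟶ Z} {x : WCell w a b} {y : WCell w a' b'}
    {P : a ⟶ a'} {Q : b ⟶ b'} (f : X ⟶ Y) (h : Commutes x y P Q) :
    Commutes (f ◃ x) (f ◃ y) (f ◁ P) (f ◁ Q) := Commutes.map (precomp Z f) h

theorem Commutes.whiskerRight {a b a' b' : X ⟶ Y} {x : WCell w a b} {y : WCell w a' b'}
    {P : a ⟶ a'} {Q : b ⟶ b'} (h : Commutes x y P Q) (g : Y ⟶ Z) :
    Commutes (x ▹ g) (y ▹ g) (P ▷ g) (Q ▷ g) := Commutes.map (postcomp X g) h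

theorem Commutes.exchangeLeft {f f' : X ⟶ Y} (P : f ⟶ f') {a b : Y ⟶ Z} (x : WCell w a b) :
    Commutes (f ◃ x) (f' ◃ x) (P ▷ a) (P ▷ b) :=
  Commutes.natural ((precomposing X Y Z).map P) x

theorem Commutes.exchangeRight {f f' : Y ⟶ Z} (P : f ⟶ f') {a b : X ⟶ Y} (x : WCell w a b) :
    Commutes (x ▹ f) (x ▹ f') (a ◁ P) (b ◁ P) :=
  Commutes.natural ((postcomposing X Y Z).map P) x

variable [Bicategory.Strict B]

theorem comp_whiskerLeft (f : X ⟶ Y) (g : Y ⟶ Z) {a b : Z ⟶ V} (x : WCell w a b) :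
    (f ≫ g) ◃ x = ofEq (Strict.assoc _ _ _) ⊚ (f ◃ g ◃ x) ⊚ ofEq (Strict.assoc _ _ _).symm := by
  cases x
  · rfl
  · exact congrArg pseudo (Iso.ext (strict_comp_whiskerLeft f g _))
  · exact congrArg lax (strict_comp_whiskerLeft f g _)
  · exact congrArg colax ((strict_comp_whiskerLeft f g _).trans (Category.assoc _ _ _).symm)

theorem whiskerRight_comp {a b : X ⟶ Y} (x : WCell w a b) (f : Y ⟶ Z) (g : Z ⟶ V) :
    x ▹ (f ≫ g) = ofEq (Strict.assoc _ _ _).symm ⊚ ((x ▹ f) ▹ g) ⊚ ofEq (Strict.assoc _ _ _) := by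
  cases x
  · rfl
  · exact congrArg pseudo (Iso.ext (strict_whiskerRight_comp _ f g))
  · exact congrArg lax (strict_whiskerRight_comp _ f g)
  · exact congrArg colax ((strict_whiskerRight_comp _ f g).trans (Category.assoc _ _ _).symm)

theorem whisker_assoc (f : X ⟶ Y) {a b : Y ⟶ Z} (x : WCell w a b) (g : Z ⟶ V) :
    (f ◃ x) ▹ g = ofEq (Strict.assoc _ _ _) ⊚ (f ◃ (x ▹ g)) ⊚ ofEq (Strict.assoc _ _ _).symm := by
  cases x
  · rfl
  · exact congrArg pseudo (Iso.ext (strict_whisker_assoc f _ g))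
  · exact congrArg lax (strict_whisker_assoc f _ g)
  · exact congrArg colax ((strict_whisker_assoc f _ g).trans (Category.assoc _ _ _).symm)

theorem id_whiskerLeft {a b : X ⟶ Y} (x : WCell w a b) :
    𝟙 X ◃ x = ofEq (Strict.id_comp _) ⊚ x ⊚ ofEq (Strict.id_comp _).symm := by
  cases x
  · rfl
  · exact congrArg pseudo (Iso.ext (strict_id_whiskerLeft _))
  · exact congrArg lax (strict_id_whiskerLeft _)
  · exact congrArg colax ((strict_id_whiskerLeft _).trans (Category.assoc _ _ _).symm)

theorem whiskerRight_id {a b : X ⟶ Y} (x : WCell w a b) :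
    x ▹ 𝟙 Y = ofEq (Strict.comp_id _) ⊚ x ⊚ ofEq (Strict.comp_id _).symm := by
  cases x
  · rfl
  · exact congrArg pseudo (Iso.ext (strict_whiskerRight_id _))
  · exact congrArg lax (strict_whiskerRight_id _)
  · exact congrArg colax ((strict_whiskerRight_id _).trans (Category.assoc _ _ _).symm)

end
end WCell

/-- An `F`-category (enhanced `2`-category): a (strict) `2`-category, whose `1`-cells are the loose
morphisms, with a wide and locally full sub-`2`-category, whose `1`-cells are the tight
morphisms. -/
structure FCat where
  carrier : Type u
  [bicategory : Bicategory.{w, v} carrier]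
  [strict : Bicategory.Strict carrier]
  Tight : ∀ {X Y : carrier}, (X ⟶ Y) → Prop
  tight_id : ∀ X : carrier, Tight (𝟙 X)
  tight_comp : ∀ {X Y Z : carrier} {f : X ⟶ Y} {g : Y ⟶ Z}, Tight f → Tight g → Tight (f ≫ g)

instance : CoeSort FCat.{w, v, u} (Type u) := ⟨FCat.carrier⟩

attribute [instance] FCat.bicategory FCat.strict

/-- An `F`-functor: a (strict) `2`-functor preserving tightness. -/
structure FFunctor (A : FCat.{w₁, v₁, u₁}) (B : FCat.{w₂, v₂, u₂}) extends
    StrictPseudofunctorPreCore A B where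
  map_tight : ∀ {X Y : A} {f : X ⟶ Y}, A.Tight f → B.Tight (map f)

namespace FFunctor

variable {A : FCat.{w₁, v₁, u₁}} {B : FCat.{w₂, v₂, u₂}} {C : FCat.{w₃, v₃, u₃}}
  {D : FCat.{w₄, v₄, u₄}}

/-- The identity `F`-functor. -/
def id (A : FCat.{w₁, v₁, u₁}) : FFunctor A A where
  toPrelaxFunctor := PrelaxFunctor.id A
  map_id _ := rfl
  map_comp _ _ := rfl
  map₂_whisker_left _ _ _ _ := ((Category.id_comp _).trans (Category.comp_id _)).symm
  map₂_whisker_right _ _ := ((Category.id_comp _).trans (Category.comp_id _)).symm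
  map_tight h := h

/-- Composition of `F`-functors (in diagrammatic order). -/
def comp (F : FFunctor A B) (G : FFunctor B C) : FFunctor A C where
  toPrelaxFunctor := F.toPrelaxFunctor.comp G.toPrelaxFunctor
  map_id X := by
    change G.map (F.map _) = 𝟙 (G.obj (F.obj X))
    rw [F.map_id, G.map_id]
  map_comp f g := by
    change G.map (F.map _) = G.map (F.map f) ≫ G.map (F.map g)
    rw [F.map_comp, G.map_comp]
  map₂_whisker_left f _ _ η := by
    change G.map₂ (F.map₂ _) = _ ≫ G.map (F.map f) ◁ G.map₂ (F.map₂ η) ≫ _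
    rw [F.map₂_whisker_left]
    simp [PrelaxFunctor.map₂_eqToHom, G.map₂_whisker_left]
    rfl
  map₂_whisker_right η g := by
    change G.map₂ (F.map₂ _) = _ ≫ G.map₂ (F.map₂ η) ▷ G.map (F.map g) ≫ _
    rw [F.map₂_whisker_right]
    simp [PrelaxFunctor.map₂_eqToHom, G.map₂_whisker_right]
    rfl
  map_tight h := G.map_tight (F.map_tight h)

/-- The action of an `F`-functor on `w`-cells. -/
abbrev mapCell (F : FFunctor A B) {w : Weakness} {X Y : A} {f g : X ⟶ Y} (x : WCell w f g) :
    WCell w (F.map f) (F.map g) := x.map (F.mapFunctor X Y)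

theorem mapCell_whiskerLeft (F : FFunctor A B) {w : Weakness} {X Y Z : A} (f : X ⟶ Y)
    {a b : Y ⟶ Z} (x : WCell w a b) :
    F.mapCell (f ◃ x) = .ofEq (F.map_comp _ _) ⊚ (F.map f ◃ F.mapCell x) ⊚
      .ofEq (F.map_comp _ _).symm := by
  cases x
  · rfl
  · exact congrArg WCell.pseudo (Iso.ext (F.map₂_whisker_left _ _))
  · exact congrArg WCell.lax (F.map₂_whisker_left _ _)
  · exact congrArg WCell.colax ((F.map₂_whisker_left _ _).trans (Category.assoc _ _ _).symm)

theorem mapCell_whiskerRight (F : FFunctor A B) {w : Weakness} {X Y Z : A} {a b : X ⟶ Y}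
    (x : WCell w a b) (g : Y ⟶ Z) :
    F.mapCell (x ▹ g) = .ofEq (F.map_comp _ _) ⊚ (F.mapCell x ▹ F.map g) ⊚
      .ofEq (F.map_comp _ _).symm := by
  cases x
  · rfl
  · exact congrArg WCell.pseudo (Iso.ext (F.map₂_whisker_right _ _))
  · exact congrArg WCell.lax (F.map₂_whisker_right _ _)
  · exact congrArg WCell.colax ((F.map₂_whisker_right _ _).trans (Category.assoc _ _ _).symm)

end FFunctor

/-- A loose `(w', w)`-natural transformation between `F`-functors. The cell at `f : X ⟶ Y` fills
the square with top `app X`, right `G.map f`, left `F.map f` and bottom `app Y`; it is a `w`-cell,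
and a `w'`-cell if `f` is tight. -/
structure WTrans (w' w : Weakness) {A : FCat.{w₁, v₁, u₁}} {B : FCat.{w₂, v₂, u₂}}
    (F G : FFunctor A B) where
  app (X : A) : F.obj X ⟶ G.obj X
  cell {X Y : A} (f : X ⟶ Y) : WCell w (app X ≫ G.map f) (F.map f ≫ app Y)
  cell_is {X Y : A} (f : X ⟶ Y) : A.Tight f → (cell f).Is w'
  cell_id (X : A) : cell (𝟙 X) =
    .ofEq (by rw [F.map_id, G.map_id, Strict.comp_id, Strict.id_comp])
  cell_comp {X Y Z : A} (f : X ⟶ Y) (g : Y ⟶ Z) : cell (f ≫ g) =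
    .ofEq (by rw [G.map_comp, Strict.assoc]) ⊚ (cell f ▹ G.map g) ⊚ .ofEq (Strict.assoc _ _ _) ⊚
      (F.map f ◃ cell g) ⊚ .ofEq (by rw [F.map_comp, Strict.assoc])
  cell_naturality {X Y : A} {f g : X ⟶ Y} (σ : f ⟶ g) :
    (cell f).Commutes (cell g) (app X ◁ G.map₂ σ) (F.map₂ σ ▷ app Y)

namespace WTrans

variable {w' w : Weakness} {A : FCat.{w₁, v₁, u₁}} {B : FCat.{w₂, v₂, u₂}}
  {F G H K : FFunctor A B}

theorem ext' {φ ψ : WTrans w' w F G} (h : ∀ X, φ.app X = ψ.app X)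
    (h' : ∀ {X Y : A} (f : X ⟶ Y),
      φ.cell f = .ofEq (by rw [h]) ⊚ ψ.cell f ⊚ .ofEq (by rw [h])) : φ = ψ := by
  obtain ⟨a, c, _, _, _, _⟩ := φ
  obtain ⟨a', c', _, _, _, _⟩ := ψ
  obtain rfl : a = a' := funext h
  obtain rfl : @c = @c' := by
    funext X Y f
    simpa using h' f
  rfl

/-- A loose transformation is tight if its components are tight and its cells are `w'`-cells. -/
def IsTight (φ : WTrans w' w F G) : Prop :=
  (∀ X, B.Tight (φ.app X)) ∧ ∀ {X Y : A} (f : X ⟶ Y), (φ.cell f).Is w'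

/-- The identity transformation. -/
def id (F : FFunctor A B) : WTrans w' w F F where
  app X := 𝟙 (F.obj X)
  cell f := .ofEq (by rw [Strict.comp_id, Strict.id_comp])
  cell_is _ _ := .ofEq _
  cell_id _ := rfl
  cell_comp f g := by simp
  cell_naturality σ := by
    apply WCell.Commutes.ofEq
    simp [Strict.leftUnitor_eqToIso, Strict.rightUnitor_eqToIso]

/-- Composition of loose transformations, by pasting squares. -/
def comp (φ : WTrans w' w F G) (ψ : WTrans w' w G H) : WTrans w' w F H where
  app X := φ.app X ≫ ψ.app X
  cell {X Y} f := .ofEq (Strict.assoc _ _ _) ⊚ (φ.app X ◃ ψ.cell f) ⊚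
    .ofEq (Strict.assoc _ _ _).symm ⊚ (φ.cell f ▹ ψ.app Y) ⊚ .ofEq (Strict.assoc _ _ _)
  cell_is f hf := .comp (.ofEq _) (.comp (.whiskerLeft _ (ψ.cell_is f hf)) (.comp (.ofEq _)
    (.comp (.whiskerRight (φ.cell_is f hf) _) (.ofEq _))))
  cell_id X := by simp [φ.cell_id, ψ.cell_id]
  cell_comp {X Y Z} f g := by
    trans .ofEq (by simp [H.map_comp, Strict.assoc]) ⊚ (φ.app X ◃ ψ.cell f ▹ H.map g) ⊚
      .ofEq (by simp [Strict.assoc]) ⊚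
      (((φ.app X ≫ G.map f) ◃ ψ.cell g) ⊚ (φ.cell f ▹ (G.map g ≫ ψ.app Z))) ⊚
      .ofEq (by simp [Strict.assoc]) ⊚ (F.map f ◃ φ.cell g ▹ ψ.app Z) ⊚
      .ofEq (by simp [F.map_comp, Strict.assoc])
    · simp [φ.cell_comp, ψ.cell_comp, WCell.comp_whiskerLeft, WCell.whiskerRight_comp,
        WCell.whisker_assoc]
    · rw [← WCell.exchange]
      simp [WCell.comp_whiskerLeft, WCell.whiskerRight_comp, WCell.whisker_assoc]
  cell_naturality {X Y f g} σ := by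
    refine (WCell.Commutes.ofEq _ _ ?_).comp_horiz
      (((ψ.cell_naturality σ).whiskerLeft (φ.app X)).comp_horiz
      ((WCell.Commutes.ofEq _ _ ?_).comp_horiz
      (((φ.cell_naturality σ).whiskerRight (ψ.app Y)).comp_horiz
      (WCell.Commutes.ofEq _ _ ?_))))
    all_goals simp [Strict.associator_eqToIso]

theorem IsTight.id (F : FFunctor A B) : (WTrans.id F : WTrans w' w F F).IsTight :=
  ⟨fun _ => B.tight_id _, fun _ => .ofEq _⟩

theorem IsTight.comp {φ : WTrans w' w F G} {ψ : WTrans w' w G H} (hφ : φ.IsTight)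
    (hψ : ψ.IsTight) : (φ.comp ψ).IsTight :=
  ⟨fun X => B.tight_comp (hφ.1 X) (hψ.1 X), fun f => .comp (.ofEq _) (.comp
    (.whiskerLeft _ (hψ.2 f)) (.comp (.ofEq _) (.comp (.whiskerRight (hφ.2 f) _) (.ofEq _))))⟩

theorem id_comp (φ : WTrans w' w F G) : (id F).comp φ = φ :=
  ext' (fun _ => Strict.id_comp _) fun {X Y} f => by
    have e : .ofEq (Strict.assoc _ _ _) ⊚ (𝟙 (F.obj X) ◃ φ.cell f) ⊚
        .ofEq (Strict.assoc _ _ _).symm ⊚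
        ((.ofEq (by rw [Strict.comp_id, Strict.id_comp]) :
          WCell w (𝟙 (F.obj X) ≫ F.map f) (F.map f ≫ 𝟙 (F.obj Y))) ▹ φ.app Y) ⊚
        .ofEq (Strict.assoc _ _ _) =
        .ofEq (by rw [Strict.id_comp]) ⊚ φ.cell f ⊚ .ofEq (by rw [Strict.id_comp]) := by
      simp [WCell.id_whiskerLeft]
    exact e

theorem comp_id (φ : WTrans w' w F G) : φ.comp (id G) = φ :=
  ext' (fun _ => Strict.comp_id _) fun {X Y} f => by
    have e : .ofEq (Strict.assoc _ _ _) ⊚ (φ.app X ◃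
        (.ofEq (by rw [Strict.comp_id, Strict.id_comp]) :
          WCell w (𝟙 (G.obj X) ≫ G.map f) (G.map f ≫ 𝟙 (G.obj Y)))) ⊚
        .ofEq (Strict.assoc _ _ _).symm ⊚ (φ.cell f ▹ 𝟙 (G.obj Y)) ⊚
        .ofEq (Strict.assoc _ _ _) =
        .ofEq (by rw [Strict.comp_id]) ⊚ φ.cell f ⊚ .ofEq (by rw [Strict.comp_id]) := by
      simp [WCell.whiskerRight_id]
    exact e

theorem assoc (φ : WTrans w' w F G) (ψ : WTrans w' w G H) (χ : WTrans w' w H K) :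
    (φ.comp ψ).comp χ = φ.comp (ψ.comp χ) :=
  ext' (fun _ => Strict.assoc _ _ _) fun {X Y} f => by
    have e : .ofEq (Strict.assoc _ _ _) ⊚ ((φ.app X ≫ ψ.app X) ◃ χ.cell f) ⊚
        .ofEq (Strict.assoc _ _ _).symm ⊚ ((.ofEq (Strict.assoc _ _ _) ⊚ (φ.app X ◃ ψ.cell f) ⊚
          .ofEq (Strict.assoc _ _ _).symm ⊚ (φ.cell f ▹ ψ.app Y) ⊚
          .ofEq (Strict.assoc _ _ _)) ▹ χ.app Y) ⊚ .ofEq (Strict.assoc _ _ _) =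
        .ofEq (by simp only [Strict.assoc]) ⊚ (.ofEq (Strict.assoc _ _ _) ⊚
          (φ.app X ◃ (.ofEq (Strict.assoc _ _ _) ⊚ (ψ.app X ◃ χ.cell f) ⊚
          .ofEq (Strict.assoc _ _ _).symm ⊚ (ψ.cell f ▹ χ.app Y) ⊚
          .ofEq (Strict.assoc _ _ _))) ⊚ .ofEq (Strict.assoc _ _ _).symm ⊚
          (φ.cell f ▹ (ψ.app Y ≫ χ.app Y)) ⊚ .ofEq (Strict.assoc _ _ _)) ⊚
        .ofEq (by simp only [Strict.assoc]) := by
      simp [WCell.comp_whiskerLeft, WCell.whiskerRight_comp, WCell.whisker_assoc]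
    exact e

end WTrans

/-- Modifications between loose transformations. -/
@[ext]
structure Modif {w' w : Weakness} {A : FCat.{w₁, v₁, u₁}} {B : FCat.{w₂, v₂, u₂}}
    {F G : FFunctor A B} (φ ψ : WTrans w' w F G) where
  app (X : A) : φ.app X ⟶ ψ.app X
  comm {X Y : A} (f : X ⟶ Y) :
    (φ.cell f).Commutes (ψ.cell f) (app X ▷ G.map f) (F.map f ◁ app Y)

namespace Modif

variable {w' w : Weakness} {A : FCat.{w₁, v₁, u₁}} {B : FCat.{w₂, v₂, u₂}}
  {F G H : FFunctor A B}

instance category : Category (WTrans w' w F G) where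
  Hom φ ψ := Modif φ ψ
  id φ := ⟨fun X => 𝟙 (φ.app X), fun f => by simpa using WCell.Commutes.refl (φ.cell f)⟩
  comp μ ν := ⟨fun X => μ.app X ≫ ν.app X, fun f => by
    simpa using (μ.comm f).comp_vert (ν.comm f)⟩
  id_comp μ := Modif.ext (funext fun _ => Category.id_comp _)
  comp_id μ := Modif.ext (funext fun _ => Category.comp_id _)
  assoc μ ν ξ := Modif.ext (funext fun _ => Category.assoc _ _ _)

@[ext] theorem hom_ext {φ ψ : WTrans w' w F G} {μ ν : φ ⟶ ψ} (h : ∀ X, μ.app X = ν.app X) :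
    μ = ν := Modif.ext (funext h)

@[simp] theorem id_app (φ : WTrans w' w F G) (X : A) : Modif.app (𝟙 φ) X = 𝟙 (φ.app X) := rfl

@[simp] theorem comp_app {φ ψ χ : WTrans w' w F G} (μ : φ ⟶ ψ) (ν : ψ ⟶ χ) (X : A) :
    Modif.app (μ ≫ ν) X = μ.app X ≫ ν.app X := rfl

@[simp] theorem eqToHom_app {φ ψ : WTrans w' w F G} (h : φ = ψ) (X : A) :
    Modif.app (eqToHom h) X = eqToHom (by rw [h]) := by
  subst h; rfl

/-- Whiskering of a modification on the left. -/
def whiskerLeft (φ : WTrans w' w F G) {ψ χ : WTrans w' w G H} (μ : ψ ⟶ χ) :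
    φ.comp ψ ⟶ φ.comp χ where
  app X := φ.app X ◁ μ.app X
  comm {X Y} f := by
    refine (WCell.Commutes.ofEq _ _ ?_).comp_horiz
      (((μ.comm f).whiskerLeft (φ.app X)).comp_horiz
      ((WCell.Commutes.ofEq _ _ ?_).comp_horiz
      ((WCell.Commutes.exchangeRight (μ.app Y) (φ.cell f)).comp_horiz
      (WCell.Commutes.ofEq _ _ ?_))))
    all_goals simp [WTrans.comp, Strict.associator_eqToIso]

/-- Whiskering of a modification on the right. -/
def whiskerRight {φ ψ : WTrans w' w F G} (μ : φ ⟶ ψ) (χ : WTrans w' w G H) :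
    φ.comp χ ⟶ ψ.comp χ where
  app X := μ.app X ▷ χ.app X
  comm {X Y} f := by
    refine (WCell.Commutes.ofEq _ _ ?_).comp_horiz
      ((WCell.Commutes.exchangeLeft (μ.app X) (χ.cell f)).comp_horiz
      ((WCell.Commutes.ofEq _ _ ?_).comp_horiz
      (((μ.comm f).whiskerRight (χ.app Y)).comp_horiz
      (WCell.Commutes.ofEq _ _ ?_))))
    all_goals simp [WTrans.comp, Strict.associator_eqToIso]

end Modif

/-- The `2`-category of `F`-functors, loose `(w', w)`-natural transformations and modifications. -/
@[reducible] def funBicategory (w' w : Weakness) (A : FCat.{w₁, v₁, u₁}) (B : FCat.{w₂, v₂, u₂}) :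
    Bicategory.{max u₁ w₂, max u₁ v₁ w₂ v₂} (FFunctor A B) where
  Hom F G := WTrans w' w F G
  id := WTrans.id
  comp := WTrans.comp
  homCategory := fun _ _ => Modif.category
  whiskerLeft := Modif.whiskerLeft
  whiskerRight := Modif.whiskerRight
  associator := fun φ ψ χ => eqToIso (WTrans.assoc φ ψ χ)
  leftUnitor := fun φ => eqToIso (WTrans.id_comp φ)
  rightUnitor := fun φ => eqToIso (WTrans.comp_id φ)
  whiskerLeft_id := fun _ _ => Modif.hom_ext fun _ => Bicategory.whiskerLeft_id _ _
  whiskerLeft_comp := fun _ _ _ _ _ _ =>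
    Modif.hom_ext fun _ => Bicategory.whiskerLeft_comp _ _ _
  id_whiskerLeft := fun _ => Modif.hom_ext fun _ => by
    rw [Modif.comp_app, Modif.comp_app, eqToIso.hom, eqToIso.inv, Modif.eqToHom_app,
      Modif.eqToHom_app]
    exact strict_id_whiskerLeft _
  comp_whiskerLeft := fun _ _ _ _ _ => Modif.hom_ext fun _ => by
    rw [Modif.comp_app, Modif.comp_app, eqToIso.hom, eqToIso.inv, Modif.eqToHom_app,
      Modif.eqToHom_app]
    exact strict_comp_whiskerLeft _ _ _
  id_whiskerRight := fun _ _ => Modif.hom_ext fun _ => Bicategory.id_whiskerRight _ _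
  comp_whiskerRight := fun _ _ _ => Modif.hom_ext fun _ => Bicategory.comp_whiskerRight _ _ _
  whiskerRight_id := fun _ => Modif.hom_ext fun _ => by
    rw [Modif.comp_app, Modif.comp_app, eqToIso.hom, eqToIso.inv, Modif.eqToHom_app,
      Modif.eqToHom_app]
    exact strict_whiskerRight_id _
  whiskerRight_comp := fun _ _ _ => Modif.hom_ext fun _ => by
    rw [Modif.comp_app, Modif.comp_app, eqToIso.inv, eqToIso.hom, Modif.eqToHom_app,
      Modif.eqToHom_app]
    exact strict_whiskerRight_comp _ _ _
  whisker_assoc := fun _ _ _ _ _ => Modif.hom_ext fun _ => by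
    rw [Modif.comp_app, Modif.comp_app, eqToIso.hom, eqToIso.inv, Modif.eqToHom_app,
      Modif.eqToHom_app]
    exact strict_whisker_assoc _ _ _
  whisker_exchange := fun _ _ => Modif.hom_ext fun _ =>
    Bicategory.whisker_exchange (Modif.app _ _) (Modif.app _ _)
  pentagon := fun _ _ _ _ => Modif.hom_ext fun _ => by
    simp only [eqToIso.hom, Modif.comp_app, Modif.whiskerLeft, Modif.whiskerRight,
      Modif.eqToHom_app, eqToHom_whiskerRight, whiskerLeft_eqToHom]
    exact (congrArg (_ ≫ ·) (eqToHom_trans _ _)).trans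
      ((eqToHom_trans _ _).trans (eqToHom_trans _ _).symm)
  triangle := fun _ _ => Modif.hom_ext fun _ => by
    simp only [eqToIso.hom, Modif.comp_app, Modif.whiskerLeft, Modif.whiskerRight,
      Modif.eqToHom_app, eqToHom_whiskerRight, whiskerLeft_eqToHom]
    exact eqToHom_trans _ _

/-- The `F`-category of `F`-functors from `A` to `B`, loose `(w', w)`-natural transformations and
modifications. -/
def Fun (w' w : Weakness) (A : FCat.{w₁, v₁, u₁}) (B : FCat.{w₂, v₂, u₂}) :
    FCat.{max u₁ w₂, max u₁ v₁ w₂ v₂, max w₁ v₁ u₁ w₂ v₂ u₂} where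
  carrier := FFunctor A B
  bicategory := funBicategory w' w A B
  strict := letI := funBicategory w' w A B
    { id_comp := WTrans.id_comp
      comp_id := WTrans.comp_id
      assoc := WTrans.assoc
      leftUnitor_eqToIso := fun _ => rfl
      rightUnitor_eqToIso := fun _ => rfl
      associator_eqToIso := fun _ _ _ => rfl }
  Tight φ := WTrans.IsTight φ
  tight_id F := WTrans.IsTight.id F
  tight_comp := WTrans.IsTight.comp

/-! ### Multifunctors -/

/-- `Along i x y a b` says that the tuples `x` and `y` have `i`-th entries `a` and `b`, and that
their other entries agree. -/
structure Along {ι : Type} {S : ι → FCat.{w, v, u}} (i : ι) (x y : ∀ j, S j) (a b : S i) :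
    Prop where
  src : x i = a
  tgt : y i = b
  eq : ∀ j, j ≠ i → x j = y j

namespace Along

variable {ι : Type} {S : ι → FCat.{w, v, u}} {i : ι} {x y z : ∀ j, S j} {a b d : S i}

theorem trans (h : Along i x y a b) (h' : Along i y z b d) : Along i x z a d :=
  ⟨h.src, h'.tgt, fun j hj => (h.eq j hj).trans (h'.eq j hj)⟩

theorem ext (h : Along i x y a a) : x = y := by
  funext j
  by_cases hj : j = i
  · subst hj
    rw [h.src, h.tgt]
  · exact h.eq j hj

theorem update [DecidableEq ι] (x : ∀ j, S j) (a b : S i) :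
    Along i (Function.update x i a) (Function.update x i b) a b :=
  ⟨Function.update_self .., Function.update_self .., fun j hj => by
    rw [Function.update_of_ne hj, Function.update_of_ne hj]⟩

end Along

/-- A `(w', w)`-natural `F`-multifunctor from a family `S` of `F`-categories, indexed by a linear
order, to `C`. For a `1`-cell `f : a ⟶ b` of `S i`, and tuples `x`, `y` with entries `a`, `b` at `i`
which agree elsewhere, `map` gives the value of the `i`-th partial functor at `f`. For `i < j` and
`f : a ⟶ a'` in `S i`, `g : b ⟶ b'` in `S j`, there is a `w`-cell filling the square with top and
bottom given by `f`, and left and right given by `g`. -/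
structure Multifunctor (w' w : Weakness) {ι : Type} [LinearOrder ι] (S : ι → FCat.{w₁, v₁, u₁})
    (C : FCat.{w₂, v₂, u₂}) where
  obj : (∀ i, S i) → C
  -- The partial functors.
  map {i : ι} {x y : ∀ i, S i} {a b : S i} : Along i x y a b → (a ⟶ b) → (obj x ⟶ obj y)
  map₂ {i : ι} {x y : ∀ i, S i} {a b : S i} (h : Along i x y a b) {f g : a ⟶ b} :
    (f ⟶ g) → (map h f ⟶ map h g)
  map_id {i : ι} {x : ∀ i, S i} {a : S i} (h : Along i x x a a) : map h (𝟙 a) = 𝟙 (obj x)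
  map_comp {i : ι} {x y z : ∀ i, S i} {a b d : S i} (h : Along i x y a b) (h' : Along i y z b d)
    (f : a ⟶ b) (g : b ⟶ d) : map (h.trans h') (f ≫ g) = map h f ≫ map h' g
  map₂_id {i : ι} {x y : ∀ i, S i} {a b : S i} (h : Along i x y a b) (f : a ⟶ b) :
    map₂ h (𝟙 f) = 𝟙 (map h f)
  map₂_comp {i : ι} {x y : ∀ i, S i} {a b : S i} (h : Along i x y a b) {f g k : a ⟶ b}
    (σ : f ⟶ g) (τ : g ⟶ k) : map₂ h (σ ≫ τ) = map₂ h σ ≫ map₂ h τ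
  map₂_whisker_left {i : ι} {x y z : ∀ i, S i} {a b d : S i} (h : Along i x y a b)
    (h' : Along i y z b d) (f : a ⟶ b) {g k : b ⟶ d} (σ : g ⟶ k) :
    map₂ (h.trans h') (f ◁ σ) =
      eqToHom (map_comp h h' f g) ≫ map h f ◁ map₂ h' σ ≫ eqToHom (map_comp h h' f k).symm
  map₂_whisker_right {i : ι} {x y z : ∀ i, S i} {a b d : S i} (h : Along i x y a b)
    (h' : Along i y z b d) {f g : a ⟶ b} (σ : f ⟶ g) (k : b ⟶ d) :
    map₂ (h.trans h') (σ ▷ k) =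
      eqToHom (map_comp h h' f k) ≫ map₂ h σ ▷ map h' k ≫ eqToHom (map_comp h h' g k).symm
  map_tight {i : ι} {x y : ∀ i, S i} {a b : S i} (h : Along i x y a b) {f : a ⟶ b} :
    (S i).Tight f → C.Tight (map h f)
  -- The cells of the squares.
  cell {i j : ι} (hij : i < j) {x y z t : ∀ i, S i} {a a' : S i} {b b' : S j}
    (top : Along i x y a a') (right : Along j y t b b')
    (left : Along j x z b b') (bottom : Along i z t a a') (f : a ⟶ a') (g : b ⟶ b') :
    WCell w (map top f ≫ map right g) (map left g ≫ map bottom f)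
  cell_is {i j : ι} (hij : i < j) {x y z t : ∀ i, S i} {a a' : S i} {b b' : S j}
    (top : Along i x y a a') (right : Along j y t b b')
    (left : Along j x z b b') (bottom : Along i z t a a') (f : a ⟶ a') (g : b ⟶ b') :
    (S i).Tight f ∨ (S j).Tight g → (cell hij top right left bottom f g).Is w'
  -- The `w`-naturality in the second variable.
  cell_id_right {i j : ι} (hij : i < j) {x y : ∀ i, S i} {a a' : S i} {b : S j}
    (top : Along i x y a a') (right : Along j y y b b) (left : Along j x x b b) (f : a ⟶ a') :
    cell hij top right left top f (𝟙 b) =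
      .ofEq (by rw [map_id, map_id, Strict.comp_id, Strict.id_comp])
  cell_comp_right {i j : ι} (hij : i < j) {x y z t x' y' : ∀ i, S i} {a a' : S i} {b b' b'' : S j}
    (top : Along i x y a a') (right : Along j y t b b')
    (left : Along j x z b b') (middle : Along i z t a a') (right' : Along j t y' b' b'')
    (left' : Along j z x' b' b'') (bottom : Along i x' y' a a')
    (f : a ⟶ a') (g : b ⟶ b') (g' : b' ⟶ b'') :
    cell hij top (right.trans right') (left.trans left') bottom f (g ≫ g') =
      .ofEq (by rw [map_comp right right', Strict.assoc]) ⊚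
      (cell hij top right left middle f g ▹ map right' g') ⊚ .ofEq (Strict.assoc _ _ _) ⊚
      (map left g ◃ cell hij middle right' left' bottom f g') ⊚
      .ofEq (by rw [map_comp left left', Strict.assoc])
  cell_naturality_right {i j : ι} (hij : i < j) {x y z t : ∀ i, S i} {a a' : S i} {b b' : S j}
    (top : Along i x y a a') (right : Along j y t b b')
    (left : Along j x z b b') (bottom : Along i z t a a') (f : a ⟶ a') {g g' : b ⟶ b'}
    (τ : g ⟶ g') :
    (cell hij top right left bottom f g).Commutes (cell hij top right left bottom f g')
      (map top f ◁ map₂ right τ) (map₂ left τ ▷ map bottom f)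
  -- The `w.bar`-naturality in the first variable.
  cell_id_left {i j : ι} (hij : i < j) {x y : ∀ i, S i} {a : S i} {b b' : S j}
    (top : Along i x x a a) (left : Along j x y b b') (bottom : Along i y y a a) (g : b ⟶ b') :
    cell hij top left left bottom (𝟙 a) g =
      .ofEq (by rw [map_id, map_id, Strict.comp_id, Strict.id_comp])
  cell_comp_left {i j : ι} (hij : i < j) {x y z t x' y' : ∀ i, S i} {a a' a'' : S i} {b b' : S j}
    (top : Along i x y a a') (middle : Along j y t b b') (left : Along j x z b b')
    (bottom : Along i z t a a') (top' : Along i y x' a' a'') (right : Along j x' y' b b')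
    (bottom' : Along i t y' a' a'') (f : a ⟶ a') (f' : a' ⟶ a'') (g : b ⟶ b') :
    cell hij (top.trans top') right left (bottom.trans bottom') (f ≫ f') g =
      .ofEq (by rw [map_comp top top', Strict.assoc]) ⊚
      (map top f ◃ cell hij top' right middle bottom' f' g) ⊚ .ofEq (Strict.assoc _ _ _).symm ⊚
      (cell hij top middle left bottom f g ▹ map bottom' f') ⊚
      .ofEq (by rw [map_comp bottom bottom', Strict.assoc])
  cell_naturality_left {i j : ι} (hij : i < j) {x y z t : ∀ i, S i} {a a' : S i} {b b' : S j}
    (top : Along i x y a a') (right : Along j y t b b')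
    (left : Along j x z b b') (bottom : Along i z t a a') {f f' : a ⟶ a'} (g : b ⟶ b')
    (σ : f ⟶ f') :
    (cell hij top right left bottom f g).Commutes (cell hij top right left bottom f' g)
      (map₂ top σ ▷ map right g) (map left g ◁ map₂ bottom σ)
  -- The two pastings of the faces of a cube agree.
  cube {i j k : ι} (hij : i < j) (hjk : j < k) {a a' : S i} {b b' : S j} {d d' : S k}
    {x₀₀₀ x₁₀₀ x₀₁₀ x₁₁₀ x₀₀₁ x₁₀₁ x₀₁₁ x₁₁₁ : ∀ i, S i}
    (i₀₀ : Along i x₀₀₀ x₁₀₀ a a') (i₁₀ : Along i x₀₁₀ x₁₁₀ a a')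
    (i₀₁ : Along i x₀₀₁ x₁₀₁ a a') (i₁₁ : Along i x₀₁₁ x₁₁₁ a a')
    (j₀₀ : Along j x₀₀₀ x₀₁₀ b b') (j₁₀ : Along j x₁₀₀ x₁₁₀ b b')
    (j₀₁ : Along j x₀₀₁ x₀₁₁ b b') (j₁₁ : Along j x₁₀₁ x₁₁₁ b b')
    (k₀₀ : Along k x₀₀₀ x₀₀₁ d d') (k₁₀ : Along k x₁₀₀ x₁₀₁ d d')
    (k₀₁ : Along k x₀₁₀ x₀₁₁ d d') (k₁₁ : Along k x₁₁₀ x₁₁₁ d d')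
    (f : a ⟶ a') (g : b ⟶ b') (h : d ⟶ d') :
    .ofEq (Strict.assoc _ _ _).symm ⊚ (cell hij i₀₀ j₁₀ j₀₀ i₁₀ f g ▹ map k₁₁ h) ⊚
      .ofEq (Strict.assoc _ _ _) ⊚
      (map j₀₀ g ◃ cell (hij.trans hjk) i₁₀ k₁₁ k₀₁ i₁₁ f h) ⊚ .ofEq (Strict.assoc _ _ _).symm ⊚
      (cell hjk j₀₀ k₀₁ k₀₀ j₀₁ g h ▹ map i₁₁ f) ⊚ .ofEq (Strict.assoc _ _ _) =
    (map i₀₀ f ◃ cell hjk j₁₀ k₁₁ k₁₀ j₁₁ g h) ⊚ .ofEq (Strict.assoc _ _ _).symm ⊚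
      (cell (hij.trans hjk) i₀₀ k₁₀ k₀₀ i₀₁ f h ▹ map j₁₁ g) ⊚ .ofEq (Strict.assoc _ _ _) ⊚
      (map k₀₀ h ◃ cell hij i₀₁ j₁₁ j₀₁ i₁₁ f g)

namespace Multifunctor

variable {w' w : Weakness} {ι : Type} [LinearOrder ι] {S : ι → FCat.{w₁, v₁, u₁}}
  {C : FCat.{w₂, v₂, u₂}}

theorem map_heq (M : Multifunctor w' w S C) {i : ι} {x y x₂ y₂ : ∀ i, S i} {a b a₂ b₂ : S i}
    (h : Along i x y a b) (h' : Along i x₂ y₂ a₂ b₂) {f : a ⟶ b} {g : a₂ ⟶ b₂} (hx : x = x₂)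
    (hy : y = y₂) (hf : HEq f g) : HEq (M.map h f) (M.map h' g) := by
  subst hx hy
  obtain rfl := h.src.symm.trans h'.src
  obtain rfl := h.tgt.symm.trans h'.tgt
  obtain rfl := eq_of_heq hf
  rfl

theorem map_eq (M : Multifunctor w' w S C) {i : ι} {x y : ∀ i, S i} {a b a₂ b₂ : S i}
    (h : Along i x y a b) (h' : Along i x y a₂ b₂) {f : a ⟶ b} {g : a₂ ⟶ b₂} (hf : HEq f g) :
    M.map h f = M.map h' g := eq_of_heq (M.map_heq h h' rfl rfl hf)

theorem cell_congr (M : Multifunctor w' w S C) {i j : ι} (hij : i < j)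
    {x y z t : ∀ i, S i} {a a' a₂ a₂' : S i} {b b' b₂ b₂' : S j}
    (top : Along i x y a a') (right : Along j y t b b')
    (left : Along j x z b b') (bottom : Along i z t a a')
    (top' : Along i x y a₂ a₂') (right' : Along j y t b₂ b₂')
    (left' : Along j x z b₂ b₂') (bottom' : Along i z t a₂ a₂')
    {f : a ⟶ a'} {g : b ⟶ b'} {f₂ : a₂ ⟶ a₂'} {g₂ : b₂ ⟶ b₂'} (hf : HEq f f₂) (hg : HEq g g₂) :
    M.cell hij top right left bottom f g =
      .ofEq (by rw [M.map_eq top top' hf, M.map_eq right right' hg]) ⊚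
      M.cell hij top' right' left' bottom' f₂ g₂ ⊚
      .ofEq (by rw [M.map_eq bottom bottom' hf, M.map_eq left left' hg]) := by
  obtain rfl := top.src.symm.trans top'.src
  obtain rfl := top.tgt.symm.trans top'.tgt
  obtain rfl := right.src.symm.trans right'.src
  obtain rfl := right.tgt.symm.trans right'.tgt
  obtain rfl := eq_of_heq hf
  obtain rfl := eq_of_heq hg
  simp

/-- The functor between categories of `1`-cells given by a multifunctor. -/
abbrev mapFunctor (M : Multifunctor w' w S C) {i : ι} {x y : ∀ i, S i} {a b : S i}
    (h : Along i x y a b) : (a ⟶ b) ⥤ (M.obj x ⟶ M.obj y) where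
  obj := M.map h
  map := M.map₂ h
  map_id := M.map₂_id h
  map_comp := M.map₂_comp h

theorem mapFunctor_whiskerLeft (M : Multifunctor w' w S C) {i : ι} {x y z : ∀ i, S i} {a b d : S i}
    (h : Along i x y a b) (h' : Along i y z b d) (f : a ⟶ b) {p q : b ⟶ d} (c : WCell w p q) :
    (f ◃ c).map (M.mapFunctor (h.trans h')) = .ofEq (M.map_comp _ _ _ _) ⊚
      (M.map h f ◃ c.map (M.mapFunctor h')) ⊚ .ofEq (M.map_comp _ _ _ _).symm := by
  cases c
  · rfl
  · exact congrArg WCell.pseudo (Iso.ext (M.map₂_whisker_left _ _ _ _))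
  · exact congrArg WCell.lax (M.map₂_whisker_left _ _ _ _)
  · exact congrArg WCell.colax ((M.map₂_whisker_left _ _ _ _).trans (Category.assoc _ _ _).symm)

theorem mapFunctor_whiskerRight (M : Multifunctor w' w S C) {i : ι} {x y z : ∀ i, S i}
    {a b d : S i} (h : Along i x y a b) (h' : Along i y z b d) {p q : a ⟶ b} (c : WCell w p q)
    (g : b ⟶ d) :
    (c ▹ g).map (M.mapFunctor (h.trans h')) = .ofEq (M.map_comp _ _ _ _) ⊚
      (c.map (M.mapFunctor h) ▹ M.map h' g) ⊚ .ofEq (M.map_comp _ _ _ _).symm := by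
  cases c
  · rfl
  · exact congrArg WCell.pseudo (Iso.ext (M.map₂_whisker_right _ _ _ _))
  · exact congrArg WCell.lax (M.map₂_whisker_right _ _ _ _)
  · exact congrArg WCell.colax ((M.map₂_whisker_right _ _ _ _).trans (Category.assoc _ _ _).symm)

theorem ext_heq {M N : Multifunctor w' w S C} (ho : M.obj = N.obj)
    (hm : ∀ {i : ι} {x y : ∀ i, S i} {a b : S i} (h : Along i x y a b) (f : a ⟶ b),
      HEq (M.map h f) (N.map h f))
    (h₂ : ∀ {i : ι} {x y : ∀ i, S i} {a b : S i} (h : Along i x y a b) {f g : a ⟶ b} (σ : f ⟶ g),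
      HEq (M.map₂ h σ) (N.map₂ h σ))
    (hc : ∀ {i j : ι} (hij : i < j) {x y z t : ∀ i, S i} {a a' : S i} {b b' : S j}
      (top : Along i x y a a') (right : Along j y t b b')
      (left : Along j x z b b') (bottom : Along i z t a a') (f : a ⟶ a') (g : b ⟶ b'),
      HEq (M.cell hij top right left bottom f g) (N.cell hij top right left bottom f g)) :
    M = N := by
  cases M with
  | mk o m m₂ _ _ _ _ _ _ _ c =>
  cases N with
  | mk o' m' m₂' _ _ _ _ _ _ _ c' =>
  obtain rfl : o = o' := ho
  obtain rfl : @m = @m' := by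
    funext i x y a b h f
    exact eq_of_heq (hm h f)
  obtain rfl : @m₂ = @m₂' := by
    funext i x y a b h f g σ
    exact eq_of_heq (h₂ h σ)
  obtain rfl : @c = @c' := by
    funext i j hij x y z t a a' b b' top right left bottom f g
    exact eq_of_heq (hc hij top right left bottom f g)
  rfl

/-! Reindexing along an isomorphism of linear orders. -/

/-- The transport along an equality of indices. -/
def transport {κ : Type} (T : κ → FCat.{w₁, v₁, u₁}) {k k' : κ} (h : k = k') :
    FFunctor (T k) (T k') := h ▸ FFunctor.id (T k)

theorem _root_.Along.transport {κ : Type} {T : κ → FCat.{w₁, v₁, u₁}} {k k' : κ} (h : k = k')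
    {x y : ∀ k, T k} {a b : T k} (hx : Along k x y a b) :
    Along k' x y ((Multifunctor.transport T h).obj a) ((Multifunctor.transport T h).obj b) := by
  subst h; exact hx

theorem _root_.Along.comp_equiv {κ : Type} {T : κ → FCat.{w₁, v₁, u₁}} (e : ι ≃ κ) {i : ι}
    {x y : ∀ k, T k} {a b : T (e i)} (h : Along (e i) x y a b) :
    Along (S := fun i => T (e i)) i (fun i => x (e i)) (fun i => y (e i)) a b :=
  ⟨h.src, h.tgt, fun j hj => h.eq (e j) fun h' => hj (e.injective h')⟩


end Multifunctor

section Reindex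

variable {w' w : Weakness} {ι κ : Type} [LinearOrder ι] [LinearOrder κ]
  {T : κ → FCat.{w₁, v₁, u₁}} {C : FCat.{w₂, v₂, u₂}}

theorem Along.at (e : ι ≃o κ) {k : κ} {i : ι} (hk : k = e i) {x y : ∀ k, T k} {a b : T k}
    (h : Along k x y a b) : Along (S := fun i => T (e i)) i (fun i => x (e i))
      (fun i => y (e i)) ((Multifunctor.transport T hk).obj a)
      ((Multifunctor.transport T hk).obj b) :=
  (h.transport hk).comp_equiv e.toEquiv

namespace Multifunctor

variable (e : ι ≃o κ) (M : Multifunctor w' w (fun i => T (e i)) C)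

/-- The action of `M` on `1`-cells of `T k`, for `k = e i`. -/
def mapAt {k : κ} {i : ι} (hk : k = e i) {x y : ∀ k, T k} {a b : T k} (h : Along k x y a b)
    (f : a ⟶ b) : (M.obj fun i => x (e i)) ⟶ M.obj fun i => y (e i) :=
  M.map (h.at e hk) ((transport T hk).map f)

/-- The action of `M` on `2`-cells of `T k`, for `k = e i`. -/
def map₂At {k : κ} {i : ι} (hk : k = e i) {x y : ∀ k, T k} {a b : T k} (h : Along k x y a b)
    {f g : a ⟶ b} (σ : f ⟶ g) : M.mapAt e hk h f ⟶ M.mapAt e hk h g :=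
  M.map₂ (h.at e hk) ((transport T hk).map₂ σ)

/-- The cells of `M` for `1`-cells of `T k` and `T l`, for `k = e i` and `l = e j`. -/
def cellAt {k l : κ} {i j : ι} (hk : k = e i) (hl : l = e j) (hij : i < j)
    {x y z t : ∀ k, T k} {a a' : T k} {b b' : T l} (top : Along k x y a a')
    (right : Along l y t b b') (left : Along l x z b b') (bottom : Along k z t a a')
    (f : a ⟶ a') (g : b ⟶ b') :
    WCell w (M.mapAt e hk top f ≫ M.mapAt e hl right g)
      (M.mapAt e hl left g ≫ M.mapAt e hk bottom f) :=
  M.cell hij (top.at e hk) (right.at e hl) (left.at e hl) (bottom.at e hk) _ _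

theorem mapAt_id {k : κ} {i : ι} (hk : k = e i) {x : ∀ k, T k} {a : T k} (h : Along k x x a a) :
    M.mapAt e hk h (𝟙 a) = 𝟙 _ := by
  subst hk; exact M.map_id _

theorem mapAt_comp {k : κ} {i : ι} (hk : k = e i) {x y z : ∀ k, T k} {a b d : T k}
    (h : Along k x y a b) (h' : Along k y z b d) (f : a ⟶ b) (g : b ⟶ d) :
    M.mapAt e hk (h.trans h') (f ≫ g) = M.mapAt e hk h f ≫ M.mapAt e hk h' g := by
  subst hk; exact M.map_comp (h.at e rfl) (h'.at e rfl) f g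

/-- Reindexing along an isomorphism of linear orders. -/
def reindex : Multifunctor w' w T C where
  obj x := M.obj fun i => x (e i)
  map h f := M.mapAt e (e.apply_symm_apply _).symm h f
  map₂ h _ _ σ := M.map₂At e (e.apply_symm_apply _).symm h σ
  map_id := M.mapAt_id e _
  map_comp := M.mapAt_comp e _
  map₂_id {k} _ _ _ _ := by
    generalize_proofs hk
    generalize e.symm k = i at hk
    subst hk
    exact fun h => M.map₂_id (h.at e rfl)
  map₂_comp {k} _ _ _ _ := by
    generalize_proofs hk
    generalize e.symm k = i at hk
    subst hk
    exact fun h => M.map₂_comp (h.at e rfl)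
  map₂_whisker_left {k} _ _ _ _ _ _ := by
    generalize_proofs hk
    generalize e.symm k = i at hk
    subst hk
    exact fun h h' => M.map₂_whisker_left (h.at e rfl) (h'.at e rfl)
  map₂_whisker_right {k} _ _ _ _ _ _ := by
    generalize_proofs hk
    generalize e.symm k = i at hk
    subst hk
    exact fun h h' _ _ => M.map₂_whisker_right (h.at e rfl) (h'.at e rfl)
  map_tight h _ hf := M.map_tight _ (FFunctor.map_tight _ hf)
  cell hij _ _ _ _ _ _ _ _ top right left bottom f g :=
    M.cellAt e (e.apply_symm_apply _).symm (e.apply_symm_apply _).symm (e.symm.strictMono hij)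
      top right left bottom f g
  cell_is hij _ _ _ _ _ _ _ _ top right left bottom f g h :=
    M.cell_is _ _ _ _ _ _ _ (h.imp (FFunctor.map_tight _) (FFunctor.map_tight _))
  cell_id_right {k l} hij _ _ _ _ _ := by
    generalize_proofs hk hl h
    generalize e.symm k = i at hk h
    generalize e.symm l = j at hl h
    subst hk hl
    exact fun top right left => M.cell_id_right h (top.at e rfl) (right.at e rfl) (left.at e rfl)
  cell_comp_right {k l} hij _ _ _ _ _ _ _ _ _ _ _ := by
    generalize_proofs hk hl _ _ h
    generalize e.symm k = i at hk h
    generalize e.symm l = j at hl h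
    subst hk hl
    exact fun top right left middle right' left' bottom => M.cell_comp_right h (top.at e rfl)
      (right.at e rfl) (left.at e rfl) (middle.at e rfl) (right'.at e rfl) (left'.at e rfl)
      (bottom.at e rfl)
  cell_naturality_right {k l} hij _ _ _ _ _ _ _ _ := by
    generalize_proofs hk hl h
    generalize e.symm k = i at hk h
    generalize e.symm l = j at hl h
    subst hk hl
    exact fun top right left bottom f _ _ => M.cell_naturality_right h (top.at e rfl)
      (right.at e rfl) (left.at e rfl) (bottom.at e rfl) f
  cell_id_left {k l} hij _ _ _ _ _ := by
    generalize_proofs hk hl h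
    generalize e.symm k = i at hk h
    generalize e.symm l = j at hl h
    subst hk hl
    exact fun top left bottom => M.cell_id_left h (top.at e rfl) (left.at e rfl) (bottom.at e rfl)
  cell_comp_left {k l} hij _ _ _ _ _ _ _ _ _ _ _ := by
    generalize_proofs hk _ hl _ h
    generalize e.symm k = i at hk h
    generalize e.symm l = j at hl h
    subst hk hl
    exact fun top middle left bottom top' right bottom' => M.cell_comp_left h (top.at e rfl)
      (middle.at e rfl) (left.at e rfl) (bottom.at e rfl) (top'.at e rfl) (right.at e rfl)
      (bottom'.at e rfl)
  cell_naturality_left {k l} hij _ _ _ _ _ _ _ _ := by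
    generalize_proofs hk hl h
    generalize e.symm k = i at hk h
    generalize e.symm l = j at hl h
    subst hk hl
    exact fun top right left bottom _ _ g => M.cell_naturality_left h (top.at e rfl)
      (right.at e rfl) (left.at e rfl) (bottom.at e rfl) g
  cube hij hjk _ _ _ _ _ _ _ _ _ _ _ _ _ _ i₀₀ i₁₀ i₀₁ i₁₁ j₀₀ j₁₀ j₀₁ j₁₁ k₀₀ k₁₀ k₀₁ k₁₁
      f g h :=
    M.cube _ _ (i₀₀.at e _) (i₁₀.at e _) (i₀₁.at e _) (i₁₁.at e _) (j₀₀.at e _)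
      (j₁₀.at e _) (j₀₁.at e _) (j₁₁.at e _) (k₀₀.at e _) (k₁₀.at e _)
      (k₀₁.at e _) (k₁₁.at e _) _ _ _

theorem reindex_map {i : ι} {x y : ∀ k, T k} {a b : T (e i)} (h : Along (e i) x y a b)
    (f : a ⟶ b) : (M.reindex e).map h f = M.map (h.at e rfl) f := by
  change M.mapAt e _ h f = M.mapAt e rfl h f
  congr 1
  simp

theorem reindex_map₂ {i : ι} {x y : ∀ k, T k} {a b : T (e i)} (h : Along (e i) x y a b)
    {f g : a ⟶ b} (σ : f ⟶ g) : HEq ((M.reindex e).map₂ h σ) (M.map₂ (h.at e rfl) σ) := by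
  have (i' : ι) (hk : e i = e i') : HEq (M.map₂At e hk h σ) (M.map₂ (h.at e rfl) σ) := by
    obtain rfl := e.injective hk
    rfl
  exact this _ _

theorem reindex_cell {i j : ι} (hij : i < j) (hij' : e i < e j) {x y z t : ∀ k, T k}
    {a a' : T (e i)} {b b' : T (e j)} (top : Along (e i) x y a a')
    (right : Along (e j) y t b b') (left : Along (e j) x z b b') (bottom : Along (e i) z t a a')
    (f : a ⟶ a') (g : b ⟶ b') :
    HEq ((M.reindex e).cell hij' top right left bottom f g)
      (M.cell hij (top.at e rfl) (right.at e rfl) (left.at e rfl) (bottom.at e rfl) f g) := by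
  have (i' j' : ι) (hk : e i = e i') (hl : e j = e j') (h : i' < j') :
      HEq (M.cellAt e hk hl h top right left bottom f g)
        (M.cell hij (top.at e rfl) (right.at e rfl) (left.at e rfl) (bottom.at e rfl) f g) := by
    obtain rfl := e.injective hk
    obtain rfl := e.injective hl
    rfl
  exact this _ _ _ _ _

end Multifunctor

end Reindex

theorem WCell.heq {w : Weakness} {A : Type u} [Category.{v} A] {a b a' b' : A} {x : WCell w a b}
    {y : WCell w a' b'} (h : a = a') (h' : b' = b) (e : x = .ofEq h ⊚ y ⊚ .ofEq h') : HEq x y := by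
  subst h h'
  simpa using e

theorem WCell.eq_of_heq {w : Weakness} {A : Type u} [Category.{v} A] {a b a' b' : A}
    {x : WCell w a b} {y : WCell w a' b'} (h : a = a') (h' : b' = b) (e : HEq x y) :
    x = .ofEq h ⊚ y ⊚ .ofEq h' := by
  subst h h'
  simpa using e

/-- The lexicographic sum of a family of linear orders. -/
@[ext]
structure LexSum {κ : Type} (I : κ → Type) where
  fst : κ
  snd : I fst

namespace LexSum

variable {κ : Type} {I : κ → Type}

/-- The underlying set of a lexicographic sum. -/
def equiv (I : κ → Type) : LexSum I ≃ Lex (Σ j, I j) where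
  toFun p := toLex ⟨p.fst, p.snd⟩
  invFun p := ⟨(ofLex p).1, (ofLex p).2⟩
  left_inv _ := rfl
  right_inv _ := rfl

instance [LinearOrder κ] [∀ j, LinearOrder (I j)] : LinearOrder (LexSum I) :=
  LinearOrder.lift' (equiv I) (equiv I).injective

instance [Finite κ] [∀ j, Finite (I j)] : Finite (LexSum I) :=
  Finite.of_injective (fun p => (⟨p.fst, p.snd⟩ : Σ j, I j)) (equiv I).injective

variable [LinearOrder κ] [∀ j, LinearOrder (I j)]

theorem lt_iff {p q : LexSum I} :
    p < q ↔ p.fst < q.fst ∨ ∃ h : p.fst = q.fst, h ▸ p.snd < q.snd := Sigma.Lex.lt_def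

theorem mk_lt_mk {j : κ} {i i' : I j} : (⟨j, i⟩ : LexSum I) < ⟨j, i'⟩ ↔ i < i' :=
  lt_iff.trans (by simp)

theorem mk_lt_mk_of_lt {j j' : κ} (h : j < j') (i : I j) (i' : I j') :
    (⟨j, i⟩ : LexSum I) < ⟨j', i'⟩ := lt_iff.2 (.inl h)

theorem lt_cases {j j' : κ} {i : I j} {i' : I j'} (h : (⟨j, i⟩ : LexSum I) < ⟨j', i'⟩) :
    j < j' ∨ ∃ h : j = j', h ▸ i < i' := lt_iff.1 h

/-- The lexicographic sum of a single linear order. -/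
noncomputable def single (ι : Type) [LinearOrder ι] : LexSum (fun _ : Unit => ι) ≃o ι :=
  StrictMono.orderIsoOfSurjective (fun p => p.snd)
    (fun _ _ h => (lt_iff.1 h).elim (fun h => absurd h (lt_irrefl _)) fun h => h.2)
    fun i => ⟨⟨(), i⟩, rfl⟩

/-- The lexicographic sum of a family of one-element linear orders. -/
noncomputable def singletons (κ : Type) [LinearOrder κ] : LexSum (fun _ : κ => Unit) ≃o κ :=
  StrictMono.orderIsoOfSurjective (fun p => p.fst)
    (fun _ _ h => (lt_iff.1 h).elim id fun h => absurd h.2 (lt_irrefl _))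
    fun j => ⟨⟨j, ()⟩, rfl⟩

/-- The associativity of lexicographic sums. -/
noncomputable def assoc {ι μ : Type} [LinearOrder ι] [LinearOrder μ] {J : μ → Type}
    [∀ m, LinearOrder (J m)] (e : LexSum I ≃o ι) (d : LexSum J ≃o κ) :
    LexSum (fun m => LexSum fun k : J m => I (d ⟨m, k⟩)) ≃o ι :=
  StrictMono.orderIsoOfSurjective (fun p => e ⟨d ⟨p.fst, p.snd.fst⟩, p.snd.snd⟩) (by
    rintro ⟨m, k, i⟩ ⟨m', k', i'⟩ h
    refine e.strictMono ?_
    obtain h | ⟨rfl, h⟩ := lt_cases h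
    · exact mk_lt_mk_of_lt (d.strictMono (mk_lt_mk_of_lt h _ _)) _ _
    · obtain h | ⟨rfl, h⟩ := lt_cases h
      · exact mk_lt_mk_of_lt (d.strictMono (mk_lt_mk.2 h)) _ _
      · exact mk_lt_mk.2 h) (by
    intro i
    obtain ⟨⟨j, i⟩, rfl⟩ := e.surjective i
    obtain ⟨⟨m, k⟩, rfl⟩ := d.surjective j
    exact ⟨⟨m, k, i⟩, rfl⟩)

end LexSum

/-- A natural family of `w`-cells is natural with respect to `w`-cells. -/
theorem WCell.natural {w : Weakness} {A : Type u} [Category.{v} A] {D : Type u₁} [Category.{v₁} D]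
    (P Q : D ⥤ A) (x : ∀ d, WCell w (P.obj d) (Q.obj d))
    (hx : ∀ {d d' : D} (τ : d ⟶ d'), (x d).Commutes (x d') (P.map τ) (Q.map τ))
    {d d' : D} (y : WCell w d d') : x d ⊚ y.map Q = y.map P ⊚ x d' := by
  cases y with
  | strict h =>
    subst h
    have e (F : D ⥤ A) : (WCell.strict (rfl : d = d)).map F = .ofEq rfl := rfl
    rw [e, e]
    simp
  | pseudo α =>
    have := hx α.hom
    revert this
    cases x d with | pseudo β =>
    cases x d' with | pseudo γ =>
    intro this
    exact congrArg WCell.pseudo (Iso.ext this.symm)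
  | lax α =>
    have := hx α
    revert this
    cases x d with | lax β =>
    cases x d' with | lax γ =>
    intro this
    exact congrArg WCell.lax this.symm
  | colax α =>
    have := hx α
    revert this
    cases x d with | colax β =>
    cases x d' with | colax γ =>
    intro this
    exact congrArg WCell.colax this

theorem whiskerRight_congr {B : Type u} [Bicategory.{w₁, v₁} B] {X Y Z : B} {a b : X ⟶ Y}
    (σ : a ⟶ b) {k k' : Y ⟶ Z} (h : k = k') :
    σ ▷ k = eqToHom (by rw [h]) ≫ σ ▷ k' ≫ eqToHom (by rw [h]) := by
  subst h; simp

section Comp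

set_option linter.unusedSectionVars false
set_option linter.unusedVariables false

variable {w' w : Weakness} {κ : Type} [LinearOrder κ] {I : κ → Type} [∀ j, LinearOrder (I j)]
  {S : LexSum I → FCat.{w₁, v₁, u₁}} {T : κ → FCat.{w₂, v₂, u₂}} {C : FCat.{w₃, v₃, u₃}}

theorem Along.inner {j : κ} {i : I j} {x y : ∀ p, S p} {a b : S (⟨j, i⟩)}
    (h : Along (⟨j, i⟩) x y a b) : Along (S := fun i => S (⟨j, i⟩)) i
      (fun i => x (⟨j, i⟩)) (fun i => y (⟨j, i⟩)) a b :=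
  ⟨h.src, h.tgt, fun i' hi => h.eq _ fun e => hi (eq_of_heq (LexSum.mk.inj e).2)⟩

namespace Multifunctor

variable (G : Multifunctor w' w T C)
  (F : ∀ j, Multifunctor w' w (fun i : I j => S (⟨j, i⟩)) (T j))

/-- The values of a family of multifunctors. -/
abbrev vals (x : ∀ p, S p) (j : κ) : T j := (F j).obj fun i => x (⟨j, i⟩)

theorem _root_.Along.restrict_eq {j : κ} {i : I j} {x y : ∀ p, S p} {a b : S (⟨j, i⟩)}
    (h : Along (⟨j, i⟩) x y a b) {j' : κ} (hj : j' ≠ j) :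
    (fun i => x (⟨j', i⟩)) = fun i => y (⟨j', i⟩) :=
  funext fun _ => h.eq _ fun e => hj (LexSum.mk.inj e).1

theorem _root_.Along.vals_eq {j : κ} {i : I j} {x y : ∀ p, S p} {a b : S (⟨j, i⟩)}
    (h : Along (⟨j, i⟩) x y a b) {j' : κ} (hj : j' ≠ j) : vals F x j' = vals F y j' :=
  congrArg (F j').obj (h.restrict_eq hj)

theorem _root_.Along.outer {j : κ} {i : I j} {x y : ∀ p, S p} {a b : S (⟨j, i⟩)}
    (h : Along (⟨j, i⟩) x y a b) {A B : T j} (hA : vals F x j = A) (hB : vals F y j = B) :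
    Along j (vals F x) (vals F y) A B :=
  ⟨hA, hB, fun _ hj => h.vals_eq F hj⟩

/-- The value of the composite at a `1`-cell. -/
abbrev compMap {j : κ} {i : I j} {x y : ∀ p, S p} {a b : S (⟨j, i⟩)}
    (h : Along (⟨j, i⟩) x y a b) (f : a ⟶ b) : G.obj (vals F x) ⟶ G.obj (vals F y) :=
  G.map (h.outer F rfl rfl) ((F j).map h.inner f)

theorem compMap_eq {j : κ} {i : I j} {x y : ∀ p, S p} {a b : S (⟨j, i⟩)}
    (h : Along (⟨j, i⟩) x y a b) (f : a ⟶ b) {A B : T j} (h' : Along j (vals F x) (vals F y) A B)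
    {f' : A ⟶ B} (hf : HEq ((F j).map h.inner f) f') : G.compMap F h f = G.map h' f' :=
  G.map_eq _ _ hf

theorem inner_map_heq {j : κ} {i : I j} {x y z t : ∀ p, S p} {a b : S (⟨j, i⟩)}
    (h : Along (⟨j, i⟩) x y a b) (h' : Along (⟨j, i⟩) z t a b) (f : a ⟶ b)
    (hx : (fun i => x (⟨j, i⟩)) = fun i => z (⟨j, i⟩))
    (hy : (fun i => y (⟨j, i⟩)) = fun i => t (⟨j, i⟩)) :
    HEq ((F j).map h.inner f) ((F j).map h'.inner f) :=
  (F j).map_heq _ _ hx hy HEq.rfl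

/-- The cells of the composite, in two variables of different components. -/
def compCellDiff {j j' : κ} (hj : j < j') {i : I j} {i' : I j'} {x y z t : ∀ p, S p}
    {a a' : S (⟨j, i⟩)} {b b' : S (⟨j', i'⟩)}
    (top : Along (⟨j, i⟩) x y a a') (right : Along (⟨j', i'⟩) y t b b')
    (left : Along (⟨j', i'⟩) x z b b') (bottom : Along (⟨j, i⟩) z t a a')
    (f : a ⟶ a') (g : b ⟶ b') :
    WCell w (G.compMap F top f ≫ G.compMap F right g)
      (G.compMap F left g ≫ G.compMap F bottom f) :=
  .ofEq (congrArg (_ ≫ ·) (G.compMap_eq F right g _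
      (inner_map_heq F right left g (top.restrict_eq hj.ne').symm
      (bottom.restrict_eq hj.ne').symm))) ⊚
    G.cell hj (top.outer F rfl rfl)
      (right.outer F (top.vals_eq F hj.ne').symm (bottom.vals_eq F hj.ne').symm)
      (left.outer F rfl rfl)
      (bottom.outer F (left.vals_eq F hj.ne).symm (right.vals_eq F hj.ne).symm)
      ((F j).map top.inner f) ((F j').map left.inner g) ⊚
    .ofEq (congrArg (_ ≫ ·) (G.compMap_eq F bottom f _
      (inner_map_heq F bottom top f (left.restrict_eq hj.ne).symm
      (right.restrict_eq hj.ne).symm)).symm)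

/-- The cells of the composite, in two variables of the same component. -/
def compCellSame {j : κ} {i i' : I j} (hi : i < i') {x y z t : ∀ p, S p}
    {a a' : S (⟨j, i⟩)} {b b' : S (⟨j, i'⟩)}
    (top : Along (⟨j, i⟩) x y a a') (right : Along (⟨j, i'⟩) y t b b')
    (left : Along (⟨j, i'⟩) x z b b') (bottom : Along (⟨j, i⟩) z t a a')
    (f : a ⟶ a') (g : b ⟶ b') :
    WCell w (G.compMap F top f ≫ G.compMap F right g)
      (G.compMap F left g ≫ G.compMap F bottom f) :=
  .ofEq (G.map_comp _ _ _ _).symm ⊚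
    ((F j).cell hi top.inner right.inner left.inner bottom.inner f g).map
      (G.mapFunctor ((top.outer F rfl rfl).trans (right.outer F rfl rfl))) ⊚
    .ofEq (G.map_comp (left.outer F rfl rfl) (bottom.outer F rfl rfl) _ _)

theorem compCellDiff_eq {j j' : κ} (hj : j < j') {i : I j} {i' : I j'} {x y z t : ∀ p, S p}
    {a a' : S (⟨j, i⟩)} {b b' : S (⟨j', i'⟩)}
    (top : Along (⟨j, i⟩) x y a a') (right : Along (⟨j', i'⟩) y t b b')
    (left : Along (⟨j', i'⟩) x z b b') (bottom : Along (⟨j, i⟩) z t a a')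
    (f : a ⟶ a') (g : b ⟶ b') {A A' : T j} {B B' : T j'} {f' : A ⟶ A'} {g' : B ⟶ B'}
    (top' : Along j (vals F x) (vals F y) A A') (right' : Along j' (vals F y) (vals F t) B B')
    (left' : Along j' (vals F x) (vals F z) B B') (bottom' : Along j (vals F z) (vals F t) A A')
    (hf : HEq ((F j).map top.inner f) f') (hg : HEq ((F j').map left.inner g) g') :
    G.compCellDiff F hj top right left bottom f g =
      .ofEq (congr (congrArg _ (G.compMap_eq F top f top' hf)) (G.compMap_eq F right g right'
        ((inner_map_heq F right left g (top.restrict_eq hj.ne').symm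
          (bottom.restrict_eq hj.ne').symm).trans hg))) ⊚
      G.cell hj top' right' left' bottom' f' g' ⊚
      .ofEq (congr (congrArg _ (G.compMap_eq F left g left' hg)) (G.compMap_eq F bottom f bottom'
        ((inner_map_heq F bottom top f (left.restrict_eq hj.ne).symm
          (right.restrict_eq hj.ne).symm).trans hf))).symm := by
  unfold compCellDiff
  rw [G.cell_congr hj _ _ _ _ top' right' left' bottom' hf hg]
  simp

theorem compCellSame_eq {j : κ} {i i' : I j} (hi : i < i') {x y z t : ∀ p, S p}
    {a a' : S ⟨j, i⟩} {b b' : S ⟨j, i'⟩}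
    (top : Along ⟨j, i⟩ x y a a') (right : Along ⟨j, i'⟩ y t b b')
    (left : Along ⟨j, i'⟩ x z b b') (bottom : Along ⟨j, i⟩ z t a a')
    (f : a ⟶ a') (g : b ⟶ b') {x' y' z' t' : ∀ p, S p}
    (hx : (fun i => x ⟨j, i⟩) = fun i => x' ⟨j, i⟩) (hy : (fun i => y ⟨j, i⟩) = fun i => y' ⟨j, i⟩)
    (hz : (fun i => z ⟨j, i⟩) = fun i => z' ⟨j, i⟩) (ht : (fun i => t ⟨j, i⟩) = fun i => t' ⟨j, i⟩)
    (top' : Along ⟨j, i⟩ x' y' a a') (right' : Along ⟨j, i'⟩ y' t' b b')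
    (left' : Along ⟨j, i'⟩ x' z' b b') (bottom' : Along ⟨j, i⟩ z' t' a a')
    (h : Along j (vals F x) (vals F t) (vals F x' j) (vals F t' j)) :
    ∃ p q, G.compCellSame F hi top right left bottom f g = .ofEq p ⊚
      ((F j).cell hi top'.inner right'.inner left'.inner bottom'.inner f g).map (G.mapFunctor h) ⊚
      .ofEq q := by
  have aux {X Y Z W X' Y' Z' W' : ∀ i, S ⟨j, i⟩} (hX : X = X') (hY : Y = Y') (hZ : Z = Z')
      (hW : W = W') (t₁ : Along i X Y a a') (r₁ : Along i' Y W b b') (l₁ : Along i' X Z b b')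
      (b₁ : Along i Z W a a') (t₂ : Along i X' Y' a a') (r₂ : Along i' Y' W' b b')
      (l₂ : Along i' X' Z' b b') (b₂ : Along i Z' W' a a')
      (h₁ : Along j (vals F x) (vals F t) ((F j).obj X) ((F j).obj W))
      (h₂ : Along j (vals F x) (vals F t) ((F j).obj X') ((F j).obj W')) :
      HEq (((F j).cell hi t₁ r₁ l₁ b₁ f g).map (G.mapFunctor h₁))
        (((F j).cell hi t₂ r₂ l₂ b₂ f g).map (G.mapFunctor h₂)) ∧
      G.map h₁ ((F j).map t₁ f ≫ (F j).map r₁ g) = G.map h₂ ((F j).map t₂ f ≫ (F j).map r₂ g) ∧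
      G.map h₁ ((F j).map l₁ g ≫ (F j).map b₁ f) =
        G.map h₂ ((F j).map l₂ g ≫ (F j).map b₂ f) := by
    subst hX hY hZ hW
    exact ⟨HEq.rfl, rfl, rfl⟩
  obtain ⟨e, h₁, h₂⟩ := aux hx hy hz ht top.inner right.inner left.inner bottom.inner top'.inner
    right'.inner left'.inner bottom'.inner ((top.outer F rfl rfl).trans (right.outer F rfl rfl)) h
  unfold compCellSame
  rw [WCell.eq_of_heq h₁ h₂.symm e]
  refine ⟨(G.map_comp (top.outer F rfl rfl) (right.outer F rfl rfl) _ _).symm.trans h₁,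
    h₂.symm.trans (G.map_comp (left.outer F rfl rfl) (bottom.outer F rfl rfl) _ _), ?_⟩
  simp

/-- The cells of the composite. -/
def compCell {j j' : κ} {i : I j} {i' : I j'}
    (hij : (⟨j, i⟩ : LexSum I) <  ⟨j', i'⟩) {x y z t : ∀ p, S p}
    {a a' : S (⟨j, i⟩)} {b b' : S (⟨j', i'⟩)}
    (top : Along (⟨j, i⟩) x y a a') (right : Along (⟨j', i'⟩) y t b b')
    (left : Along (⟨j', i'⟩) x z b b') (bottom : Along (⟨j, i⟩) z t a a')
    (f : a ⟶ a') (g : b ⟶ b') :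
    WCell w (G.compMap F top f ≫ G.compMap F right g)
      (G.compMap F left g ≫ G.compMap F bottom f) :=
  if hj : j = j' then by
    subst hj
    exact G.compCellSame F (LexSum.mk_lt_mk.1 hij) top right left bottom f g
  else G.compCellDiff F (by
    rcases LexSum.lt_iff.1 hij with h | ⟨h, _⟩
    exacts [h, absurd h hj]) top right left bottom f g

theorem compCell_same {j : κ} {i i' : I j} (hi : i < i')
    (hij : (⟨j, i⟩ : LexSum I) <  ⟨j, i'⟩) {x y z t : ∀ p, S p}
    {a a' : S (⟨j, i⟩)} {b b' : S (⟨j, i'⟩)}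
    (top : Along (⟨j, i⟩) x y a a') (right : Along (⟨j, i'⟩) y t b b')
    (left : Along (⟨j, i'⟩) x z b b') (bottom : Along (⟨j, i⟩) z t a a')
    (f : a ⟶ a') (g : b ⟶ b') :
    G.compCell F hij top right left bottom f g =
      G.compCellSame F hi top right left bottom f g := dif_pos rfl

theorem compCell_diff {j j' : κ} (hj : j < j') {i : I j} {i' : I j'}
    (hij : (⟨j, i⟩ : LexSum I) <  ⟨j', i'⟩) {x y z t : ∀ p, S p}
    {a a' : S (⟨j, i⟩)} {b b' : S (⟨j', i'⟩)}
    (top : Along (⟨j, i⟩) x y a a') (right : Along (⟨j', i'⟩) y t b b')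
    (left : Along (⟨j', i'⟩) x z b b') (bottom : Along (⟨j, i⟩) z t a a')
    (f : a ⟶ a') (g : b ⟶ b') :
    G.compCell F hij top right left bottom f g =
      G.compCellDiff F hj top right left bottom f g := dif_neg hj.ne

theorem compCell_cases {j j' : κ} {i : I j} {i' : I j'}
    (hij : (⟨j, i⟩ : LexSum I) <  ⟨j', i'⟩) :
    j < j' ∨ ∃ h : j = j', h ▸ i < i' := by
  rcases LexSum.lt_iff.1 hij with h | ⟨h, h'⟩
  exacts [.inl h, .inr ⟨h, h'⟩]

theorem cell_wcell_right {i j : κ} (hij : i < j) {x y z t : ∀ i, T i} {a a' : T i} {b b' : T j}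
    (top : Along i x y a a') (right : Along j y t b b')
    (left : Along j x z b b') (bottom : Along i z t a a') (f : a ⟶ a') {g g' : b ⟶ b'}
    (c : WCell w g g') :
    G.cell hij top right left bottom f g ⊚ (c.map (G.mapFunctor left) ▹ G.map bottom f) =
      (G.map top f ◃ c.map (G.mapFunctor right)) ⊚ G.cell hij top right left bottom f g' := by
  unfold WCell.whiskerLeft WCell.whiskerRight
  rw [WCell.map_map, WCell.map_map]
  exact WCell.natural (G.mapFunctor right ⋙ precomp _ (G.map top f))
    (G.mapFunctor left ⋙ postcomp _ (G.map bottom f))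
    (fun g => G.cell hij top right left bottom f g)
    (fun τ => G.cell_naturality_right hij top right left bottom f τ) c

theorem cell_wcell_left {i j : κ} (hij : i < j) {x y z t : ∀ i, T i} {a a' : T i} {b b' : T j}
    (top : Along i x y a a') (right : Along j y t b b')
    (left : Along j x z b b') (bottom : Along i z t a a') {f f' : a ⟶ a'} (g : b ⟶ b')
    (c : WCell w f f') :
    G.cell hij top right left bottom f g ⊚ (G.map left g ◃ c.map (G.mapFunctor bottom)) =
      (c.map (G.mapFunctor top) ▹ G.map right g) ⊚ G.cell hij top right left bottom f' g := by
  unfold WCell.whiskerLeft WCell.whiskerRight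
  rw [WCell.map_map, WCell.map_map]
  exact WCell.natural (G.mapFunctor top ⋙ postcomp _ (G.map right g))
    (G.mapFunctor bottom ⋙ precomp _ (G.map left g))
    (fun f => G.cell hij top right left bottom f g)
    (fun σ => G.cell_naturality_left hij top right left bottom g σ) c

theorem compMap_id {j : κ} {i : I j} {x : ∀ p, S p} {a : S (⟨j, i⟩)}
    (h : Along (⟨j, i⟩) x x a a) : G.compMap F h (𝟙 a) = 𝟙 _ := by
  unfold compMap
  rw [(F j).map_id, G.map_id]

theorem compMap_comp {j : κ} {i : I j} {x y z : ∀ p, S p} {a b d : S (⟨j, i⟩)}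
    (h : Along (⟨j, i⟩) x y a b) (h' : Along (⟨j, i⟩) y z b d) (f : a ⟶ b)
    (g : b ⟶ d) : G.compMap F (h.trans h') (f ≫ g) = G.compMap F h f ≫ G.compMap F h' g := by
  unfold compMap
  rw [(F j).map_comp h.inner h'.inner, G.map_comp (h.outer F rfl rfl) (h'.outer F rfl rfl)]

theorem map₂_eqToHom {i : κ} {x y : ∀ i, T i} {a b : T i} (h : Along i x y a b) {f g : a ⟶ b}
    (e : f = g) : G.map₂ h (eqToHom e) = eqToHom (by rw [e]) := by
  subst e
  exact G.map₂_id h f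

/-- The value of the composite at a `2`-cell. -/
abbrev compMap₂ {j : κ} {i : I j} {x y : ∀ p, S p} {a b : S ⟨j, i⟩}
    (h : Along ⟨j, i⟩ x y a b) {f g : a ⟶ b} (σ : f ⟶ g) : G.compMap F h f ⟶ G.compMap F h g :=
  G.map₂ (h.outer F rfl rfl) ((F j).map₂ h.inner σ)

theorem compMap₂_whisker_left {j : κ} {i : I j} {x y z : ∀ p, S p} {a b d : S ⟨j, i⟩}
    (h : Along ⟨j, i⟩ x y a b) (h' : Along ⟨j, i⟩ y z b d) (f : a ⟶ b) {g k : b ⟶ d} (σ : g ⟶ k) :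
    G.compMap₂ F (h.trans h') (f ◁ σ) = eqToHom (G.compMap_comp F h h' f g) ≫
      G.compMap F h f ◁ G.compMap₂ F h' σ ≫ eqToHom (G.compMap_comp F h h' f k).symm := by
  unfold compMap₂
  rw [(F j).map₂_whisker_left h.inner h'.inner, G.map₂_comp, G.map₂_comp, G.map₂_eqToHom,
    G.map₂_eqToHom, G.map₂_whisker_left (h.outer F rfl rfl) (h'.outer F rfl rfl)]
  simp

theorem compMap₂_whisker_right {j : κ} {i : I j} {x y z : ∀ p, S p} {a b d : S ⟨j, i⟩}
    (h : Along ⟨j, i⟩ x y a b) (h' : Along ⟨j, i⟩ y z b d) {f g : a ⟶ b} (σ : f ⟶ g) (k : b ⟶ d) :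
    G.compMap₂ F (h.trans h') (σ ▷ k) = eqToHom (G.compMap_comp F h h' f k) ≫
      G.compMap₂ F h σ ▷ G.compMap F h' k ≫ eqToHom (G.compMap_comp F h h' g k).symm := by
  unfold compMap₂
  rw [(F j).map₂_whisker_right h.inner h'.inner, G.map₂_comp, G.map₂_comp, G.map₂_eqToHom,
    G.map₂_eqToHom, G.map₂_whisker_right (h.outer F rfl rfl) (h'.outer F rfl rfl)]
  simp

theorem compCell_id_right {j j' : κ} {i : I j} {i' : I j'}
    (hij : (⟨j, i⟩ : LexSum I) < ⟨j', i'⟩) {x y : ∀ p, S p} {a a' : S ⟨j, i⟩} {b : S ⟨j', i'⟩}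
    (top : Along ⟨j, i⟩ x y a a') (right : Along ⟨j', i'⟩ y y b b)
    (left : Along ⟨j', i'⟩ x x b b) (f : a ⟶ a') :
    G.compCell F hij top right left top f (𝟙 b) =
      .ofEq (by rw [compMap_id, compMap_id, Strict.comp_id, Strict.id_comp]) := by
  obtain hj | ⟨rfl, hi⟩ := compCell_cases hij
  · rw [compCell_diff _ _ hj, compCellDiff_eq _ _ hj top right left top f (𝟙 b)
      (top.outer F rfl rfl) (right.outer F (top.vals_eq F hj.ne').symm (top.vals_eq F hj.ne').symm)
      (left.outer F rfl rfl) (top.outer F rfl rfl) HEq.rfl (heq_of_eq ((F j').map_id left.inner)),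
      G.cell_id_right]
    simp
  · rw [compCell_same _ _ hi]
    unfold compCellSame
    rw [(F j).cell_id_right]
    simp

theorem compCell_comp_right {j j' : κ} {i : I j} {i' : I j'}
    (hij : (⟨j, i⟩ : LexSum I) < ⟨j', i'⟩) {x y z t x' y' : ∀ p, S p}
    {a a' : S ⟨j, i⟩} {b b' b'' : S ⟨j', i'⟩}
    (top : Along ⟨j, i⟩ x y a a') (right : Along ⟨j', i'⟩ y t b b')
    (left : Along ⟨j', i'⟩ x z b b') (middle : Along ⟨j, i⟩ z t a a')
    (right' : Along ⟨j', i'⟩ t y' b' b'') (left' : Along ⟨j', i'⟩ z x' b' b'')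
    (bottom : Along ⟨j, i⟩ x' y' a a') (f : a ⟶ a') (g : b ⟶ b') (g' : b' ⟶ b'') :
    G.compCell F hij top (right.trans right') (left.trans left') bottom f (g ≫ g') =
      .ofEq (by rw [G.compMap_comp F right right', Strict.assoc]) ⊚
      (G.compCell F hij top right left middle f g ▹ G.compMap F right' g') ⊚
      .ofEq (Strict.assoc _ _ _) ⊚
      (G.compMap F left g ◃ G.compCell F hij middle right' left' bottom f g') ⊚
      .ofEq (by rw [G.compMap_comp F left left', Strict.assoc]) := by
  obtain hj | ⟨rfl, hi⟩ := compCell_cases hij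
  · rw [compCell_diff _ _ hj, compCell_diff _ _ hj, compCell_diff _ _ hj]
    have T := top.outer F rfl rfl
    have R := right.outer F (top.vals_eq F hj.ne').symm (middle.vals_eq F hj.ne').symm
    have L := left.outer F rfl rfl
    have M := middle.outer F (left.vals_eq F hj.ne).symm (right.vals_eq F hj.ne).symm
    have R' := right'.outer F (middle.vals_eq F hj.ne').symm (bottom.vals_eq F hj.ne').symm
    have L' := left'.outer F rfl rfl
    have B := bottom.outer F ((left.trans left').vals_eq F hj.ne).symm
      ((right.trans right').vals_eq F hj.ne).symm
    have hM := inner_map_heq F middle top f (left.restrict_eq hj.ne).symm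
      (right.restrict_eq hj.ne).symm
    have hR' := inner_map_heq F right' left' g' (middle.restrict_eq hj.ne').symm
      (bottom.restrict_eq hj.ne').symm
    rw [compCellDiff_eq _ _ hj top (right.trans right') (left.trans left') bottom f (g ≫ g')
      T (R.trans R') (L.trans L') B HEq.rfl
      (heq_of_eq ((F j').map_comp left.inner left'.inner g g')),
      compCellDiff_eq _ _ hj top right left middle f g T R L M HEq.rfl HEq.rfl,
      compCellDiff_eq _ _ hj middle right' left' bottom f g' M R' L' B hM HEq.rfl,
      G.cell_comp_right hj T R L M R' L' B,
      WCell.whiskerRight_congr (G.compMap_eq F right' g' R' hR')]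
    simp
  · simp only [compCell_same _ _ hi]
    unfold compCellSame
    rw [(F j).cell_comp_right hi top.inner right.inner left.inner middle.inner right'.inner
      left'.inner bottom.inner]
    simp only [WCell.map_comp]
    rw [G.mapFunctor_whiskerRight ((top.outer F rfl rfl).trans (right.outer F rfl rfl))
        (right'.outer F rfl rfl),
      G.mapFunctor_whiskerLeft (left.outer F rfl rfl)
        ((middle.outer F rfl rfl).trans (right'.outer F rfl rfl))]
    simp

theorem compCell_id_left {j j' : κ} {i : I j} {i' : I j'}
    (hij : (⟨j, i⟩ : LexSum I) < ⟨j', i'⟩) {x y : ∀ p, S p} {a : S ⟨j, i⟩} {b b' : S ⟨j', i'⟩}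
    (top : Along ⟨j, i⟩ x x a a) (left : Along ⟨j', i'⟩ x y b b')
    (bottom : Along ⟨j, i⟩ y y a a) (g : b ⟶ b') :
    G.compCell F hij top left left bottom (𝟙 a) g =
      .ofEq (by rw [compMap_id, compMap_id, Strict.comp_id, Strict.id_comp]) := by
  obtain hj | ⟨rfl, hi⟩ := compCell_cases hij
  · rw [compCell_diff _ _ hj, compCellDiff_eq _ _ hj top left left bottom (𝟙 a) g
      (top.outer F rfl rfl) (left.outer F rfl rfl) (left.outer F rfl rfl)
      (bottom.outer F (left.vals_eq F hj.ne).symm (left.vals_eq F hj.ne).symm)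
      (heq_of_eq ((F j).map_id top.inner)) HEq.rfl, G.cell_id_left]
    simp
  · rw [compCell_same _ _ hi]
    unfold compCellSame
    rw [(F j).cell_id_left]
    simp

theorem compCell_comp_left {j j' : κ} {i : I j} {i' : I j'}
    (hij : (⟨j, i⟩ : LexSum I) < ⟨j', i'⟩) {x y z t x' y' : ∀ p, S p}
    {a a' a'' : S ⟨j, i⟩} {b b' : S ⟨j', i'⟩}
    (top : Along ⟨j, i⟩ x y a a') (middle : Along ⟨j', i'⟩ y t b b')
    (left : Along ⟨j', i'⟩ x z b b') (bottom : Along ⟨j, i⟩ z t a a')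
    (top' : Along ⟨j, i⟩ y x' a' a'') (right : Along ⟨j', i'⟩ x' y' b b')
    (bottom' : Along ⟨j, i⟩ t y' a' a'') (f : a ⟶ a') (f' : a' ⟶ a'') (g : b ⟶ b') :
    G.compCell F hij (top.trans top') right left (bottom.trans bottom') (f ≫ f') g =
      .ofEq (by rw [G.compMap_comp F top top', Strict.assoc]) ⊚
      (G.compMap F top f ◃ G.compCell F hij top' right middle bottom' f' g) ⊚
      .ofEq (Strict.assoc _ _ _).symm ⊚
      (G.compCell F hij top middle left bottom f g ▹ G.compMap F bottom' f') ⊚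
      .ofEq (by rw [G.compMap_comp F bottom bottom', Strict.assoc]) := by
  obtain hj | ⟨rfl, hi⟩ := compCell_cases hij
  · rw [compCell_diff _ _ hj, compCell_diff _ _ hj, compCell_diff _ _ hj]
    have T := top.outer F rfl rfl
    have T' := top'.outer F rfl rfl
    have L := left.outer F rfl rfl
    have M := middle.outer F (top.vals_eq F hj.ne').symm (bottom.vals_eq F hj.ne').symm
    have R := right.outer F ((top.trans top').vals_eq F hj.ne').symm
      ((bottom.trans bottom').vals_eq F hj.ne').symm
    have B := bottom.outer F (left.vals_eq F hj.ne).symm (middle.vals_eq F hj.ne).symm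
    have B' := bottom'.outer F (middle.vals_eq F hj.ne).symm (right.vals_eq F hj.ne).symm
    have hM := inner_map_heq F middle left g (top.restrict_eq hj.ne').symm
      (bottom.restrict_eq hj.ne').symm
    have hB' := inner_map_heq F bottom' top' f' (middle.restrict_eq hj.ne).symm
      (right.restrict_eq hj.ne).symm
    rw [compCellDiff_eq _ _ hj (top.trans top') right left (bottom.trans bottom') (f ≫ f') g
      (T.trans T') R L (B.trans B') (heq_of_eq ((F j).map_comp top.inner top'.inner f f'))
      HEq.rfl,
      compCellDiff_eq _ _ hj top' right middle bottom' f' g T' R M B' HEq.rfl hM,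
      compCellDiff_eq _ _ hj top middle left bottom f g T M L B HEq.rfl HEq.rfl,
      G.cell_comp_left hj T M L B T' R B',
      WCell.whiskerRight_congr (G.compMap_eq F bottom' f' B' hB')]
    simp
  · simp only [compCell_same _ _ hi]
    unfold compCellSame
    rw [(F j).cell_comp_left hi top.inner middle.inner left.inner bottom.inner top'.inner
      right.inner bottom'.inner]
    simp only [WCell.map_comp]
    rw [G.mapFunctor_whiskerRight ((top.outer F rfl rfl).trans (middle.outer F rfl rfl))
        (bottom'.outer F rfl rfl),
      G.mapFunctor_whiskerLeft (top.outer F rfl rfl)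
        ((top'.outer F rfl rfl).trans (right.outer F rfl rfl))]
    simp

theorem map₂_heq {ι : Type} [LinearOrder ι] {S : ι → FCat.{w₁, v₁, u₁}}
    {C : FCat.{w₂, v₂, u₂}} (M : Multifunctor w' w S C) {i : ι} {x y x₂ y₂ : ∀ i, S i}
    {a b a₂ b₂ : S i} (h : Along i x y a b) (h' : Along i x₂ y₂ a₂ b₂) {f f' : a ⟶ b}
    {g g' : a₂ ⟶ b₂} {σ : f ⟶ f'} {τ : g ⟶ g'} (hx : x = x₂)
    (hy : y = y₂) (hf : HEq f g) (hf' : HEq f' g') (hσ : HEq σ τ) :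
    HEq (M.map₂ h σ) (M.map₂ h' τ) := by
  subst hx hy
  obtain rfl := h.src.symm.trans h'.src
  obtain rfl := h.tgt.symm.trans h'.tgt
  obtain rfl := eq_of_heq hf
  obtain rfl := eq_of_heq hf'
  obtain rfl := eq_of_heq hσ
  rfl

theorem compMap₂_eq {j : κ} {i : I j} {x y : ∀ p, S p} {a b : S ⟨j, i⟩}
    (h : Along ⟨j, i⟩ x y a b) {f g : a ⟶ b} (σ : f ⟶ g) {A B : T j}
    (h' : Along j (vals F x) (vals F y) A B) {f' g' : A ⟶ B} {σ' : f' ⟶ g'}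
    (hf : HEq ((F j).map h.inner f) f') (hg : HEq ((F j).map h.inner g) g')
    (hσ : HEq ((F j).map₂ h.inner σ) σ') : G.compMap₂ F h σ =
      eqToHom (G.compMap_eq F h f h' hf) ≫ G.map₂ h' σ' ≫
        eqToHom (G.compMap_eq F h g h' hg).symm :=
  (conj_eqToHom_iff_heq _ _ (G.compMap_eq F h f h' hf) (G.compMap_eq F h g h' hg)).2
    (G.map₂_heq _ _ rfl rfl hf hg hσ)

theorem inner_map₂_heq {j : κ} {i : I j} {x y z t : ∀ p, S p} {a b : S ⟨j, i⟩}
    (h : Along ⟨j, i⟩ x y a b) (h' : Along ⟨j, i⟩ z t a b) {f g : a ⟶ b} (σ : f ⟶ g)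
    (hx : (fun i => x ⟨j, i⟩) = fun i => z ⟨j, i⟩)
    (hy : (fun i => y ⟨j, i⟩) = fun i => t ⟨j, i⟩) :
    HEq ((F j).map₂ h.inner σ) ((F j).map₂ h'.inner σ) :=
  (F j).map₂_heq _ _ hx hy HEq.rfl HEq.rfl HEq.rfl

theorem compCell_naturality_right {j j' : κ} {i : I j} {i' : I j'}
    (hij : (⟨j, i⟩ : LexSum I) < ⟨j', i'⟩) {x y z t : ∀ p, S p}
    {a a' : S ⟨j, i⟩} {b b' : S ⟨j', i'⟩}
    (top : Along ⟨j, i⟩ x y a a') (right : Along ⟨j', i'⟩ y t b b')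
    (left : Along ⟨j', i'⟩ x z b b') (bottom : Along ⟨j, i⟩ z t a a')
    (f : a ⟶ a') {g g' : b ⟶ b'} (τ : g ⟶ g') :
    (G.compCell F hij top right left bottom f g).Commutes
      (G.compCell F hij top right left bottom f g') (G.compMap F top f ◁ G.compMap₂ F right τ)
      (G.compMap₂ F left τ ▷ G.compMap F bottom f) := by
  obtain hj | ⟨rfl, hi⟩ := compCell_cases hij
  · rw [compCell_diff _ _ hj, compCell_diff _ _ hj]
    have T := top.outer F rfl rfl
    have R := right.outer F (top.vals_eq F hj.ne').symm (bottom.vals_eq F hj.ne').symm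
    have L := left.outer F rfl rfl
    have B := bottom.outer F (left.vals_eq F hj.ne).symm (right.vals_eq F hj.ne).symm
    have hB := inner_map_heq F bottom top f (left.restrict_eq hj.ne).symm
      (right.restrict_eq hj.ne).symm
    have hR (g : b ⟶ b') := inner_map_heq F right left g (top.restrict_eq hj.ne').symm
      (bottom.restrict_eq hj.ne').symm
    have hR₂ := inner_map₂_heq F right left τ (top.restrict_eq hj.ne').symm
      (bottom.restrict_eq hj.ne').symm
    rw [compCellDiff_eq _ _ hj top right left bottom f g T R L B HEq.rfl HEq.rfl,
      compCellDiff_eq _ _ hj top right left bottom f g' T R L B HEq.rfl HEq.rfl]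
    refine (WCell.Commutes.ofEq _ _ ?_).comp_horiz
      ((G.cell_naturality_right hj T R L B ((F j).map top.inner f)
        ((F j').map₂ left.inner τ)).comp_horiz (WCell.Commutes.ofEq _ _ ?_))
    · rw [G.compMap₂_eq F right τ R (hR g) (hR g') hR₂]
      simp
    · rw [whiskerRight_congr _ (G.compMap_eq F bottom f B hB)]
      simp
  · simp only [compCell_same _ _ hi]
    have T := top.outer F rfl rfl
    have R := right.outer F rfl rfl
    have L := left.outer F rfl rfl
    have B := bottom.outer F rfl rfl
    refine (WCell.Commutes.ofEq _ _ ?_).comp_horiz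
      ((((F j).cell_naturality_right hi top.inner right.inner left.inner bottom.inner f τ).map
        (G.mapFunctor (T.trans R))).comp_horiz (WCell.Commutes.ofEq _ _ ?_))
    · dsimp only [mapFunctor]
      rw [G.map₂_whisker_left T R]
      simp
    · dsimp only [mapFunctor]
      rw [G.map₂_whisker_right L B]
      simp

theorem compCell_naturality_left {j j' : κ} {i : I j} {i' : I j'}
    (hij : (⟨j, i⟩ : LexSum I) < ⟨j', i'⟩) {x y z t : ∀ p, S p}
    {a a' : S ⟨j, i⟩} {b b' : S ⟨j', i'⟩}
    (top : Along ⟨j, i⟩ x y a a') (right : Along ⟨j', i'⟩ y t b b')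
    (left : Along ⟨j', i'⟩ x z b b') (bottom : Along ⟨j, i⟩ z t a a')
    {f f' : a ⟶ a'} (g : b ⟶ b') (σ : f ⟶ f') :
    (G.compCell F hij top right left bottom f g).Commutes
      (G.compCell F hij top right left bottom f' g) (G.compMap₂ F top σ ▷ G.compMap F right g)
      (G.compMap F left g ◁ G.compMap₂ F bottom σ) := by
  obtain hj | ⟨rfl, hi⟩ := compCell_cases hij
  · rw [compCell_diff _ _ hj, compCell_diff _ _ hj]
    have T := top.outer F rfl rfl
    have R := right.outer F (top.vals_eq F hj.ne').symm (bottom.vals_eq F hj.ne').symm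
    have L := left.outer F rfl rfl
    have B := bottom.outer F (left.vals_eq F hj.ne).symm (right.vals_eq F hj.ne).symm
    have hB (f : a ⟶ a') := inner_map_heq F bottom top f (left.restrict_eq hj.ne).symm
      (right.restrict_eq hj.ne).symm
    have hB₂ := inner_map₂_heq F bottom top σ (left.restrict_eq hj.ne).symm
      (right.restrict_eq hj.ne).symm
    have hR := inner_map_heq F right left g (top.restrict_eq hj.ne').symm
      (bottom.restrict_eq hj.ne').symm
    rw [compCellDiff_eq _ _ hj top right left bottom f g T R L B HEq.rfl HEq.rfl,
      compCellDiff_eq _ _ hj top right left bottom f' g T R L B HEq.rfl HEq.rfl]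
    refine (WCell.Commutes.ofEq _ _ ?_).comp_horiz
      ((G.cell_naturality_left hj T R L B ((F j').map left.inner g)
        ((F j).map₂ top.inner σ)).comp_horiz (WCell.Commutes.ofEq _ _ ?_))
    · rw [whiskerRight_congr _ (G.compMap_eq F right g R hR)]
      simp
    · rw [G.compMap₂_eq F bottom σ B (hB f) (hB f') hB₂]
      simp
  · simp only [compCell_same _ _ hi]
    have T := top.outer F rfl rfl
    have R := right.outer F rfl rfl
    have L := left.outer F rfl rfl
    have B := bottom.outer F rfl rfl
    refine (WCell.Commutes.ofEq _ _ ?_).comp_horiz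
      ((((F j).cell_naturality_left hi top.inner right.inner left.inner bottom.inner g σ).map
        (G.mapFunctor (T.trans R))).comp_horiz (WCell.Commutes.ofEq _ _ ?_))
    · dsimp only [mapFunctor]
      rw [G.map₂_whisker_right T R]
      simp
    · dsimp only [mapFunctor]
      rw [G.map₂_whisker_left L B]
      simp

theorem compCell_is {j j' : κ} {i : I j} {i' : I j'}
    (hij : (⟨j, i⟩ : LexSum I) < ⟨j', i'⟩) {x y z t : ∀ p, S p}
    {a a' : S ⟨j, i⟩} {b b' : S ⟨j', i'⟩}
    (top : Along ⟨j, i⟩ x y a a') (right : Along ⟨j', i'⟩ y t b b')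
    (left : Along ⟨j', i'⟩ x z b b') (bottom : Along ⟨j, i⟩ z t a a')
    (f : a ⟶ a') (g : b ⟶ b') (h : (S ⟨j, i⟩).Tight f ∨ (S ⟨j', i'⟩).Tight g) :
    (G.compCell F hij top right left bottom f g).Is w' := by
  obtain hj | ⟨rfl, hi⟩ := compCell_cases hij
  · rw [compCell_diff _ _ hj]
    exact .comp (.ofEq _) (.comp (G.cell_is hj _ _ _ _ _ _
      (h.imp ((F j).map_tight _) ((F j').map_tight _))) (.ofEq _))
  · rw [compCell_same _ _ hi]
    exact .comp (.ofEq _) (.comp (((F j).cell_is hi _ _ _ _ _ _ h).map _) (.ofEq _))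

theorem compCell_cube {j₁ j₂ j₃ : κ} {i₁ : I j₁} {i₂ : I j₂} {i₃ : I j₃}
    (hij : (⟨j₁, i₁⟩ : LexSum I) < ⟨j₂, i₂⟩) (hjk : (⟨j₂, i₂⟩ : LexSum I) < ⟨j₃, i₃⟩)
    {a a' : S ⟨j₁, i₁⟩} {b b' : S ⟨j₂, i₂⟩} {d d' : S ⟨j₃, i₃⟩}
    {x₀₀₀ x₁₀₀ x₀₁₀ x₁₁₀ x₀₀₁ x₁₀₁ x₀₁₁ x₁₁₁ : ∀ p, S p}
    (i₀₀ : Along ⟨j₁, i₁⟩ x₀₀₀ x₁₀₀ a a') (i₁₀ : Along ⟨j₁, i₁⟩ x₀₁₀ x₁₁₀ a a')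
    (i₀₁ : Along ⟨j₁, i₁⟩ x₀₀₁ x₁₀₁ a a') (i₁₁ : Along ⟨j₁, i₁⟩ x₀₁₁ x₁₁₁ a a')
    (j₀₀ : Along ⟨j₂, i₂⟩ x₀₀₀ x₀₁₀ b b') (j₁₀ : Along ⟨j₂, i₂⟩ x₁₀₀ x₁₁₀ b b')
    (j₀₁ : Along ⟨j₂, i₂⟩ x₀₀₁ x₀₁₁ b b') (j₁₁ : Along ⟨j₂, i₂⟩ x₁₀₁ x₁₁₁ b b')
    (k₀₀ : Along ⟨j₃, i₃⟩ x₀₀₀ x₀₀₁ d d') (k₁₀ : Along ⟨j₃, i₃⟩ x₁₀₀ x₁₀₁ d d')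
    (k₀₁ : Along ⟨j₃, i₃⟩ x₀₁₀ x₀₁₁ d d') (k₁₁ : Along ⟨j₃, i₃⟩ x₁₁₀ x₁₁₁ d d')
    (f : a ⟶ a') (g : b ⟶ b') (h : d ⟶ d') :
    .ofEq (Strict.assoc _ _ _).symm ⊚
      (G.compCell F hij i₀₀ j₁₀ j₀₀ i₁₀ f g ▹ G.compMap F k₁₁ h) ⊚ .ofEq (Strict.assoc _ _ _) ⊚
      (G.compMap F j₀₀ g ◃ G.compCell F (hij.trans hjk) i₁₀ k₁₁ k₀₁ i₁₁ f h) ⊚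
      .ofEq (Strict.assoc _ _ _).symm ⊚
      (G.compCell F hjk j₀₀ k₀₁ k₀₀ j₀₁ g h ▹ G.compMap F i₁₁ f) ⊚ .ofEq (Strict.assoc _ _ _) =
    (G.compMap F i₀₀ f ◃ G.compCell F hjk j₁₀ k₁₁ k₁₀ j₁₁ g h) ⊚
      .ofEq (Strict.assoc _ _ _).symm ⊚
      (G.compCell F (hij.trans hjk) i₀₀ k₁₀ k₀₀ i₀₁ f h ▹ G.compMap F j₁₁ g) ⊚
      .ofEq (Strict.assoc _ _ _) ⊚
      (G.compMap F k₀₀ h ◃ G.compCell F hij i₀₁ j₁₁ j₀₁ i₁₁ f g) := by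
  have I₀₀ := i₀₀.outer F rfl rfl
  have J₀₀ := j₀₀.outer F rfl rfl
  have K₀₀ := k₀₀.outer F rfl rfl
  obtain hj | ⟨rfl, hi⟩ := compCell_cases hij
  · obtain hk | ⟨rfl, hk⟩ := compCell_cases hjk
    · have hl := hj.trans hk
      simp only [compCell_diff _ _ hj, compCell_diff _ _ hk, compCell_diff _ _ hl]
      have I₁₀ := i₁₀.outer F (j₀₀.vals_eq F hj.ne).symm (j₁₀.vals_eq F hj.ne).symm
      have I₀₁ := i₀₁.outer F (k₀₀.vals_eq F hl.ne).symm (k₁₀.vals_eq F hl.ne).symm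
      have I₁₁ := i₁₁.outer F ((k₀₁.vals_eq F hl.ne).symm.trans (j₀₀.vals_eq F hj.ne).symm)
        ((k₁₁.vals_eq F hl.ne).symm.trans (j₁₀.vals_eq F hj.ne).symm)
      have J₁₀ := j₁₀.outer F (i₀₀.vals_eq F hj.ne').symm (i₁₀.vals_eq F hj.ne').symm
      have J₀₁ := j₀₁.outer F (k₀₀.vals_eq F hk.ne).symm (k₀₁.vals_eq F hk.ne).symm
      have J₁₁ := j₁₁.outer F ((k₁₀.vals_eq F hk.ne).symm.trans (i₀₀.vals_eq F hj.ne').symm)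
        ((k₁₁.vals_eq F hk.ne).symm.trans (i₁₀.vals_eq F hj.ne').symm)
      have K₁₀ := k₁₀.outer F (i₀₀.vals_eq F hl.ne').symm (i₀₁.vals_eq F hl.ne').symm
      have K₀₁ := k₀₁.outer F (j₀₀.vals_eq F hk.ne').symm (j₀₁.vals_eq F hk.ne').symm
      have K₁₁ := k₁₁.outer F ((j₁₀.vals_eq F hk.ne').symm.trans (i₀₀.vals_eq F hl.ne').symm)
        ((j₁₁.vals_eq F hk.ne').symm.trans (i₀₁.vals_eq F hl.ne').symm)
      have hi₁₀ := inner_map_heq F i₁₀ i₀₀ f (j₀₀.restrict_eq hj.ne).symm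
        (j₁₀.restrict_eq hj.ne).symm
      have hi₀₁ := inner_map_heq F i₀₁ i₀₀ f (k₀₀.restrict_eq hl.ne).symm
        (k₁₀.restrict_eq hl.ne).symm
      have hi₁₁ := inner_map_heq F i₁₁ i₀₀ f
        ((k₀₁.restrict_eq hl.ne).symm.trans (j₀₀.restrict_eq hj.ne).symm)
        ((k₁₁.restrict_eq hl.ne).symm.trans (j₁₀.restrict_eq hj.ne).symm)
      have hj₁₀ := inner_map_heq F j₁₀ j₀₀ g (i₀₀.restrict_eq hj.ne').symm
        (i₁₀.restrict_eq hj.ne').symm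
      have hj₀₁ := inner_map_heq F j₀₁ j₀₀ g (k₀₀.restrict_eq hk.ne).symm
        (k₀₁.restrict_eq hk.ne).symm
      have hj₁₁ := inner_map_heq F j₁₁ j₀₀ g
        ((k₁₀.restrict_eq hk.ne).symm.trans (i₀₀.restrict_eq hj.ne').symm)
        ((k₁₁.restrict_eq hk.ne).symm.trans (i₁₀.restrict_eq hj.ne').symm)
      have hk₁₀ := inner_map_heq F k₁₀ k₀₀ h (i₀₀.restrict_eq hl.ne').symm
        (i₀₁.restrict_eq hl.ne').symm
      have hk₀₁ := inner_map_heq F k₀₁ k₀₀ h (j₀₀.restrict_eq hk.ne').symm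
        (j₀₁.restrict_eq hk.ne').symm
      have hk₁₁ := inner_map_heq F k₁₁ k₀₀ h
        ((j₁₀.restrict_eq hk.ne').symm.trans (i₀₀.restrict_eq hl.ne').symm)
        ((j₁₁.restrict_eq hk.ne').symm.trans (i₀₁.restrict_eq hl.ne').symm)
      have ei := G.compMap_eq F i₁₁ f I₁₁ hi₁₁
      have ej := G.compMap_eq F j₁₀ g J₁₀ hj₁₀
      have ej' := G.compMap_eq F j₁₁ g J₁₁ hj₁₁
      have ej₀ := G.compMap_eq F j₀₁ g J₀₁ hj₀₁
      have ek := G.compMap_eq F k₁₁ h K₁₁ hk₁₁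
      rw [compCellDiff_eq _ _ hj i₀₀ j₁₀ j₀₀ i₁₀ f g I₀₀ J₁₀ J₀₀ I₁₀ HEq.rfl HEq.rfl,
        compCellDiff_eq _ _ hl i₁₀ k₁₁ k₀₁ i₁₁ f h I₁₀ K₁₁ K₀₁ I₁₁ hi₁₀ hk₀₁,
        compCellDiff_eq _ _ hk j₀₀ k₀₁ k₀₀ j₀₁ g h J₀₀ K₀₁ K₀₀ J₀₁ HEq.rfl HEq.rfl,
        compCellDiff_eq _ _ hk j₁₀ k₁₁ k₁₀ j₁₁ g h J₁₀ K₁₁ K₁₀ J₁₁ hj₁₀ hk₁₀,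
        compCellDiff_eq _ _ hl i₀₀ k₁₀ k₀₀ i₀₁ f h I₀₀ K₁₀ K₀₀ I₀₁ HEq.rfl HEq.rfl,
        compCellDiff_eq _ _ hj i₀₁ j₁₁ j₀₁ i₁₁ f g I₀₁ J₁₁ J₀₁ I₁₁ hi₀₁ hj₀₁,
        WCell.whiskerRight_congr ei, WCell.whiskerRight_congr ej', WCell.whiskerRight_congr ek]
      have p : G.compMap F i₀₀ f ≫ G.compMap F j₁₀ g ≫ G.compMap F k₁₁ h = _ :=
        congrArg (_ ≫ ·) (congr (congrArg _ ej) ek)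
      have q : G.compMap F k₀₀ h ≫ G.compMap F j₀₁ g ≫ G.compMap F i₁₁ f = _ :=
        congrArg (_ ≫ ·) (congr (congrArg _ ej₀) ei)
      have c := congrArg (fun c => .ofEq p ⊚ c ⊚ .ofEq q.symm)
        (G.cube hj hk I₀₀ I₁₀ I₀₁ I₁₁ J₀₀ J₁₀ J₀₁ J₁₁ K₀₀ K₁₀ K₀₁ K₁₁ ((F j₁).map i₀₀.inner f)
        ((F j₂).map j₀₀.inner g) ((F j₃).map k₀₀.inner h))
      simpa using c
    · simp only [compCell_diff _ _ hj, compCell_same _ _ hk]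
      have J₀₁ := j₀₁.outer F rfl rfl
      have K₀₁ := k₀₁.outer F rfl rfl
      have I₁₀ := i₁₀.outer F (j₀₀.vals_eq F hj.ne).symm (j₁₀.vals_eq F hj.ne).symm
      have I₀₁ := i₀₁.outer F (k₀₀.vals_eq F hj.ne).symm (k₁₀.vals_eq F hj.ne).symm
      have I₁₁ := i₁₁.outer F ((k₀₁.vals_eq F hj.ne).symm.trans (j₀₀.vals_eq F hj.ne).symm)
        ((k₁₁.vals_eq F hj.ne).symm.trans (j₁₀.vals_eq F hj.ne).symm)
      have J₁₀ := j₁₀.outer F (i₀₀.vals_eq F hj.ne').symm (i₁₀.vals_eq F hj.ne').symm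
      have J₁₁ := j₁₁.outer F (i₀₁.vals_eq F hj.ne').symm (i₁₁.vals_eq F hj.ne').symm
      have K₁₀ := k₁₀.outer F (i₀₀.vals_eq F hj.ne').symm (i₀₁.vals_eq F hj.ne').symm
      have K₁₁ := k₁₁.outer F (i₁₀.vals_eq F hj.ne').symm (i₁₁.vals_eq F hj.ne').symm
      have hi₁₀ := inner_map_heq F i₁₀ i₀₀ f (j₀₀.restrict_eq hj.ne).symm
        (j₁₀.restrict_eq hj.ne).symm
      have hi₀₁ := inner_map_heq F i₀₁ i₀₀ f (k₀₀.restrict_eq hj.ne).symm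
        (k₁₀.restrict_eq hj.ne).symm
      have hi₁₁ := inner_map_heq F i₁₁ i₀₀ f
        ((k₀₁.restrict_eq hj.ne).symm.trans (j₀₀.restrict_eq hj.ne).symm)
        ((k₁₁.restrict_eq hj.ne).symm.trans (j₁₀.restrict_eq hj.ne).symm)
      have hj₁₀ := inner_map_heq F j₁₀ j₀₀ g (i₀₀.restrict_eq hj.ne').symm
        (i₁₀.restrict_eq hj.ne').symm
      have hj₁₁ := inner_map_heq F j₁₁ j₀₁ g (i₀₁.restrict_eq hj.ne').symm
        (i₁₁.restrict_eq hj.ne').symm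
      have hk₁₁ := inner_map_heq F k₁₁ k₀₁ h (i₁₀.restrict_eq hj.ne').symm
        (i₁₁.restrict_eq hj.ne').symm
      have ei := G.compMap_eq F i₁₁ f I₁₁ hi₁₁
      have ej := G.compMap_eq F j₁₀ g J₁₀ hj₁₀
      have ej' := G.compMap_eq F j₁₁ g J₁₁ hj₁₁
      have ek := G.compMap_eq F k₁₁ h K₁₁ hk₁₁
      obtain ⟨p₁, q₁, e₁⟩ := G.compCellSame_eq F hk j₀₀ k₀₁ k₀₀ j₀₁ g h rfl rfl rfl rfl j₀₀ k₀₁ k₀₀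
        j₀₁ (J₀₀.trans K₀₁)
      obtain ⟨p₂, q₂, e₂⟩ := G.compCellSame_eq F hk j₁₀ k₁₁ k₁₀ j₁₁ g h
        (i₀₀.restrict_eq hj.ne').symm (i₁₀.restrict_eq hj.ne').symm (i₀₁.restrict_eq hj.ne').symm
        (i₁₁.restrict_eq hj.ne').symm j₀₀ k₀₁ k₀₀ j₀₁ (J₁₀.trans K₁₁)
      rw [compCellDiff_eq _ _ hj i₀₀ j₁₀ j₀₀ i₁₀ f g I₀₀ J₁₀ J₀₀ I₁₀ HEq.rfl HEq.rfl,
        compCellDiff_eq _ _ hj i₁₀ k₁₁ k₀₁ i₁₁ f h I₁₀ K₁₁ K₀₁ I₁₁ hi₁₀ HEq.rfl,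
        compCellDiff_eq _ _ hj i₀₀ k₁₀ k₀₀ i₀₁ f h I₀₀ K₁₀ K₀₀ I₀₁ HEq.rfl HEq.rfl,
        compCellDiff_eq _ _ hj i₀₁ j₁₁ j₀₁ i₁₁ f g I₀₁ J₁₁ J₀₁ I₁₁ hi₀₁ HEq.rfl,
        e₁, e₂, WCell.whiskerRight_congr ei, WCell.whiskerRight_congr ej',
        WCell.whiskerRight_congr ek]
      have N := G.cell_wcell_right hj I₀₀ (J₁₀.trans K₁₁) (J₀₀.trans K₀₁) I₁₁
        ((F j₁).map i₀₀.inner f)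
        ((F j₂).cell hk j₀₀.inner k₀₁.inner k₀₀.inner j₀₁.inner g h)
      rw [G.cell_comp_right hj I₀₀ J₁₀ J₀₀ I₁₀ K₁₁ K₀₁ I₁₁,
        G.cell_comp_right hj I₀₀ K₁₀ K₀₀ I₀₁ J₁₁ J₀₁ I₁₁] at N
      have p : G.compMap F i₀₀ f ≫ G.compMap F j₁₀ g ≫ G.compMap F k₁₁ h =
          G.map I₀₀ _ ≫ G.map (J₁₀.trans K₁₁) _ :=
        congrArg (_ ≫ ·) ((congr (congrArg _ ej) ek).trans (G.map_comp _ _ _ _).symm)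
      have q : G.compMap F k₀₀ h ≫ G.compMap F j₀₁ g ≫ G.compMap F i₁₁ f =
          G.map (K₀₀.trans J₀₁) _ ≫ G.map I₁₁ _ :=
        (congrArg (_ ≫ _ ≫ ·) ei).trans (by rw [G.map_comp, Strict.assoc])
      have c := congrArg (fun c => .ofEq p ⊚ c ⊚ .ofEq q.symm) N
      simpa using c
  · obtain hk | ⟨rfl, hk⟩ := compCell_cases hjk
    · simp only [compCell_diff _ _ hk, compCell_same _ _ hi]
      have J₁₀ := j₁₀.outer F rfl rfl
      have I₁₀ := i₁₀.outer F rfl rfl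
      have I₀₁ := i₀₁.outer F (k₀₀.vals_eq F hk.ne).symm (k₁₀.vals_eq F hk.ne).symm
      have I₁₁ := i₁₁.outer F (k₀₁.vals_eq F hk.ne).symm (k₁₁.vals_eq F hk.ne).symm
      have J₀₁ := j₀₁.outer F (k₀₀.vals_eq F hk.ne).symm (k₀₁.vals_eq F hk.ne).symm
      have J₁₁ := j₁₁.outer F (k₁₀.vals_eq F hk.ne).symm (k₁₁.vals_eq F hk.ne).symm
      have K₁₀ := k₁₀.outer F (i₀₀.vals_eq F hk.ne').symm (i₀₁.vals_eq F hk.ne').symm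
      have K₀₁ := k₀₁.outer F (j₀₀.vals_eq F hk.ne').symm (j₀₁.vals_eq F hk.ne').symm
      have K₁₁ := k₁₁.outer F ((j₁₀.vals_eq F hk.ne').symm.trans (i₀₀.vals_eq F hk.ne').symm)
        ((j₁₁.vals_eq F hk.ne').symm.trans (i₀₁.vals_eq F hk.ne').symm)
      have hi₁₁ := inner_map_heq F i₁₁ i₁₀ f (k₀₁.restrict_eq hk.ne).symm
        (k₁₁.restrict_eq hk.ne).symm
      have hj₁₁ := inner_map_heq F j₁₁ j₁₀ g (k₁₀.restrict_eq hk.ne).symm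
        (k₁₁.restrict_eq hk.ne).symm
      have hj₀₁ := inner_map_heq F j₀₁ j₀₀ g (k₀₀.restrict_eq hk.ne).symm
        (k₀₁.restrict_eq hk.ne).symm
      have hk₁₀ := inner_map_heq F k₁₀ k₀₀ h (i₀₀.restrict_eq hk.ne').symm
        (i₀₁.restrict_eq hk.ne').symm
      have hk₀₁ := inner_map_heq F k₀₁ k₀₀ h (j₀₀.restrict_eq hk.ne').symm
        (j₀₁.restrict_eq hk.ne').symm
      have hk₁₁ := inner_map_heq F k₁₁ k₀₀ h
        ((j₁₀.restrict_eq hk.ne').symm.trans (i₀₀.restrict_eq hk.ne').symm)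
        ((j₁₁.restrict_eq hk.ne').symm.trans (i₀₁.restrict_eq hk.ne').symm)
      have ei := G.compMap_eq F i₁₁ f I₁₁ hi₁₁
      have ej := G.compMap_eq F j₀₁ g J₀₁ hj₀₁
      have ej' := G.compMap_eq F j₁₁ g J₁₁ hj₁₁
      have ek := G.compMap_eq F k₁₁ h K₁₁ hk₁₁
      obtain ⟨p₁, q₁, e₁⟩ := G.compCellSame_eq F hi i₀₀ j₁₀ j₀₀ i₁₀ f g rfl rfl rfl rfl i₀₀ j₁₀ j₀₀
        i₁₀ (I₀₀.trans J₁₀)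
      obtain ⟨p₂, q₂, e₂⟩ := G.compCellSame_eq F hi i₀₁ j₁₁ j₀₁ i₁₁ f g
        (k₀₀.restrict_eq hk.ne).symm (k₁₀.restrict_eq hk.ne).symm (k₀₁.restrict_eq hk.ne).symm
        (k₁₁.restrict_eq hk.ne).symm i₀₀ j₁₀ j₀₀ i₁₀ (I₀₁.trans J₁₁)
      rw [compCellDiff_eq _ _ hk i₁₀ k₁₁ k₀₁ i₁₁ f h I₁₀ K₁₁ K₀₁ I₁₁ HEq.rfl hk₀₁,
        compCellDiff_eq _ _ hk j₀₀ k₀₁ k₀₀ j₀₁ g h J₀₀ K₀₁ K₀₀ J₀₁ HEq.rfl HEq.rfl,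
        compCellDiff_eq _ _ hk j₁₀ k₁₁ k₁₀ j₁₁ g h J₁₀ K₁₁ K₁₀ J₁₁ HEq.rfl hk₁₀,
        compCellDiff_eq _ _ hk i₀₀ k₁₀ k₀₀ i₀₁ f h I₀₀ K₁₀ K₀₀ I₀₁ HEq.rfl HEq.rfl,
        e₁, e₂, WCell.whiskerRight_congr ei, WCell.whiskerRight_congr ej',
        WCell.whiskerRight_congr ek]
      have N := (G.cell_wcell_left hk (I₀₀.trans J₁₀) K₁₁ K₀₀ (I₀₁.trans J₁₁)
        ((F j₃).map k₀₀.inner h)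
        ((F j₁).cell hi i₀₀.inner j₁₀.inner j₀₀.inner i₁₀.inner f g)).symm
      rw [G.cell_comp_left hk I₀₀ K₁₀ K₀₀ I₀₁ J₁₀ K₁₁ J₁₁,
        G.cell_comp_left hk J₀₀ K₀₁ K₀₀ J₀₁ I₁₀ K₁₁ I₁₁] at N
      have p : G.compMap F i₀₀ f ≫ G.compMap F j₁₀ g ≫ G.compMap F k₁₁ h =
          G.map (I₀₀.trans J₁₀) _ ≫ G.map K₁₁ _ :=
        (congrArg (_ ≫ _ ≫ ·) ek).trans (by rw [G.map_comp, Strict.assoc])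
      have q : G.compMap F k₀₀ h ≫ G.compMap F j₀₁ g ≫ G.compMap F i₁₁ f =
          G.map K₀₀ _ ≫ G.map (J₀₁.trans I₁₁) _ :=
        congrArg (_ ≫ ·) ((congr (congrArg _ ej) ei).trans (G.map_comp _ _ _ _).symm)
      have c := congrArg (fun c => .ofEq p ⊚ c ⊚ .ofEq q.symm) N
      simpa using c
    · have hl := hi.trans hk
      simp only [compCell_same _ _ hi, compCell_same _ _ hk, compCell_same _ _ hl]
      have I₁₀ := i₁₀.outer F rfl rfl
      have I₀₁ := i₀₁.outer F rfl rfl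
      have I₁₁ := i₁₁.outer F rfl rfl
      have J₁₀ := j₁₀.outer F rfl rfl
      have J₀₁ := j₀₁.outer F rfl rfl
      have J₁₁ := j₁₁.outer F rfl rfl
      have K₁₀ := k₁₀.outer F rfl rfl
      have K₀₁ := k₀₁.outer F rfl rfl
      have K₁₁ := k₁₁.outer F rfl rfl
      have N := congrArg (WCell.map (G.mapFunctor (I₀₀.trans (J₁₀.trans K₁₁))))
        ((F j₁).cube hi hk i₀₀.inner i₁₀.inner i₀₁.inner i₁₁.inner j₀₀.inner j₁₀.inner j₀₁.inner
        j₁₁.inner k₀₀.inner k₁₀.inner k₀₁.inner k₁₁.inner f g h)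
      simp only [WCell.map_comp] at N
      rw [G.mapFunctor_whiskerRight (I₀₀.trans J₁₀) K₁₁,
        G.mapFunctor_whiskerLeft J₀₀ (I₁₀.trans K₁₁),
        G.mapFunctor_whiskerRight (J₀₀.trans K₀₁) I₁₁,
        G.mapFunctor_whiskerLeft I₀₀ (J₁₀.trans K₁₁),
        G.mapFunctor_whiskerRight (I₀₀.trans K₁₀) J₁₁,
        G.mapFunctor_whiskerLeft K₀₀ (I₀₁.trans J₁₁)] at N
      have p : G.compMap F i₀₀ f ≫ G.compMap F j₁₀ g ≫ G.compMap F k₁₁ h =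
          G.map (I₀₀.trans (J₁₀.trans K₁₁)) ((F j₁).map i₀₀.inner f ≫ (F j₁).map j₁₀.inner g ≫
            (F j₁).map k₁₁.inner h) := by
        rw [G.map_comp I₀₀ (J₁₀.trans K₁₁), G.map_comp J₁₀ K₁₁]
      have q : G.compMap F k₀₀ h ≫ G.compMap F j₀₁ g ≫ G.compMap F i₁₁ f =
          G.map (K₀₀.trans (J₀₁.trans I₁₁)) ((F j₁).map k₀₀.inner h ≫ (F j₁).map j₀₁.inner g ≫
            (F j₁).map i₁₁.inner f) := by
        rw [G.map_comp K₀₀ (J₀₁.trans I₁₁), G.map_comp J₀₁ I₁₁]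
      have c := congrArg (fun c => .ofEq p ⊚ c ⊚ .ofEq q.symm) N
      unfold compCellSame
      simpa using c

/-- The composite of multifunctors, with domain indexed by a lexicographic sum. -/
def compLex : Multifunctor w' w S C where
  obj x := G.obj (vals F x)
  map {p} _ _ _ _ h f := G.compMap F (j := p.1) (i := p.2) h f
  map₂ {p} _ _ _ _ h _ _ σ := G.compMap₂ F (j := p.1) (i := p.2) h σ
  map_id {p} _ _ h := G.compMap_id F (j := p.1) (i := p.2) h
  map_comp {p} _ _ _ _ _ _ h h' f g := G.compMap_comp F (j := p.1) (i := p.2) h h' f g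
  map₂_id h f := (congrArg (G.map₂ _) ((F _).map₂_id _ _)).trans (G.map₂_id _ _)
  map₂_comp h _ _ _ σ τ := (congrArg (G.map₂ _) ((F _).map₂_comp _ _ _)).trans (G.map₂_comp _ _ _)
  map₂_whisker_left {p} _ _ _ _ _ _ h h' f _ _ σ :=
    G.compMap₂_whisker_left F (j := p.1) (i := p.2) h h' f σ
  map₂_whisker_right {p} _ _ _ _ _ _ h h' _ _ σ k :=
    G.compMap₂_whisker_right F (j := p.1) (i := p.2) h h' σ k
  map_tight h _ hf := G.map_tight _ ((F _).map_tight _ hf)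
  cell {p q} hpq _ _ _ _ _ _ _ _ top right left bottom f g :=
    G.compCell F (j := p.1) (i := p.2) (j' := q.1) (i' := q.2) hpq top right left bottom f g
  cell_is hpq _ _ _ _ _ _ _ _ top right left bottom f g h :=
    G.compCell_is F hpq top right left bottom f g h
  cell_id_right hpq _ _ _ _ _ top right left f := G.compCell_id_right F hpq top right left f
  cell_comp_right hpq _ _ _ _ _ _ _ _ _ _ _ top right left middle right' left' bottom f g g' :=
    G.compCell_comp_right F hpq top right left middle right' left' bottom f g g'
  cell_naturality_right hpq _ _ _ _ _ _ _ _ top right left bottom f _ _ τ :=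
    G.compCell_naturality_right F hpq top right left bottom f τ
  cell_id_left hpq _ _ _ _ _ top left bottom g := G.compCell_id_left F hpq top left bottom g
  cell_comp_left hpq _ _ _ _ _ _ _ _ _ _ _ top middle left bottom top' right bottom' f f' g :=
    G.compCell_comp_left F hpq top middle left bottom top' right bottom' f f' g
  cell_naturality_left hpq _ _ _ _ _ _ _ _ top right left bottom _ _ g σ :=
    G.compCell_naturality_left F hpq top right left bottom g σ
  cube hij hjk _ _ _ _ _ _ _ _ _ _ _ _ _ _ i₀₀ i₁₀ i₀₁ i₁₁ j₀₀ j₁₀ j₀₁ j₁₁ k₀₀ k₁₀ k₀₁ k₁₁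
      f g h :=
    G.compCell_cube F hij hjk i₀₀ i₁₀ i₀₁ i₁₁ j₀₀ j₁₀ j₀₁ j₁₁ k₀₀ k₁₀ k₀₁ k₁₁ f g h

end Multifunctor

end Comp

/-! ### Multicategories -/

/-- A multicategory. The multimorphisms have families of objects indexed by finite linear orders as
their domains, and composition is unbiased: given a multimorphism with domain `T : κ → Obj`, and
for every `j : κ` a multimorphism with codomain `T j`, there is a composite whose domain is the
concatenation of their domains. Here a concatenation is any family indexed by a linear order `ι`
with an isomorphism from the lexicographic sum, so that reindexing is a case of composition. -/
structure Multicategory where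
  Obj : Type u
  Hom {ι : Type} [LinearOrder ι] [Finite ι] : (ι → Obj) → Obj → Type v
  id (C : Obj) : Hom (fun _ : Unit => C) C
  comp {κ : Type} [LinearOrder κ] [Finite κ] {I : κ → Type} [∀ j, LinearOrder (I j)]
    [∀ j, Finite (I j)] {ι : Type} [LinearOrder ι] [Finite ι] (e : LexSum I ≃o ι) {S : ι → Obj}
    {T : κ → Obj} {C : Obj} (g : Hom T C) (f : ∀ j, Hom (fun i : I j => S (e ⟨j, i⟩)) (T j)) :
    Hom S C
  id_comp {ι : Type} [LinearOrder ι] [Finite ι] {S : ι → Obj} {C : Obj} (f : Hom S C) :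
    comp (LexSum.single ι) (id C) (fun _ => f) = f
  comp_id {κ : Type} [LinearOrder κ] [Finite κ] {T : κ → Obj} {C : Obj} (g : Hom T C) :
    comp (LexSum.singletons κ) g (fun j => id (T j)) = g
  assoc {μ : Type} [LinearOrder μ] [Finite μ] {J : μ → Type} [∀ m, LinearOrder (J m)]
    [∀ m, Finite (J m)] {κ : Type} [LinearOrder κ] [Finite κ] (d : LexSum J ≃o κ)
    {I : κ → Type} [∀ j, LinearOrder (I j)] [∀ j, Finite (I j)] {ι : Type} [LinearOrder ι]
    [Finite ι] (e : LexSum I ≃o ι) {S : ι → Obj} {T : κ → Obj} {U : μ → Obj} {C : Obj}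
    (h : Hom U C) (g : ∀ m, Hom (fun k : J m => T (d ⟨m, k⟩)) (U m))
    (f : ∀ j, Hom (fun i : I j => S (e ⟨j, i⟩)) (T j)) :
    comp e (comp d h g) f = comp (LexSum.assoc e d) h fun m =>
      comp (OrderIso.refl _) (g m) fun k => f (d ⟨m, k⟩)

namespace Multifunctor

variable {w' w : Weakness}

/-- An `F`-functor as a unary multifunctor. -/
def ofFFunctor (w' w : Weakness) {A : FCat.{w₁, v₁, u₁}} {C : FCat.{w₂, v₂, u₂}}
    (K : FFunctor A C) : Multifunctor w' w (fun _ : Unit => A) C where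
  obj x := K.obj (x ())
  map h f := cast (by rw [← h.src, ← h.tgt]) (K.map f)
  map₂ h f g σ := cast (by obtain ⟨rfl, rfl, _⟩ := h; rfl) (K.map₂ σ)
  map_id h := by obtain ⟨rfl, _, _⟩ := h; exact K.map_id _
  map_comp h h' f g := by
    obtain ⟨rfl, rfl, _⟩ := h
    obtain ⟨_, rfl, _⟩ := h'
    exact K.map_comp _ _
  map₂_id h f := by obtain ⟨rfl, rfl, _⟩ := h; exact K.map₂_id _
  map₂_comp h _ _ _ σ τ := by obtain ⟨rfl, rfl, _⟩ := h; exact K.map₂_comp _ _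
  map₂_whisker_left h h' f _ _ σ := by
    obtain ⟨rfl, rfl, _⟩ := h
    obtain ⟨_, rfl, _⟩ := h'
    exact K.map₂_whisker_left _ _
  map₂_whisker_right h h' _ _ σ f := by
    obtain ⟨rfl, rfl, _⟩ := h
    obtain ⟨_, rfl, _⟩ := h'
    exact K.map₂_whisker_right _ _
  map_tight h f hf := by obtain ⟨rfl, rfl, _⟩ := h; exact K.map_tight hf
  cell hij := absurd hij (lt_irrefl _)
  cell_is hij := absurd hij (lt_irrefl _)
  cell_id_right hij := absurd hij (lt_irrefl _)
  cell_comp_right hij := absurd hij (lt_irrefl _)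
  cell_naturality_right hij := absurd hij (lt_irrefl _)
  cell_id_left hij := absurd hij (lt_irrefl _)
  cell_comp_left hij := absurd hij (lt_irrefl _)
  cell_naturality_left hij := absurd hij (lt_irrefl _)
  cube hij := absurd hij (lt_irrefl _)

/-- The identity multifunctor. -/
def id (w' w : Weakness) (C : FCat.{w₁, v₁, u₁}) : Multifunctor w' w (fun _ : Unit => C) C :=
  ofFFunctor w' w (FFunctor.id C)

variable {κ : Type} [LinearOrder κ] {I : κ → Type} [∀ j, LinearOrder (I j)] {ι : Type}
  [LinearOrder ι] (e : LexSum I ≃o ι) {S : ι → FCat.{w₁, v₁, u₁}} {T : κ → FCat.{w₂, v₂, u₂}}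
  {C : FCat.{w₃, v₃, u₃}}

/-- The composite of multifunctors. -/
def comp (G : Multifunctor w' w T C)
    (F : ∀ j, Multifunctor w' w (fun i : I j => S (e ⟨j, i⟩)) (T j)) : Multifunctor w' w S C :=
  (G.compLex (S := fun p => S (e p)) F).reindex e

variable (G : Multifunctor w' w T C)
  (F : ∀ j, Multifunctor w' w (fun i : I j => S (e ⟨j, i⟩)) (T j))

theorem comp_obj (x : ∀ i, S i) :
    (G.comp e F).obj x = G.obj fun j => (F j).obj fun i => x (e ⟨j, i⟩) := rfl

theorem _root_.Along.left {j : κ} {i : I j} {x y : ∀ i, S i} {a b : S (e ⟨j, i⟩)}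
    (h : Along (e ⟨j, i⟩) x y a b) : Along (S := fun i : I j => S (e ⟨j, i⟩)) i
      (fun i => x (e ⟨j, i⟩)) (fun i => y (e ⟨j, i⟩)) a b :=
  Along.inner (S := fun p => S (e p)) (h.at e rfl)

theorem _root_.Along.right {j : κ} {i : I j} {x y : ∀ i, S i} {a b : S (e ⟨j, i⟩)}
    (h : Along (e ⟨j, i⟩) x y a b) : Along j (fun j => (F j).obj fun i => x (e ⟨j, i⟩))
      (fun j => (F j).obj fun i => y (e ⟨j, i⟩)) ((F j).obj fun i => x (e ⟨j, i⟩))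
      ((F j).obj fun i => y (e ⟨j, i⟩)) :=
  Along.outer (S := fun p => S (e p)) F (h.at e rfl) rfl rfl

theorem comp_map {j : κ} {i : I j} {x y : ∀ i, S i} {a b : S (e ⟨j, i⟩)}
    (h : Along (e ⟨j, i⟩) x y a b) (f : a ⟶ b) :
    (G.comp e F).map h f = G.map (h.right e F) ((F j).map (h.left e) f) :=
  (G.compLex (S := fun p => S (e p)) F).reindex_map e h f

theorem comp_map₂ {j : κ} {i : I j} {x y : ∀ i, S i} {a b : S (e ⟨j, i⟩)}
    (h : Along (e ⟨j, i⟩) x y a b) {f g : a ⟶ b} (σ : f ⟶ g) :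
    HEq ((G.comp e F).map₂ h σ) (G.map₂ (h.right e F) ((F j).map₂ (h.left e) σ)) :=
  (G.compLex (S := fun p => S (e p)) F).reindex_map₂ e h σ

theorem comp_cell_same {j : κ} {i i' : I j} (hi : i < i') (hij : e ⟨j, i⟩ < e ⟨j, i'⟩)
    {x y z t : ∀ i, S i} {a a' : S (e ⟨j, i⟩)} {b b' : S (e ⟨j, i'⟩)}
    (top : Along (e ⟨j, i⟩) x y a a') (right : Along (e ⟨j, i'⟩) y t b b')
    (left : Along (e ⟨j, i'⟩) x z b b') (bottom : Along (e ⟨j, i⟩) z t a a')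
    (f : a ⟶ a') (g : b ⟶ b') :
    HEq ((G.comp e F).cell hij top right left bottom f g)
      (((F j).cell hi (top.left e) (right.left e) (left.left e) (bottom.left e) f g).map
        (G.mapFunctor ((top.right e F).trans (right.right e F)))) := by
  have := compCell_same (S := fun p => S (e p)) G F hi (LexSum.mk_lt_mk.2 hi) (top.at e rfl)
    (right.at e rfl) (left.at e rfl) (bottom.at e rfl) f g
  exact ((G.compLex (S := fun p => S (e p)) F).reindex_cell e (LexSum.mk_lt_mk.2 hi) hij top right
    left bottom f g).trans ((heq_of_eq this).trans (WCell.heq _ _ rfl))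

theorem comp_cell_diff {j j' : κ} (hj : j < j') {i : I j} {i' : I j'}
    (hij : e ⟨j, i⟩ < e ⟨j', i'⟩)
    {x y z t : ∀ i, S i} {a a' : S (e ⟨j, i⟩)} {b b' : S (e ⟨j', i'⟩)}
    (top : Along (e ⟨j, i⟩) x y a a') (right : Along (e ⟨j', i'⟩) y t b b')
    (left : Along (e ⟨j', i'⟩) x z b b') (bottom : Along (e ⟨j, i⟩) z t a a')
    (f : a ⟶ a') (g : b ⟶ b') {A A' : T j} {B B' : T j'} {f' : A ⟶ A'} {g' : B ⟶ B'}
    (top' : Along j (fun j => (F j).obj fun i => x (e ⟨j, i⟩))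
      (fun j => (F j).obj fun i => y (e ⟨j, i⟩)) A A')
    (right' : Along j' (fun j => (F j).obj fun i => y (e ⟨j, i⟩))
      (fun j => (F j).obj fun i => t (e ⟨j, i⟩)) B B')
    (left' : Along j' (fun j => (F j).obj fun i => x (e ⟨j, i⟩))
      (fun j => (F j).obj fun i => z (e ⟨j, i⟩)) B B')
    (bottom' : Along j (fun j => (F j).obj fun i => z (e ⟨j, i⟩))
      (fun j => (F j).obj fun i => t (e ⟨j, i⟩)) A A')
    (hf : HEq ((F j).map (top.left e) f) f') (hg : HEq ((F j').map (left.left e) g) g') :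
    HEq ((G.comp e F).cell hij top right left bottom f g)
      (G.cell hj top' right' left' bottom' f' g') := by
  have hlt := LexSum.mk_lt_mk_of_lt hj i i'
  have := (compCell_diff (S := fun p => S (e p)) G F hj hlt (top.at e rfl) (right.at e rfl)
    (left.at e rfl) (bottom.at e rfl) f g).trans (compCellDiff_eq (S := fun p => S (e p)) G F hj
    (top.at e rfl) (right.at e rfl) (left.at e rfl) (bottom.at e rfl) f g top' right' left' bottom'
    hf hg)
  exact ((G.compLex (S := fun p => S (e p)) F).reindex_cell e hlt hij top right
    left bottom f g).trans ((heq_of_eq this).trans (WCell.heq _ _ rfl))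

theorem _root_.Along.rest {j j' : κ} (hj : j' ≠ j) {i : I j} {x y : ∀ i, S i}
    {a b : S (e ⟨j, i⟩)} (h : Along (e ⟨j, i⟩) x y a b) :
    (F j').obj (fun i => x (e ⟨j', i⟩)) = (F j').obj fun i => y (e ⟨j', i⟩) :=
  congrArg (F j').obj (Along.restrict_eq (S := fun p => S (e p)) (h.at e rfl) hj)

theorem _root_.Along.right' {j : κ} {i : I j} {x y : ∀ i, S i} {a b : S (e ⟨j, i⟩)}
    (h : Along (e ⟨j, i⟩) x y a b) {A B : T j} (hA : (F j).obj (fun i => x (e ⟨j, i⟩)) = A)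
    (hB : (F j).obj (fun i => y (e ⟨j, i⟩)) = B) :
    Along j (fun j => (F j).obj fun i => x (e ⟨j, i⟩))
      (fun j => (F j).obj fun i => y (e ⟨j, i⟩)) A B :=
  Along.outer (S := fun p => S (e p)) F (h.at e rfl) hA hB

/-- `comp_cell_diff` for the evident choices. -/
theorem comp_cell_diff' {j j' : κ} (hj : j < j') {i : I j} {i' : I j'}
    (hij : e ⟨j, i⟩ < e ⟨j', i'⟩)
    {x y z t : ∀ i, S i} {a a' : S (e ⟨j, i⟩)} {b b' : S (e ⟨j', i'⟩)}
    (top : Along (e ⟨j, i⟩) x y a a') (right : Along (e ⟨j', i'⟩) y t b b')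
    (left : Along (e ⟨j', i'⟩) x z b b') (bottom : Along (e ⟨j, i⟩) z t a a')
    (f : a ⟶ a') (g : b ⟶ b') :
    HEq ((G.comp e F).cell hij top right left bottom f g)
      (G.cell hj (top.right e F)
        (right.right' e F (top.rest e F hj.ne').symm (bottom.rest e F hj.ne').symm)
        (left.right e F)
        (bottom.right' e F (left.rest e F hj.ne).symm (right.rest e F hj.ne).symm)
        ((F j).map (top.left e) f) ((F j').map (left.left e) g)) :=
  comp_cell_diff e G F hj hij top right left bottom f g _ _ _ _ HEq.rfl HEq.rfl

theorem _root_.WCell.heq_map {w : Weakness} {A : Type u} [Category.{v} A] {D : Type u₁}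
    [Category.{v₁} D] (K : A ⥤ D) {a b a' b' : A} {x : WCell w a b} {y : WCell w a' b'}
    (h : a = a') (h' : b = b') (e : HEq x y) : HEq (x.map K) (y.map K) := by
  subst h h'
  obtain rfl := eq_of_heq e
  rfl

theorem _root_.WCell.map_heq_map {w : Weakness} {A : Type u} [Category.{v} A] {D : Type u₁}
    [Category.{v₁} D] {K L : A ⥤ D} (h : K = L) {a b : A} (x : WCell w a b) :
    HEq (x.map K) (x.map L) := by
  subst h
  rfl

theorem inner_map_heq' {j : κ} {i : I j} {x y z t : ∀ i, S i} {a b : S (e ⟨j, i⟩)}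
    (h : Along (e ⟨j, i⟩) x y a b) (h' : Along (e ⟨j, i⟩) z t a b) (f : a ⟶ b)
    (hx : ∀ i, x (e ⟨j, i⟩) = z (e ⟨j, i⟩)) (hy : ∀ i, y (e ⟨j, i⟩) = t (e ⟨j, i⟩)) :
    HEq ((F j).map (h.left e) f) ((F j).map (h'.left e) f) :=
  (F j).map_heq _ _ (funext hx) (funext hy) HEq.rfl

theorem comp_mapFunctor {j : κ} {i : I j} {x y : ∀ i, S i} {a b : S (e ⟨j, i⟩)}
    (h : Along (e ⟨j, i⟩) x y a b) : (G.comp e F).mapFunctor h =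
      (F j).mapFunctor (h.left e) ⋙ G.mapFunctor (h.right e F) :=
  CategoryTheory.Functor.hext (fun f => comp_map e G F h f) fun _ _ σ => comp_map₂ e G F h σ

theorem id_map (w' w : Weakness) (C : FCat.{w₁, v₁, u₁}) {x y : Unit → C} {a b : C}
    (h : Along (S := fun _ : Unit => C) () x y a b) (f : a ⟶ b) :
    HEq ((id w' w C).map h f) f := cast_heq _ _

theorem id_map₂ (w' w : Weakness) (C : FCat.{w₁, v₁, u₁}) {x y : Unit → C} {a b : C}
    (h : Along (S := fun _ : Unit => C) () x y a b) {f g : a ⟶ b} (σ : f ⟶ g) :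
    HEq ((id w' w C).map₂ h σ) σ := cast_heq _ _

theorem cell_heq {ι : Type} [LinearOrder ι] {S : ι → FCat.{w₁, v₁, u₁}}
    (M : Multifunctor w' w S C) {i j : ι} (hij : i < j)
    {x y z t : ∀ i, S i} {a a' a₂ a₂' : S i} {b b' b₂ b₂' : S j}
    (top : Along i x y a a') (right : Along j y t b b')
    (left : Along j x z b b') (bottom : Along i z t a a')
    (top' : Along i x y a₂ a₂') (right' : Along j y t b₂ b₂')
    (left' : Along j x z b₂ b₂') (bottom' : Along i z t a₂ a₂')
    {f : a ⟶ a'} {g : b ⟶ b'} {f₂ : a₂ ⟶ a₂'} {g₂ : b₂ ⟶ b₂'} (hf : HEq f f₂) (hg : HEq g g₂) :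
    HEq (M.cell hij top right left bottom f g) (M.cell hij top' right' left' bottom' f₂ g₂) := by
  obtain rfl := top.src.symm.trans top'.src
  obtain rfl := top.tgt.symm.trans top'.tgt
  obtain rfl := right.src.symm.trans right'.src
  obtain rfl := right.tgt.symm.trans right'.tgt
  obtain rfl := eq_of_heq hf
  obtain rfl := eq_of_heq hg
  rfl

theorem _root_.WCell.map_id_heq (w' w : Weakness) (C : FCat.{w₁, v₁, u₁}) {x y : Unit → C}
    {a b : C} (h : Along (S := fun _ : Unit => C) () x y a b) {f g : a ⟶ b} (c : WCell w f g) :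
    HEq (c.map ((id w' w C).mapFunctor h)) c := by
  obtain ⟨rfl, rfl, _⟩ := h
  cases c <;> rfl

theorem id_comp' {ι : Type} [LinearOrder ι] {S : ι → FCat.{w₁, v₁, u₁}}
    (M : Multifunctor w' w S C) :
    (id w' w C).comp (LexSum.single ι) (S := S) (fun _ => M) = M := by
  refine ext_heq rfl ?_ ?_ ?_
  · intro i x y a b h f
    exact (heq_of_eq (comp_map (LexSum.single ι) (S := S) (id w' w C) (fun _ => M) (j := ())
      (i := i) h f)).trans (id_map _ _ _ _ _)
  · intro i x y a b h f g σ
    exact (comp_map₂ (LexSum.single ι) (S := S) (id w' w C) (fun _ => M) (j := ())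
      (i := i) h σ).trans (id_map₂ _ _ _ _ _)
  · intro i j hij x y z t a a' b b' top right left bottom f g
    exact (comp_cell_same (LexSum.single ι) (S := S) (id w' w C) (fun _ => M) (j := ())
      (i := i) (i' := j) hij hij top right left bottom f g).trans (WCell.map_id_heq _ _ _ _ _)

theorem comp_id' {κ : Type} [LinearOrder κ] {T : κ → FCat.{w₁, v₁, u₁}}
    (M : Multifunctor w' w T C) :
    M.comp (LexSum.singletons κ) (S := T) (fun j => id w' w (T j)) = M := by
  refine ext_heq rfl ?_ ?_ ?_
  · intro i x y a b h f
    refine (heq_of_eq (comp_map (LexSum.singletons κ) (S := T) M (fun j => id w' w (T j)) (j := i)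
      (i := ()) h f)).trans (M.map_heq _ _ rfl rfl (id_map _ _ _ _ _))
  · intro i x y a b h f g σ
    refine (comp_map₂ (LexSum.singletons κ) (S := T) M (fun j => id w' w (T j)) (j := i)
      (i := ()) h σ).trans (M.map₂_heq _ _ rfl rfl (id_map _ _ _ _ _) (id_map _ _ _ _ _)
      (id_map₂ _ _ _ _ _))
  · intro i j hij x y z t a a' b b' top right left bottom f g
    exact comp_cell_diff (LexSum.singletons κ) (S := T) M (fun j => id w' w (T j)) (j := i) (j' := j)
      (i := ()) (i' := ()) hij hij top right left bottom f g top right left bottom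
      (id_map _ _ _ _ _) (id_map _ _ _ _ _)

section assoc

variable {μ : Type} [LinearOrder μ] {J : μ → Type} [∀ m, LinearOrder (J m)]
  (d : LexSum J ≃o κ) {U : μ → FCat.{w₃, v₃, u₃}} {C : FCat.{w₄, v₄, u₄}}
  (H : Multifunctor w' w U C)
  (G : ∀ m, Multifunctor w' w (fun k : J m => T (d ⟨m, k⟩)) (U m))
  (F : ∀ j, Multifunctor w' w (fun i : I j => S (e ⟨j, i⟩)) (T j))

/-- The family of composites on the right of the associative law. -/
noncomputable abbrev assocFam (m : μ) :
    Multifunctor w' w (fun p : LexSum fun k : J m => I (d ⟨m, k⟩) => S (LexSum.assoc e d ⟨m, p⟩))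
      (U m) :=
  (G m).comp (OrderIso.refl _) (S := fun p : LexSum fun k : J m => I (d ⟨m, k⟩) =>
    S (LexSum.assoc e d ⟨m, p⟩)) fun k => F (d ⟨m, k⟩)

theorem assocFam_map {m : μ} {k : J m} {i : I (d ⟨m, k⟩)} {x y : ∀ i, S i}
    {a b : S (e ⟨d ⟨m, k⟩, i⟩)} (h : Along (e ⟨d ⟨m, k⟩, i⟩) x y a b) (f : a ⟶ b) :
    (assocFam e d G F m).map (i := ⟨k, i⟩)
      (Along.left (LexSum.assoc e d) (j := m) (i := ⟨k, i⟩) h) f =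
      (G m).map (Along.left d (h.right e F)) ((F (d ⟨m, k⟩)).map (h.left e) f) :=
  comp_map (OrderIso.refl (LexSum fun k : J m => I (d ⟨m, k⟩)))
    (S := fun p : LexSum fun k : J m => I (d ⟨m, k⟩) => S (LexSum.assoc e d ⟨m, p⟩)) (G m)
    (fun k => F (d ⟨m, k⟩)) (j := k) (i := i)
    (Along.left (LexSum.assoc e d) (j := m) (i := ⟨k, i⟩) h) f

theorem assocFam_map₂ {m : μ} {k : J m} {i : I (d ⟨m, k⟩)} {x y : ∀ i, S i}
    {a b : S (e ⟨d ⟨m, k⟩, i⟩)} (h : Along (e ⟨d ⟨m, k⟩, i⟩) x y a b) {f g : a ⟶ b} (σ : f ⟶ g) :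
    HEq ((assocFam e d G F m).map₂ (i := ⟨k, i⟩)
      (Along.left (LexSum.assoc e d) (j := m) (i := ⟨k, i⟩) h) σ)
      ((G m).map₂ (Along.left d (h.right e F)) ((F (d ⟨m, k⟩)).map₂ (h.left e) σ)) :=
  comp_map₂ (OrderIso.refl (LexSum fun k : J m => I (d ⟨m, k⟩)))
    (S := fun p : LexSum fun k : J m => I (d ⟨m, k⟩) => S (LexSum.assoc e d ⟨m, p⟩)) (G m)
    (fun k => F (d ⟨m, k⟩)) (j := k) (i := i)
    (Along.left (LexSum.assoc e d) (j := m) (i := ⟨k, i⟩) h) σ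

theorem assoc : (H.comp d G).comp e F = H.comp (LexSum.assoc e d) (S := S) fun m =>
    (G m).comp (OrderIso.refl _) (S := fun p : LexSum fun k : J m => I (d ⟨m, k⟩) =>
      S (LexSum.assoc e d ⟨m, p⟩)) fun k => F (d ⟨m, k⟩) := by
  refine ext_heq rfl ?_ ?_ ?_
  · intro i x y a b h f
    obtain ⟨⟨j, i⟩, rfl⟩ := e.surjective i
    obtain ⟨⟨m, k⟩, rfl⟩ := d.surjective j
    rw [comp_map, comp_map]
    exact heq_of_eq (Eq.trans (congrArg (H.map _) (assocFam_map e d G F h f).symm) (comp_map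
      (LexSum.assoc e d) (S := S) H (assocFam e d G F) (j := m) (i := ⟨k, i⟩) h f).symm)
  · intro i x y a b h f g σ
    obtain ⟨⟨j, i⟩, rfl⟩ := e.surjective i
    obtain ⟨⟨m, k⟩, rfl⟩ := d.surjective j
    refine (comp_map₂ e (H.comp d G) F h σ).trans ((comp_map₂ d H G _ _).trans ?_)
    refine HEq.trans ?_ (comp_map₂
      (LexSum.assoc e d) (S := S) H (assocFam e d G F) (j := m) (i := ⟨k, i⟩) h σ).symm
    exact H.map₂_heq _ _ rfl rfl (heq_of_eq (assocFam_map e d G F h f).symm)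
      (heq_of_eq (assocFam_map e d G F h g).symm)
      (assocFam_map₂ e d G F h σ).symm
  · intro i j hij x y z t a a' b b' top right left bottom f g
    obtain ⟨⟨l, i⟩, rfl⟩ := e.surjective i
    obtain ⟨⟨m, k⟩, rfl⟩ := d.surjective l
    obtain ⟨⟨l', i'⟩, rfl⟩ := e.surjective j
    obtain ⟨⟨m', k'⟩, rfl⟩ := d.surjective l'
    obtain hl | ⟨hl, hi⟩ := LexSum.lt_cases (e.lt_iff_lt.1 hij)
    · refine (comp_cell_diff' e (H.comp d G) F hl hij top right left bottom f g).trans ?_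
      obtain hm | ⟨rfl, hk⟩ := LexSum.lt_cases (d.lt_iff_lt.1 hl)
      · refine (comp_cell_diff' d H G hm hl _ _ _ _ _ _).trans (HEq.symm ?_)
        exact comp_cell_diff (LexSum.assoc e d) (S := S) H (assocFam e d G F) (j := m)
          (i := ⟨k, i⟩) (j' := m') (i' := ⟨k', i'⟩) hm hij top right left bottom f g _ _ _ _
          (heq_of_eq (assocFam_map e d G F top f)) (heq_of_eq (assocFam_map e d G F left g))
      · refine (comp_cell_same d H G hk hl _ _ _ _ _ _).trans (HEq.symm ?_)
        refine (comp_cell_same (LexSum.assoc e d) (S := S) H (assocFam e d G F) (j := m)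
          (i := ⟨k, i⟩) (i' := ⟨k', i'⟩) (LexSum.mk_lt_mk_of_lt hk _ _) hij top right left bottom
          f g).trans ?_
        have hl₁ {i : I (d ⟨m, k⟩)} : e ⟨d ⟨m, k⟩, i⟩ ≠ e ⟨d ⟨m, k'⟩, i'⟩ := fun h =>
          hl.ne (LexSum.mk.inj (e.injective h)).1
        have hl₂ {i' : I (d ⟨m, k'⟩)} : e ⟨d ⟨m, k'⟩, i'⟩ ≠ e ⟨d ⟨m, k⟩, i⟩ := fun h =>
          hl.ne' (LexSum.mk.inj (e.injective h)).1
        refine WCell.heq_map _ ?_ ?_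
          (comp_cell_diff (OrderIso.refl (LexSum fun k : J m => I (d ⟨m, k⟩)))
            (S := fun p : LexSum fun k : J m => I (d ⟨m, k⟩) => S (LexSum.assoc e d ⟨m, p⟩)) (G m)
            (fun k => F (d ⟨m, k⟩)) hk _ _ _ _ _ _ _ _ _ _ _ HEq.rfl HEq.rfl)
        · refine congr (congrArg _ (assocFam_map e d G F top f)) ?_
          exact (assocFam_map e d G F right g).trans ((G m).map_eq _ _
            (inner_map_heq' e F right left g (fun _ => (top.eq _ hl₂).symm)
              fun _ => (bottom.eq _ hl₂).symm))
        · refine congr (congrArg _ (assocFam_map e d G F left g)) ?_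
          exact (assocFam_map e d G F bottom f).trans ((G m).map_eq _ _
            (inner_map_heq' e F bottom top f (fun _ => (left.eq _ hl₁).symm)
              fun _ => (right.eq _ hl₁).symm))
    · obtain ⟨rfl, hk⟩ := LexSum.mk.inj (d.injective hl)
      obtain rfl := eq_of_heq hk
      replace hi : i < i' := hi
      refine (comp_cell_same e (H.comp d G) F hi hij top right left bottom f g).trans (HEq.symm ?_)
      refine (comp_cell_same (LexSum.assoc e d) (S := S) H (assocFam e d G F) (j := m)
          (i := ⟨k, i⟩) (i' := ⟨k, i'⟩) (LexSum.mk_lt_mk.2 hi) hij top right left bottom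
          f g).trans ?_
      refine HEq.trans ?_ (WCell.map_heq_map (comp_mapFunctor d H G _) _).symm
      refine HEq.trans ?_ (heq_of_eq (WCell.map_map ((G m).mapFunctor
        ((top.right e F).left d |>.trans ((right.right e F).left d))) (H.mapFunctor
        ((top.right e F).right d G |>.trans ((right.right e F).right d G))) _))
      refine WCell.heq_map _ ?_ ?_ ?_
      · exact (congr (congrArg _ (assocFam_map e d G F top f))
          (assocFam_map e d G F right g)).trans ((G m).map_comp _ _ _ _).symm
      · exact (congr (congrArg _ (assocFam_map e d G F left g))
          (assocFam_map e d G F bottom f)).trans ((G m).map_comp _ _ _ _).symm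
      · exact (comp_cell_same (OrderIso.refl (LexSum fun k : J m => I (d ⟨m, k⟩)))
            (S := fun p : LexSum fun k : J m => I (d ⟨m, k⟩) => S (LexSum.assoc e d ⟨m, p⟩)) (G m)
            (fun k => F (d ⟨m, k⟩)) hi (LexSum.mk_lt_mk.2 hi) _ _ _ _ _ _)

end assoc

end Multifunctor

/-- The multicategory of `F`-categories and `(w', w)`-natural `F`-multifunctors. -/
noncomputable def FCAT (w' w : Weakness) : Multicategory where
  Obj := FCat.{u, u, u}
  Hom S C := Multifunctor w' w S C
  id C := .id w' w C
  comp e _ _ _ G F := G.comp e F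
  id_comp M := M.id_comp'
  comp_id M := M.comp_id'
  assoc d _ _ _ _ _ _ e _ _ _ _ H G F := Multifunctor.assoc e d H G F

namespace FFunctor

variable {A : FCat.{w₁, v₁, u₁}} {B : FCat.{w₂, v₂, u₂}} {A' : FCat.{w₃, v₃, u₃}}
  {B' : FCat.{w₄, v₄, u₄}}

theorem ext_heq {F G : FFunctor A B} (ho : ∀ X, F.obj X = G.obj X)
    (hm : ∀ {X Y : A} (f : X ⟶ Y), HEq (F.map f) (G.map f))
    (h₂ : ∀ {X Y : A} {f g : X ⟶ Y} (σ : f ⟶ g), HEq (F.map₂ σ) (G.map₂ σ)) : F = G := by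
  obtain ⟨⟨⟨⟨⟨o, m⟩, m₂⟩, _, _⟩, _, _, _, _⟩, _⟩ := F
  obtain ⟨⟨⟨⟨⟨o', m'⟩, m₂'⟩, _, _⟩, _, _, _, _⟩, _⟩ := G
  obtain rfl : o = o' := funext ho
  obtain rfl : @m = @m' := by
    funext X Y f
    exact eq_of_heq (hm f)
  obtain rfl : @m₂ = @m₂' := by
    funext X Y f g σ
    exact eq_of_heq (h₂ σ)
  rfl

theorem _root_.WCell.ofEq_conj_ofEq {w : Weakness} {A : Type u} [Category.{v} A] {a b c d : A}
    (h₁ : a = b) (h : b = c) (h₂ : c = d) : (.ofEq h₁ ⊚ .ofEq h ⊚ .ofEq h₂ : WCell w a d) =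
      .ofEq (h₁.trans (h.trans h₂)) := by
  subst h₁ h h₂
  simp

theorem _root_.WCell.ofEq_conj {w : Weakness} {A : Type u} [Category.{v} A]
    {a a₁ a₂ a₃ a₄ a₅ a₆ a₇ : A} (h₁ : a = a₁) (h₂ : a₁ = a₂) (x : WCell w a₂ a₃)
    (y : WCell w a₃ a₄) (z : WCell w a₄ a₅) (h₃ : a₅ = a₆) (h₄ : a₆ = a₇) :
    .ofEq h₁ ⊚ (.ofEq h₂ ⊚ x ⊚ y ⊚ z ⊚ .ofEq h₃) ⊚ .ofEq h₄ =
      .ofEq (h₁.trans h₂) ⊚ x ⊚ y ⊚ z ⊚ .ofEq (h₃.trans h₄) := by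
  subst h₁ h₂ h₃ h₄
  simp

theorem _root_.Modif.conj_app {w' w : Weakness} {F G : FFunctor A B} {φ ψ φ' ψ' : WTrans w' w F G}
    (h : φ = φ') (h' : ψ' = ψ) (μ : φ' ⟶ ψ') (X : A) :
    Modif.app (eqToHom h ≫ μ ≫ eqToHom h') X =
      eqToHom (by rw [h]) ≫ μ.app X ≫ eqToHom (by rw [h']) := by
  subst h h'
  simp

theorem _root_.WTrans.cell_congr {w' w : Weakness} {F G : FFunctor A B} (φ : WTrans w' w F G)
    {X Y : A} {f g : X ⟶ Y} (h : f = g) :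
    φ.cell f = .ofEq (by rw [h]) ⊚ φ.cell g ⊚ .ofEq (by rw [h]) := by
  subst h
  simp

variable {w' w : Weakness}

theorem mapCell_comp (k : FFunctor B B') {X Y : B} {a b d : X ⟶ Y} (x : WCell w a b)
    (y : WCell w b d) : k.mapCell (x ⊚ y) = k.mapCell x ⊚ k.mapCell y := WCell.map_comp _ _ _

theorem mapCell_ofEq (k : FFunctor B B') {X Y : B} {a b : X ⟶ Y} (h : a = b) :
    k.mapCell (.ofEq h : WCell w a b) = .ofEq (congrArg k.map h) := WCell.map_ofEq _ _

/-- The image under an `F`-functor of a cell filling a square. -/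
def mapSq (k : FFunctor B B') {X Y Z V : B} {p : X ⟶ Y} {q : Y ⟶ V} {r : X ⟶ Z} {t : Z ⟶ V}
    (x : WCell w (p ≫ q) (r ≫ t)) :
    WCell w (k.map p ≫ k.map q) (k.map r ≫ k.map t) :=
  .ofEq (k.map_comp _ _).symm ⊚ k.mapCell x ⊚ .ofEq (k.map_comp _ _)

theorem mapSq_ofEq (k : FFunctor B B') {X Y Z V : B} {p : X ⟶ Y} {q : Y ⟶ V} {r : X ⟶ Z}
    {t : Z ⟶ V} (h : p ≫ q = r ≫ t) : k.mapSq (.ofEq h : WCell w _ _) =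
      .ofEq (by rw [← k.map_comp, h, k.map_comp]) := by
  unfold mapSq
  rw [mapCell_ofEq, WCell.ofEq_comp_ofEq, WCell.ofEq_comp_ofEq]

theorem mapSq_congr (k : FFunctor B B') {X Y Z V : B} {p p' : X ⟶ Y} {q q' : Y ⟶ V}
    {r r' : X ⟶ Z} {t t' : Z ⟶ V} (x : WCell w (p ≫ q) (r ≫ t)) (hp : p' = p) (hq : q' = q)
    (hr : r = r') (ht : t = t') :
    k.mapSq (.ofEq (by rw [hp, hq]) ⊚ x ⊚ .ofEq (by rw [hr, ht]) : WCell w (p' ≫ q') (r' ≫ t')) =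
      .ofEq (by rw [hp, hq]) ⊚ k.mapSq x ⊚ .ofEq (by rw [hr, ht]) := by
  subst hp hq hr ht
  simp

theorem mapSq_comp_vert (k : FFunctor B B') {X Y Z V X' Y' : B} {p : X ⟶ Y} {q : Y ⟶ V} {r : X ⟶ Z}
    {t : Z ⟶ V} {q' : V ⟶ Y'} {r' : Z ⟶ X'} {t' : X' ⟶ Y'} {q₂ : Y ⟶ Y'} {r₂ : X ⟶ X'}
    (x : WCell w (p ≫ q) (r ≫ t)) (y : WCell w (t ≫ q') (r' ≫ t')) (hq : q₂ = q ≫ q')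
    (hr : r₂ = r ≫ r') :
    k.mapSq (.ofEq (by rw [hq, Strict.assoc]) ⊚ (x ▹ q') ⊚ .ofEq (Strict.assoc _ _ _) ⊚ (r ◃ y) ⊚
      .ofEq (by rw [hr, Strict.assoc]) : WCell w (p ≫ q₂) (r₂ ≫ t')) =
    .ofEq (by rw [hq, k.map_comp, Strict.assoc]) ⊚ (k.mapSq x ▹ k.map q') ⊚
      .ofEq (Strict.assoc _ _ _) ⊚ (k.map r ◃ k.mapSq y) ⊚
      .ofEq (by rw [hr, k.map_comp, Strict.assoc]) := by
  subst hq hr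
  unfold mapSq
  rw [mapCell_comp, mapCell_comp, mapCell_comp, mapCell_comp, mapCell_ofEq, mapCell_ofEq,
    mapCell_ofEq]
  rw [k.mapCell_whiskerRight, k.mapCell_whiskerLeft]
  simp

theorem mapSq_comp_horiz (k : FFunctor B B') {X Y Z V X' Y' : B} {p : X ⟶ Y} {q : Y ⟶ V}
    {r : X ⟶ Z} {t : Z ⟶ V} {p' : Y ⟶ X'} {q' : X' ⟶ Y'} {t' : V ⟶ Y'}
    (x : WCell w (p ≫ q) (r ≫ t)) (y : WCell w (p' ≫ q') (q ≫ t')) :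
    k.mapSq (.ofEq (Strict.assoc _ _ _) ⊚ (p ◃ y) ⊚ .ofEq (Strict.assoc _ _ _).symm ⊚ (x ▹ t') ⊚
      .ofEq (Strict.assoc _ _ _) : WCell w ((p ≫ p') ≫ q') (r ≫ t ≫ t')) =
    .ofEq (by rw [k.map_comp, Strict.assoc]) ⊚ (k.map p ◃ k.mapSq y) ⊚
      .ofEq (Strict.assoc _ _ _).symm ⊚ (k.mapSq x ▹ k.map t') ⊚
      .ofEq (by rw [k.map_comp, Strict.assoc]) := by
  unfold mapSq
  rw [mapCell_comp, mapCell_comp, mapCell_comp, mapCell_comp, mapCell_ofEq, mapCell_ofEq,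
    mapCell_ofEq]
  rw [k.mapCell_whiskerRight, k.mapCell_whiskerLeft]
  simp

theorem mapSq_commutes_vert (k : FFunctor B B') {X Y Z V : B} {p : X ⟶ Y} {q q' : Y ⟶ V}
    {r r' : X ⟶ Z} {t : Z ⟶ V} {x : WCell w (p ≫ q) (r ≫ t)} {y : WCell w (p ≫ q') (r' ≫ t)}
    {σ : q ⟶ q'} {τ : r ⟶ r'} (h : x.Commutes y (p ◁ σ) (τ ▷ t)) :
    (k.mapSq x).Commutes (k.mapSq y) (k.map p ◁ k.map₂ σ) (k.map₂ τ ▷ k.map t) := by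
  refine (WCell.Commutes.ofEq _ _ ?_).comp_horiz ((h.map (k.mapFunctor _ _)).comp_horiz
    (WCell.Commutes.ofEq _ _ ?_))
  · change _ ≫ eqToHom _ = eqToHom _ ≫ k.map₂ (p ◁ σ)
    rw [k.map₂_whisker_left]
    simp
  · change k.map₂ (τ ▷ t) ≫ eqToHom _ = eqToHom _ ≫ _
    rw [k.map₂_whisker_right]
    simp

theorem mapSq_commutes_horiz (k : FFunctor B B') {X Y Z V : B} {p p' : X ⟶ Y} {q : Y ⟶ V}
    {r : X ⟶ Z} {t t' : Z ⟶ V} {x : WCell w (p ≫ q) (r ≫ t)} {y : WCell w (p' ≫ q) (r ≫ t')}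
    {σ : p ⟶ p'} {τ : t ⟶ t'} (h : x.Commutes y (σ ▷ q) (r ◁ τ)) :
    (k.mapSq x).Commutes (k.mapSq y) (k.map₂ σ ▷ k.map q) (k.map r ◁ k.map₂ τ) := by
  refine (WCell.Commutes.ofEq _ _ ?_).comp_horiz ((h.map (k.mapFunctor _ _)).comp_horiz
    (WCell.Commutes.ofEq _ _ ?_))
  · change _ ≫ eqToHom _ = eqToHom _ ≫ k.map₂ (σ ▷ q)
    rw [k.map₂_whisker_right]
    simp
  · change k.map₂ (r ◁ τ) ≫ eqToHom _ = eqToHom _ ≫ _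
    rw [k.map₂_whisker_left]
    simp

theorem mapSq_is (k : FFunctor B B') {X Y Z V : B} {p : X ⟶ Y} {q : Y ⟶ V} {r : X ⟶ Z}
    {t : Z ⟶ V} {x : WCell w (p ≫ q) (r ≫ t)} (h : x.Is w') : (k.mapSq x).Is w' :=
  .comp (.ofEq _) (.comp (.map _ h) (.ofEq _))

variable (u : FFunctor A' A) (k : FFunctor B B')

/-- The whiskering of a transformation by two `F`-functors. -/
def whisker {F G : FFunctor A B} (φ : WTrans w' w F G) :
    WTrans w' w ((u.comp F).comp k) ((u.comp G).comp k) where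
  app X := k.map (φ.app (u.obj X))
  cell f := k.mapSq (φ.cell (u.map f))
  cell_is f hf := k.mapSq_is (φ.cell_is _ (u.map_tight hf))
  cell_id X := (congrArg k.mapSq ((φ.cell_congr (u.map_id X)).trans
    (by rw [φ.cell_id, WCell.ofEq_comp_ofEq, WCell.ofEq_comp_ofEq]))).trans (k.mapSq_ofEq _)
  cell_comp f g := (congrArg k.mapSq ((φ.cell_congr (u.map_comp f g)).trans
    (by rw [φ.cell_comp]; simp only [WCell.comp_assoc, WCell.ofEq_comp_ofEq, WCell.ofEq_comp_ofEq_assoc]))).trans (k.mapSq_comp_vert (φ.cell (u.map f)) (φ.cell (u.map g)) (by rw [u.map_comp, G.map_comp]) (by rw [u.map_comp, F.map_comp]))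
  cell_naturality σ := k.mapSq_commutes_vert (φ.cell_naturality (u.map₂ σ))

/-- The whiskering of a modification by two `F`-functors. -/
def whiskerModif {F G : FFunctor A B} {φ ψ : WTrans w' w F G} (μ : φ ⟶ ψ) :
    whisker u k φ ⟶ whisker u k ψ where
  app X := k.map₂ (Modif.app μ (u.obj X))
  comm f := k.mapSq_commutes_horiz (Modif.comm μ (u.map f))

/-- The `F`-functor sending `F` to the composite of `u`, `F` and `k`. -/
def funMap (w' w : Weakness) : FFunctor (Fun w' w A B) (Fun w' w A' B') where
  obj F := (u.comp F).comp k
  map φ := whisker u k φ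
  map₂ μ := whiskerModif u k μ
  map₂_id φ := Modif.hom_ext fun X => k.map₂_id _
  map₂_comp φ ψ := Modif.hom_ext fun X => k.map₂_comp _ _
  map_id F := WTrans.ext' (fun X => k.map_id _) fun f =>
    (k.mapSq_ofEq _).trans (WCell.ofEq_conj_ofEq _ _ _).symm
  map_comp φ ψ := WTrans.ext' (fun X => k.map_comp _ _) fun f =>
    (k.mapSq_comp_horiz (WTrans.cell φ (u.map f)) (WTrans.cell ψ (u.map f))).trans
      (WCell.ofEq_conj _ _ _ _ _ _ _).symm
  map₂_whisker_left φ ψ χ μ := Modif.hom_ext fun X =>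
    (k.map₂_whisker_left _ _).trans (Modif.conj_app (φ := whisker u k (WTrans.comp φ ψ))
      (ψ := whisker u k (WTrans.comp φ χ)) _ _
      (Modif.whiskerLeft (whisker u k φ) (whiskerModif u k μ)) X).symm
  map₂_whisker_right {_ _ _ φ ψ} μ χ := Modif.hom_ext fun X =>
    (k.map₂_whisker_right _ _).trans (Modif.conj_app (φ := whisker u k (WTrans.comp φ χ))
      (ψ := whisker u k (WTrans.comp ψ χ)) _ _
      (Modif.whiskerRight (whiskerModif u k μ) (whisker u k χ)) X).symm
  map_tight h := ⟨fun X => k.map_tight (h.1 _), fun f => k.mapSq_is (h.2 _)⟩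

end FFunctor

namespace Multifunctor

section Slot

variable {w' w : Weakness} {ι : Type} [LinearOrder ι] {S : ι → FCat.{w₁, v₁, u₁}}
  {C : FCat.{w₂, v₂, u₂}} (M : Multifunctor w' w S C)

/-- The `i`-th partial `F`-functor of `M` at the tuple `x`, the entry of which at `i` is
irrelevant. -/
def slot (x : ∀ i, S i) (i : ι) : FFunctor (S i) C where
  obj a := M.obj (Function.update x i a)
  map f := M.map (Along.update x _ _) f
  map₂ σ := M.map₂ (Along.update x _ _) σ
  map₂_id f := M.map₂_id _ f
  map₂_comp σ τ := M.map₂_comp _ σ τ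
  map_id a := M.map_id _
  map_comp f g := M.map_comp _ _ f g
  map₂_whisker_left f _ _ σ := M.map₂_whisker_left _ _ f σ
  map₂_whisker_right σ f := M.map₂_whisker_right _ _ σ f
  map_tight h := M.map_tight _ h

end Slot

section Comp

variable {w' w : Weakness} {κ : Type} [LinearOrder κ] {I : κ → Type} [∀ j, LinearOrder (I j)]
  {ι : Type} [LinearOrder ι] (e : LexSum I ≃o ι) {S : ι → FCat.{w₁, v₁, u₁}}
  {T : κ → FCat.{w₂, v₂, u₂}} {C : FCat.{w₃, v₃, u₃}} (G : Multifunctor w' w T C)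
  (F : ∀ j, Multifunctor w' w (fun i : I j => S (e ⟨j, i⟩)) (T j))

theorem update_left (x : ∀ i, S i) (j : κ) (i : I j) (a : S (e ⟨j, i⟩)) :
    (fun i' => Function.update x (e ⟨j, i⟩) a (e ⟨j, i'⟩)) =
      Function.update (β := fun i' : I j => S (e ⟨j, i'⟩)) (fun i' => x (e ⟨j, i'⟩)) i a := by
  funext i'
  by_cases h : i' = i
  · subst h
    simp
  · rw [Function.update_of_ne h, Function.update_of_ne]
    exact fun h' => h (eq_of_heq (LexSum.mk.inj (e.injective h')).2)

theorem update_right (x : ∀ i, S i) (j : κ) (i : I j) (a : S (e ⟨j, i⟩)) :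
    (fun j' => (F j').obj fun i' => Function.update x (e ⟨j, i⟩) a (e ⟨j', i'⟩)) =
      Function.update (fun j' => (F j').obj fun i' => x (e ⟨j', i'⟩)) j
        (((F j).slot (fun i' => x (e ⟨j, i'⟩)) i).obj a) := by
  funext j'
  by_cases h : j' = j
  · subst h
    rw [Function.update_self]
    exact congrArg (F j').obj (update_left e x j' i a)
  · rw [Function.update_of_ne h]
    refine congrArg (F j').obj (funext fun i' => Function.update_of_ne ?_ _ _)
    exact fun h' => h (LexSum.mk.inj (e.injective h')).1

theorem slot_comp (x : ∀ i, S i) (j : κ) (i : I j) : (G.comp e F).slot x (e ⟨j, i⟩) =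
    ((F j).slot (fun i => x (e ⟨j, i⟩)) i).comp
      (G.slot (fun j => (F j).obj fun i => x (e ⟨j, i⟩)) j) := by
  refine FFunctor.ext_heq (fun a => ?_) (fun {a b} f => ?_) (fun {a b f g} σ => ?_)
  · exact congrArg G.obj (update_right e F x j i a)
  · refine (heq_of_eq (comp_map e G F (Along.update x _ _) f)).trans ?_
    exact G.map_heq _ _ (update_right e F x j i a) (update_right e F x j i b)
      ((F j).map_heq _ _ (update_left e x j i a) (update_left e x j i b) HEq.rfl)
  · refine (comp_map₂ e G F (Along.update x _ _) σ).trans ?_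
    exact G.map₂_heq _ _ (update_right e F x j i a) (update_right e F x j i b)
      ((F j).map_heq _ _ (update_left e x j i a) (update_left e x j i b) HEq.rfl)
      ((F j).map_heq _ _ (update_left e x j i a) (update_left e x j i b) HEq.rfl)
      ((F j).map₂_heq _ _ (update_left e x j i a) (update_left e x j i b) HEq.rfl HEq.rfl HEq.rfl)

end Comp

variable {w' w : Weakness} {A : FCat.{w₁, v₁, u₁}} {C : FCat.{w₂, v₂, u₂}}

/-- The `F`-functor underlying a unary multifunctor. -/
def toFFunctor (M : Multifunctor w' w (fun _ : Unit => A) C) : FFunctor A C where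
  obj a := M.obj fun _ => a
  map {a b} f := M.map (i := ()) ⟨rfl, rfl, fun _ h => (h rfl).elim⟩ f
  map₂ σ := M.map₂ _ σ
  map₂_id f := M.map₂_id _ f
  map₂_comp σ τ := M.map₂_comp _ σ τ
  map_id a := M.map_id _
  map_comp f g := M.map_comp _ _ f g
  map₂_whisker_left f _ _ σ := M.map₂_whisker_left _ _ f σ
  map₂_whisker_right σ f := M.map₂_whisker_right _ _ σ f
  map_tight h := M.map_tight _ h

theorem slot_eq_toFFunctor (M : Multifunctor w' w (fun _ : Unit => A) C) (x : Unit → A) (i : Unit) :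
    M.slot x i = M.toFFunctor := by
  have h (a : A) : Function.update x i a = fun _ => a := by
    funext j
    exact Function.update_self ..
  refine FFunctor.ext_heq (fun a => ?_) (fun {a b} f => ?_) (fun {a b f g} σ => ?_)
  · exact congrArg M.obj (h a)
  · exact M.map_heq _ _ (h a) (h b) HEq.rfl
  · exact M.map₂_heq _ _ (h a) (h b) HEq.rfl HEq.rfl HEq.rfl

theorem slot_ofFFunctor (K : FFunctor A C) (x : Unit → A) (i : Unit) :
    (ofFFunctor w' w K).slot x i = K := slot_eq_toFFunctor _ _ _

end Multifunctor

/-! ### Full sub-`F`-categories -/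

/-- The full sub-`2`-category on the objects satisfying a predicate. -/
@[reducible] def fullBicategory (B : Type u) [Bicategory.{w, v} B] (P : B → Prop) :
    Bicategory.{w, v} {X : B // P X} where
  Hom X Y := X.1 ⟶ Y.1
  id X := 𝟙 X.1
  comp f g := f ≫ g
  homCategory X Y := Bicategory.homCategory X.1 Y.1
  whiskerLeft f _ _ σ := f ◁ σ
  whiskerRight σ g := σ ▷ g
  associator f g h := α_ f g h
  leftUnitor f := λ_ f
  rightUnitor f := ρ_ f
  whiskerLeft_id _ _ := Bicategory.whiskerLeft_id _ _
  whiskerLeft_comp _ _ _ _ _ _ := Bicategory.whiskerLeft_comp _ _ _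
  id_whiskerLeft _ := Bicategory.id_whiskerLeft _
  comp_whiskerLeft _ _ _ _ _ := Bicategory.comp_whiskerLeft _ _ _
  id_whiskerRight _ _ := Bicategory.id_whiskerRight _ _
  comp_whiskerRight _ _ _ := Bicategory.comp_whiskerRight _ _ _
  whiskerRight_id _ := Bicategory.whiskerRight_id _
  whiskerRight_comp _ _ _ := Bicategory.whiskerRight_comp _ _ _
  whisker_assoc _ _ _ _ _ := Bicategory.whisker_assoc _ _ _
  whisker_exchange _ _ := Bicategory.whisker_exchange _ _
  pentagon _ _ _ _ := Bicategory.pentagon _ _ _ _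
  triangle _ _ := Bicategory.triangle _ _

namespace FCat

/-- The full sub-`F`-category on the objects satisfying a predicate. -/
def full (C : FCat.{w, v, u}) (P : C → Prop) : FCat.{w, v, u} where
  carrier := {X : C // P X}
  bicategory := fullBicategory C P
  strict := letI := fullBicategory C P
    { id_comp := fun f => Strict.id_comp (B := C) f
      comp_id := fun f => Strict.comp_id (B := C) f
      assoc := fun f g h => Strict.assoc (B := C) f g h
      leftUnitor_eqToIso := fun f => Strict.leftUnitor_eqToIso (B := C) f
      rightUnitor_eqToIso := fun f => Strict.rightUnitor_eqToIso (B := C) f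
      associator_eqToIso := fun f g h => Strict.associator_eqToIso (B := C) f g h }
  Tight {X Y} f := C.Tight (X := X.1) (Y := Y.1) f
  tight_id X := C.tight_id X.1
  tight_comp := C.tight_comp

/-- The inclusion of a full sub-`F`-category. -/
def fullIncl (C : FCat.{w, v, u}) (P : C → Prop) : FFunctor (C.full P) C where
  obj X := X.1
  map f := f
  map₂ σ := σ
  map₂_id _ := rfl
  map₂_comp _ _ := rfl
  map_id _ := rfl
  map_comp _ _ := rfl
  map₂_whisker_left _ _ _ _ := ((Category.id_comp _).trans (Category.comp_id _)).symm
  map₂_whisker_right _ _ := ((Category.id_comp _).trans (Category.comp_id _)).symm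
  map_tight h := h

end FCat

/-- The restriction of an `F`-functor to full sub-`F`-categories. -/
def FFunctor.fullMap {C : FCat.{w₁, v₁, u₁}} {D : FCat.{w₂, v₂, u₂}} (K : FFunctor C D)
    {P : C → Prop} {Q : D → Prop} (h : ∀ X, P X → Q (K.obj X)) :
    FFunctor (C.full P) (D.full Q) where
  obj X := ⟨K.obj X.1, h _ X.2⟩
  map f := K.map f
  map₂ σ := K.map₂ σ
  map₂_id f := K.map₂_id f
  map₂_comp σ τ := K.map₂_comp σ τ
  map_id X := K.map_id X.1
  map_comp f g := K.map_comp f g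
  map₂_whisker_left f _ _ σ := K.map₂_whisker_left f σ
  map₂_whisker_right σ g := K.map₂_whisker_right σ g
  map_tight h := K.map_tight h

/-! ### The `F`-category of full embeddings -/

/-- A category with a full subcategory, the objects of which are called tight. Up to isomorphism,
this is a full embedding. -/
structure TightCat where
  carrier : Type u
  [category : Category.{u} carrier]
  IsTight : carrier → Prop

attribute [instance] TightCat.category

/-- The `2`-category of categories with a full subcategory, functors between the ambient categories,
and natural transformations. -/
instance : Bicategory TightCat.{u} where
  Hom A B := A.carrier ⥤ B.carrier
  id A := 𝟭 A.carrier
  comp F G := F ⋙ G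
  homCategory A B := Functor.category
  whiskerLeft F _ _ σ := Functor.whiskerLeft F σ
  whiskerRight σ G := Functor.whiskerRight σ G
  associator F G H := Functor.associator F G H
  leftUnitor F := Functor.leftUnitor F
  rightUnitor F := Functor.rightUnitor F

instance : Bicategory.Strict TightCat.{u} where
  id_comp _ := rfl
  comp_id _ := rfl
  assoc _ _ _ := rfl

/-- The `F`-category of full embeddings: the loose morphisms are the functors, and the tight
morphisms are those which preserve tight objects. -/
def FF : FCat.{u, u, u + 1} where
  carrier := TightCat.{u}
  Tight {A B} F := ∀ a, A.IsTight a → B.IsTight (Functor.obj F a)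
  tight_id _ _ h := h
  tight_comp hf hg a h := hg _ (hf a h)

theorem conj_natTrans_app {A : Type u} [Category.{v} A] {D : Type u₁} [Category.{v₁} D]
    {F G F' G' : A ⥤ D} (h : F = F') (h' : G' = G) (τ : F' ⟶ G') (X : A) :
    (eqToHom h ≫ τ ≫ eqToHom h').app X =
      eqToHom (by rw [h]) ≫ τ.app X ≫ eqToHom (by rw [h']) := by
  subst h h'
  simp

theorem comp_eqToHom_natTrans {A : Type u} [Category.{v} A] {D : Type u₁} [Category.{v₁} D]
    {F G F' G' : A ⥤ D} (h : F = G) (h' : F' = G') {P : F ⟶ F'} {Q : G ⟶ G'}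
    (e : ∀ X, P.app X ≫ eqToHom (by rw [h']) = eqToHom (by rw [h]) ≫ Q.app X) :
    P ≫ eqToHom h' = eqToHom h ≫ Q := by
  subst h h'
  ext X
  simpa using e X

/-- The `F`-functor represented by `X`. -/
def FCat.yo (C : FCat.{u, u, u}) (X : C) : FFunctor C FF.{u} where
  obj Y := { carrier := X ⟶ Y, IsTight := C.Tight }
  map f := Bicategory.postcomp X f
  map₂ σ := (Bicategory.postcomposing _ _ _).map σ
  map₂_id f := (Bicategory.postcomposing _ _ _).map_id f
  map₂_comp σ τ := (Bicategory.postcomposing _ _ _).map_comp σ τ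
  map_id Y := Functor.hext (fun g => Strict.comp_id g) fun g g' σ => by
    change HEq (σ ▷ 𝟙 Y) σ
    rw [strict_whiskerRight_id]
    simp
  map_comp f g := Functor.hext (fun h => (Strict.assoc h f g).symm) fun h h' σ => by
    change HEq (σ ▷ (f ≫ g)) ((σ ▷ f) ▷ g)
    rw [strict_whiskerRight_comp]
    simp
  map₂_whisker_left f _ _ σ := NatTrans.ext <| funext fun h => by
    refine Eq.trans ?_ (conj_natTrans_app _ _ _ _).symm
    have e : h ◁ f ◁ σ = eqToHom (Strict.assoc _ _ _).symm ≫ (h ≫ f) ◁ σ ≫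
        eqToHom (Strict.assoc _ _ _) := by
      rw [strict_comp_whiskerLeft]
      simp
    exact e
  map₂_whisker_right σ g := NatTrans.ext <| funext fun h => by
    refine Eq.trans ?_ (conj_natTrans_app _ _ _ _).symm
    have e : h ◁ σ ▷ g = eqToHom (Strict.assoc _ _ _).symm ≫ (h ◁ σ) ▷ g ≫
        eqToHom (Strict.assoc _ _ _) := by
      rw [strict_whisker_assoc]
      simp
    exact e
  map_tight hf _ hg := C.tight_comp hg hf

instance {A : Type u} [Category.{v} A] {a b : A} : Subsingleton (WCell .s a b) where
  allEq x y := by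
    cases x
    cases y
    rfl

/-- The precomposite of a transformation with an `F`-functor. -/
def WTrans.precomp {w' w : Weakness} {A : FCat.{w₁, v₁, u₁}} {B : FCat.{w₂, v₂, u₂}}
    {C : FCat.{w₃, v₃, u₃}} (D : FFunctor A B) {F G : FFunctor B C} (φ : WTrans w' w F G) :
    WTrans w' w (D.comp F) (D.comp G) where
  app X := φ.app (D.obj X)
  cell f := φ.cell (D.map f)
  cell_is f hf := φ.cell_is _ (D.map_tight hf)
  cell_id X := (φ.cell_congr (D.map_id X)).trans
    (by rw [φ.cell_id, WCell.ofEq_comp_ofEq, WCell.ofEq_comp_ofEq]; rfl)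
  cell_comp f g := (φ.cell_congr (D.map_comp f g)).trans (by
    rw [φ.cell_comp]
    simp only [WCell.comp_assoc, WCell.ofEq_comp_ofEq, WCell.ofEq_comp_ofEq_assoc]
    rfl)
  cell_naturality σ := φ.cell_naturality (D.map₂ σ)

/-- The action of an `F`-functor `K` on `1`-cells with domain `X`, as an `F`-natural
transformation. -/
def FFunctor.yoTrans {A B : FCat.{u, u, u}} (K : FFunctor A B) (X : A) :
    WTrans .s .s (A.yo X) (K.comp (B.yo (K.obj X))) where
  app Y := K.mapFunctor X Y
  cell {Y Z} f := .strict (Functor.hext (C := X ⟶ Y) (D := K.obj X ⟶ K.obj Z)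
    (fun g => (K.map_comp g f).symm) fun (g h : X ⟶ Y) (σ : g ⟶ h) => by
      have e : HEq (K.map₂ σ ▷ K.map f) (K.map₂ (σ ▷ f)) := by
        rw [K.map₂_whisker_right]
        simp
      exact e)
  cell_is _ _ := ⟨_, rfl⟩
  cell_id _ := Subsingleton.elim _ _
  cell_comp _ _ := Subsingleton.elim _ _
  cell_naturality {Y Z f f'} σ := by
    refine comp_eqToHom_natTrans (A := X ⟶ Y) (D := K.obj X ⟶ K.obj Z) (P := _) (Q := _) _ _ ?_
    intro (g : X ⟶ Y)
    have e : K.map g ◁ K.map₂ σ ≫ eqToHom (K.map_comp g f').symm =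
        eqToHom (K.map_comp g f).symm ≫ K.map₂ (g ◁ σ) := by
      rw [K.map₂_whisker_left]
      simp
    exact e

/-! ### Sketches -/

/-- A weighted cone in `S`: a weight `W` on a small `F`-category `J`, a diagram `D` in `S`, an
object `X` of `S`, and an `F`-natural transformation from `W` to `S(X, D -)`. -/
structure WeightedCone (S : FCat.{u, u, u}) where
  J : FCat.{u, u, u}
  W : FFunctor J FF.{u}
  D : FFunctor J S
  X : S
  γ : WTrans .s .s W (D.comp (S.yo X))
  tight (j : J) : FF.Tight (γ.app j)

namespace WeightedCone

variable {A B C : FCat.{u, u, u}}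

/-- The image of a weighted cone under an `F`-functor. -/
def map (K : FFunctor A B) (c : WeightedCone A) : WeightedCone B where
  J := c.J
  W := c.W
  D := c.D.comp K
  X := K.obj c.X
  γ := c.γ.comp ((K.yoTrans c.X).precomp c.D)
  tight j := FF.tight_comp (c.tight j) fun _ h => K.map_tight h

theorem ext_γ {J : FCat.{u, u, u}} {W : FFunctor J FF.{u}} {D : FFunctor J A} {X : A}
    {γ γ' : WTrans .s .s W (D.comp (A.yo X))} {h : ∀ j, FF.Tight (γ.app j)}
    {h' : ∀ j, FF.Tight (γ'.app j)} (e : ∀ j, γ.app j = γ'.app j) :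
    WeightedCone.mk J W D X γ h = .mk J W D X γ' h' := by
  obtain rfl : γ = γ' := WTrans.ext' e fun _ => Subsingleton.elim _ _
  rfl

theorem map_id (c : WeightedCone A) : c.map (FFunctor.id A) = c :=
  ext_γ fun _ => rfl

theorem map_comp (K : FFunctor A B) (L : FFunctor B C) (c : WeightedCone A) :
    c.map (K.comp L) = (c.map K).map L :=
  ext_γ fun _ => rfl

end WeightedCone

/-- An enhanced `2`-sketch: a small `F`-category with a set of weighted cones. -/
structure Sketch where
  cat : FCat.{u, u, u}
  cones : Set (WeightedCone cat)

/-- A model of `S` in `C`: an `F`-functor sending the cones of `S` to cones of `C`. -/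
def IsModel (S C : Sketch.{u}) (K : FFunctor S.cat C.cat) : Prop :=
  ∀ c ∈ S.cones, c.map K ∈ C.cones

theorem IsModel.id (S : Sketch.{u}) : IsModel S S (FFunctor.id S.cat) := fun c hc => by
  rw [c.map_id]
  exact hc

theorem IsModel.comp {S T U : Sketch.{u}} {K : FFunctor S.cat T.cat} {L : FFunctor T.cat U.cat}
    (hK : IsModel S T K) (hL : IsModel T U L) : IsModel S U (K.comp L) := fun c hc => by
  rw [c.map_comp]
  exact hL _ (hK c hc)

/-- The evaluation `F`-functor at an object `a`. -/
def evaluation (w' w : Weakness) {A : FCat.{w₁, v₁, u₁}} (B : FCat.{w₂, v₂, u₂}) (a : A) :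
    FFunctor (Fun w' w A B) B where
  obj F := F.obj a
  map φ := WTrans.app φ a
  map₂ μ := Modif.app μ a
  map₂_id _ := rfl
  map₂_comp _ _ := rfl
  map_id _ := rfl
  map_comp _ _ := rfl
  map₂_whisker_left _ _ _ _ := ((Category.id_comp _).trans (Category.comp_id _)).symm
  map₂_whisker_right _ _ := ((Category.id_comp _).trans (Category.comp_id _)).symm
  map_tight h := h.1 a

/-- The `F`-category of models: the full sub-`F`-category of `Fun w' w S.cat C.cat` on the models. -/
def ModCat (w' w : Weakness) (S C : Sketch.{u}) : FCat.{u, u, u} :=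
  (Fun w' w S.cat C.cat).full (IsModel S C)

/-- The inclusion of the `F`-category of models in the `F`-category of `F`-functors. -/
def modIncl (w' w : Weakness) (S C : Sketch.{u}) :
    FFunctor (ModCat w' w S C) (Fun w' w S.cat C.cat) := FCat.fullIncl _ _

/-- The sketch of models of `S` in `C`: its `F`-category is the `F`-category of models, and its
cones are those which every evaluation sends to a cone of `C`. -/
def ModSketch (w' w : Weakness) (S C : Sketch.{u}) : Sketch.{u} where
  cat := ModCat w' w S C
  cones := {c | ∀ a : S.cat, c.map ((modIncl w' w S C).comp (evaluation w' w C.cat a)) ∈ C.cones}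

/-- A multimodel: a multifunctor, each partial `F`-functor of which is a model. -/
def Multifunctor.IsMultimodel {w' w : Weakness} {ι : Type} [LinearOrder ι] {S : ι → Sketch.{u}}
    {C : Sketch.{u}} (M : Multifunctor w' w (fun i => (S i).cat) C.cat) : Prop :=
  ∀ (x : ∀ i, (S i).cat) (i : ι), IsModel (S i) C (M.slot x i)

theorem Multifunctor.ofFFunctor_isMultimodel (w' w : Weakness) {S C : Sketch.{u}}
    {K : FFunctor S.cat C.cat} (hK : IsModel S C K) :
    (ofFFunctor w' w K).IsMultimodel (S := fun _ : Unit => S) := fun x i => by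
  rw [slot_ofFFunctor]
  exact hK

/-- The multicategory of enhanced `2`-sketches and `(w', w)`-natural multimodels. -/
noncomputable def FSK (w' w : Weakness) : Multicategory where
  Obj := Sketch.{u}
  Hom S C := {M : Multifunctor w' w (fun i => (S i).cat) C.cat // M.IsMultimodel}
  id C := ⟨.id w' w C.cat, Multifunctor.ofFFunctor_isMultimodel w' w (.id C)⟩
  comp e _ _ _ G F := ⟨G.1.comp e fun j => (F j).1, fun x i => by
    obtain ⟨⟨j, i⟩, rfl⟩ := e.surjective i
    rw [Multifunctor.slot_comp]
    exact ((F j).2 _ i).comp (G.2 _ j)⟩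
  id_comp M := Subtype.ext M.1.id_comp'
  comp_id M := Subtype.ext M.1.comp_id'
  assoc d _ _ _ _ _ _ e S T U C H G F :=
    Subtype.ext (Multifunctor.assoc e d (S := fun i => (S i).cat) (T := fun j => (T j).cat)
      (U := fun m => (U m).cat) H.1 (fun m => (G m).1) fun j => (F j).1)

theorem funMap_isModel {w' w : Weakness} {S S' C C' : Sketch.{u}} {p : FFunctor S'.cat S.cat}
    (hp : IsModel S' S p) {k : FFunctor C.cat C'.cat} (hk : IsModel C C' k)
    (K : Fun w' w S.cat C.cat) (hK : IsModel S C K) :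
    IsModel S' C' ((FFunctor.funMap p k w' w).obj K) := (hp.comp hK).comp hk

/-- The restriction of `FFunctor.funMap` to models. -/
def modMap (w' w : Weakness) {S S' C C' : Sketch.{u}} {p : FFunctor S'.cat S.cat}
    (hp : IsModel S' S p) {k : FFunctor C.cat C'.cat} (hk : IsModel C C' k) :
    FFunctor (ModCat w' w S C) (ModCat w' w S' C') :=
  (FFunctor.funMap p k w' w).fullMap (funMap_isModel hp hk)

theorem modMap_isModel (w' w : Weakness) {S S' C C' : Sketch.{u}} {p : FFunctor S'.cat S.cat}
    (hp : IsModel S' S p) {k : FFunctor C.cat C'.cat} (hk : IsModel C C' k) :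
    IsModel (ModSketch w' w S C) (ModSketch w' w S' C') (modMap w' w hp hk) := fun c hc a => by
  have h : (modMap w' w hp hk).comp ((modIncl w' w S' C').comp (evaluation w' w C'.cat a)) =
      ((modIncl w' w S C).comp (evaluation w' w C.cat (p.obj a))).comp k :=
    FFunctor.ext_heq (fun _ => rfl) (fun _ => HEq.rfl) fun _ => HEq.rfl
  have e : (c.map (modMap w' w hp hk)).map
      ((modIncl w' w S' C').comp (evaluation w' w C'.cat a)) =
      (c.map ((modIncl w' w S C).comp (evaluation w' w C.cat (p.obj a)))).map k :=
    (WeightedCone.map_comp _ _ _).symm.trans ((congrArg (fun L => c.map L) h).trans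
      (WeightedCone.map_comp _ _ _))
  have := hk _ (hc (p.obj a))
  exact e.symm ▸ this

namespace LexSum

variable {κ : Type} (I : κ → Type)

/-- The family of index sets `I`, extended by a one-element set at a new least index. -/
def BotFam : WithBot κ → Type := WithBot.recBotCoe Unit I

/-- The family of index sets `I`, extended by a one-element set at a new greatest index. -/
def TopFam : WithTop κ → Type := WithTop.recTopCoe Unit I

instance [∀ j, LinearOrder (I j)] (j : WithBot κ) : LinearOrder (BotFam I j) :=
  WithBot.recBotCoe (C := fun j => LinearOrder (BotFam I j)) (inferInstanceAs (LinearOrder Unit))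
    (fun j => inferInstanceAs (LinearOrder (I j))) j

instance [∀ j, LinearOrder (I j)] (j : WithTop κ) : LinearOrder (TopFam I j) :=
  WithTop.recTopCoe (C := fun j => LinearOrder (TopFam I j)) (inferInstanceAs (LinearOrder Unit))
    (fun j => inferInstanceAs (LinearOrder (I j))) j

instance [∀ j, Finite (I j)] (j : WithBot κ) : Finite (BotFam I j) :=
  WithBot.recBotCoe (C := fun j => Finite (BotFam I j)) (inferInstanceAs (Finite Unit))
    (fun j => inferInstanceAs (Finite (I j))) j

instance [∀ j, Finite (I j)] (j : WithTop κ) : Finite (TopFam I j) :=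
  WithTop.recTopCoe (C := fun j => Finite (TopFam I j)) (inferInstanceAs (Finite Unit))
    (fun j => inferInstanceAs (Finite (I j))) j

variable {I} {ι : Type} [LinearOrder κ] [∀ j, LinearOrder (I j)] [LinearOrder ι]

/-- The underlying map of `withBot`. -/
def botFun (e : LexSum I ≃o ι) : (j : WithBot κ) → BotFam I j → WithBot ι :=
  WithBot.recBotCoe (C := fun j => BotFam I j → WithBot ι) (fun _ => ⊥) fun j i => e ⟨j, i⟩

/-- The underlying map of `withTop`. -/
def topFun (e : LexSum I ≃o ι) : (j : WithTop κ) → TopFam I j → WithTop ι :=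
  WithTop.recTopCoe (C := fun j => TopFam I j → WithTop ι) (fun _ => ⊤) fun j i => e ⟨j, i⟩

/-- The extension of an isomorphism from a lexicographic sum by a new least element. -/
noncomputable def withBot (e : LexSum I ≃o ι) : LexSum (BotFam I) ≃o WithBot ι :=
  StrictMono.orderIsoOfSurjective (fun p => botFun e p.fst p.snd) (by
    rintro ⟨j, i⟩ ⟨j', i'⟩ h
    induction j using WithBot.recBotCoe with
    | bot =>
      induction j' using WithBot.recBotCoe with
      | bot => exact absurd (mk_lt_mk.1 h) (lt_irrefl ())
      | coe j' => exact WithBot.bot_lt_coe _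
    | coe j =>
      induction j' using WithBot.recBotCoe with
      | bot =>
        obtain h | ⟨h, _⟩ := lt_cases h
        · exact absurd h not_lt_bot
        · exact absurd h (WithBot.coe_ne_bot)
      | coe j' =>
        refine WithBot.coe_lt_coe.2 (e.strictMono ?_)
        obtain h | ⟨h, h'⟩ := lt_cases h
        · exact mk_lt_mk_of_lt (WithBot.coe_lt_coe.1 h) _ _
        · obtain rfl := WithBot.coe_injective h
          exact mk_lt_mk.2 h') (by
    intro i
    induction i using WithBot.recBotCoe with
    | bot => exact ⟨⟨⊥, ()⟩, rfl⟩
    | coe i =>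
      obtain ⟨⟨j, i⟩, rfl⟩ := e.surjective i
      exact ⟨⟨(j : WithBot κ), i⟩, rfl⟩)

/-- The extension of an isomorphism from a lexicographic sum by a new greatest element. -/
noncomputable def withTop (e : LexSum I ≃o ι) : LexSum (TopFam I) ≃o WithTop ι :=
  StrictMono.orderIsoOfSurjective (fun p => topFun e p.fst p.snd) (by
    rintro ⟨j, i⟩ ⟨j', i'⟩ h
    induction j' using WithTop.recTopCoe with
    | top =>
      induction j using WithTop.recTopCoe with
      | top => exact absurd (mk_lt_mk.1 h) (lt_irrefl ())
      | coe j => exact WithTop.coe_lt_top _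
    | coe j' =>
      induction j using WithTop.recTopCoe with
      | top =>
        obtain h | ⟨h, _⟩ := lt_cases h
        · exact absurd h not_top_lt
        · exact absurd h.symm (WithTop.coe_ne_top)
      | coe j =>
        refine WithTop.coe_lt_coe.2 (e.strictMono ?_)
        obtain h | ⟨h, h'⟩ := lt_cases h
        · exact mk_lt_mk_of_lt (WithTop.coe_lt_coe.1 h) _ _
        · obtain rfl := WithTop.coe_injective h
          exact mk_lt_mk.2 h') (by
    intro i
    induction i using WithTop.recTopCoe with
    | top => exact ⟨⟨⊤, ()⟩, rfl⟩
    | coe i =>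
      obtain ⟨⟨j, i⟩, rfl⟩ := e.surjective i
      exact ⟨⟨(j : WithTop κ), i⟩, rfl⟩)

end LexSum

namespace Multicategory

variable (M : Multicategory.{v, u})

/-- The composite of a multimorphism with a unary multimorphism. -/
noncomputable def andThen {ι : Type} [LinearOrder ι] [Finite ι] {S : ι → M.Obj} {C D : M.Obj} (f : M.Hom S C)
    (k : M.Hom (fun _ : Unit => C) D) : M.Hom S D :=
  M.comp (LexSum.single ι) k fun _ => f

/-- Left-closed structure on a multicategory, with internal homs `ihom X Z`, which are functorial in
`X` and `Z` by `ihomMap`: bijections between multimorphisms from `X, Y₁, …, Yₙ` to `Z` and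
multimorphisms from `Y₁, …, Yₙ` to `ihom X Z`, natural in all the variables. -/
structure LeftClosed (ihom : M.Obj → M.Obj → M.Obj)
    (ihomMap : ∀ {X X' Z Z' : M.Obj}, M.Hom (fun _ : Unit => X') X → M.Hom (fun _ : Unit => Z) Z' →
      M.Hom (fun _ : Unit => ihom X Z) (ihom X' Z')) where
  ihomMap_id (X Z : M.Obj) : ihomMap (M.id X) (M.id Z) = M.id (ihom X Z)
  ihomMap_comp {X X' X'' Z Z' Z'' : M.Obj} (f' : M.Hom (fun _ : Unit => X'') X')
    (f : M.Hom (fun _ : Unit => X') X) (k : M.Hom (fun _ : Unit => Z) Z')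
    (k' : M.Hom (fun _ : Unit => Z') Z'') :
    ihomMap (M.andThen f' f) (M.andThen k k') = M.andThen (ihomMap f k) (ihomMap f' k')
  curry {ι : Type} [LinearOrder ι] [Finite ι] (S : WithBot ι → M.Obj) (Z : M.Obj) :
    M.Hom S Z ≃ M.Hom (fun i : ι => S i) (ihom (S ⊥) Z)
  curry_comp {κ : Type} [LinearOrder κ] [Finite κ] {I : κ → Type} [∀ j, LinearOrder (I j)]
    [∀ j, Finite (I j)] {ι : Type} [LinearOrder ι] [Finite ι] (e : LexSum I ≃o ι)
    {S : WithBot ι → M.Obj} {T : WithBot κ → M.Obj} {Z Z' : M.Obj} (h : M.Hom T Z)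
    (f₀ : M.Hom (fun _ : Unit => S ⊥) (T ⊥))
    (f : ∀ j, M.Hom (fun i : I j => S (e ⟨j, i⟩)) (T j)) (k : M.Hom (fun _ : Unit => Z) Z') :
    curry S Z' (M.andThen (M.comp (LexSum.withBot e) (S := S) h (WithBot.recBotCoe f₀ f)) k) =
      M.andThen (M.comp e (S := fun i => S i) (curry T Z h) f) (ihomMap f₀ k)

/-- Right-closed structure on a multicategory, with internal homs `ihom Y Z`, which are functorial in
`Y` and `Z` by `ihomMap`: bijections between multimorphisms from `X₁, …, Xₙ, Y` to `Z` and
multimorphisms from `X₁, …, Xₙ` to `ihom Y Z`, natural in all the variables. -/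
structure RightClosed (ihom : M.Obj → M.Obj → M.Obj)
    (ihomMap : ∀ {Y Y' Z Z' : M.Obj}, M.Hom (fun _ : Unit => Y') Y → M.Hom (fun _ : Unit => Z) Z' →
      M.Hom (fun _ : Unit => ihom Y Z) (ihom Y' Z')) where
  ihomMap_id (Y Z : M.Obj) : ihomMap (M.id Y) (M.id Z) = M.id (ihom Y Z)
  ihomMap_comp {Y Y' Y'' Z Z' Z'' : M.Obj} (f' : M.Hom (fun _ : Unit => Y'') Y')
    (f : M.Hom (fun _ : Unit => Y') Y) (k : M.Hom (fun _ : Unit => Z) Z')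
    (k' : M.Hom (fun _ : Unit => Z') Z'') :
    ihomMap (M.andThen f' f) (M.andThen k k') = M.andThen (ihomMap f k) (ihomMap f' k')
  curry {ι : Type} [LinearOrder ι] [Finite ι] (S : WithTop ι → M.Obj) (Z : M.Obj) :
    M.Hom S Z ≃ M.Hom (fun i : ι => S i) (ihom (S ⊤) Z)
  curry_comp {κ : Type} [LinearOrder κ] [Finite κ] {I : κ → Type} [∀ j, LinearOrder (I j)]
    [∀ j, Finite (I j)] {ι : Type} [LinearOrder ι] [Finite ι] (e : LexSum I ≃o ι)
    {S : WithTop ι → M.Obj} {T : WithTop κ → M.Obj} {Z Z' : M.Obj} (h : M.Hom T Z)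
    (f : ∀ j, M.Hom (fun i : I j => S (e ⟨j, i⟩)) (T j))
    (f₁ : M.Hom (fun _ : Unit => S ⊤) (T ⊤)) (k : M.Hom (fun _ : Unit => Z) Z') :
    curry S Z' (M.andThen (M.comp (LexSum.withTop e) (S := S) h (WithTop.recTopCoe f₁ f)) k) =
      M.andThen (M.comp e (S := fun i => S i) (curry T Z h) f) (ihomMap f₁ k)

end Multicategory

section ClosedStructure

variable {w' w : Weakness}

/-- The functorial action of `Fun v' v` on unary multimorphisms, which sends `F` to the composite of
`f`, `F` and `k`. -/
def funHom (v' v : Weakness) {X X' Z Z' : (FCAT.{u} w' w).Obj}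
    (f : (FCAT w' w).Hom (fun _ : Unit => X') X) (k : (FCAT w' w).Hom (fun _ : Unit => Z) Z') :
    (FCAT w' w).Hom (fun _ : Unit => Fun v' v X Z) (Fun v' v X' Z') :=
  .ofFFunctor w' w (.funMap (Multifunctor.toFFunctor f) (Multifunctor.toFFunctor k) v' v)

theorem toFFunctor_isModel {X Y : Sketch.{u}} (f : (FSK w' w).Hom (fun _ : Unit => X) Y) :
    IsModel X Y (Multifunctor.toFFunctor f.1) := fun c hc =>
  Multifunctor.slot_eq_toFFunctor f.1 (fun _ => c.X) () ▸ f.2 (fun _ => c.X) () c hc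

/-- The functorial action of `ModSketch v' v` on unary multimorphisms, which sends `F` to the
composite of `f`, `F` and `k`. -/
def modHom (v' v : Weakness) {X X' Z Z' : (FSK.{u} w' w).Obj}
    (f : (FSK w' w).Hom (fun _ : Unit => X') X) (k : (FSK w' w).Hom (fun _ : Unit => Z) Z') :
    (FSK w' w).Hom (fun _ : Unit => ModSketch v' v X Z) (ModSketch v' v X' Z') :=
  ⟨.ofFFunctor w' w (modMap v' v (toFFunctor_isModel f) (toFFunctor_isModel k)),
    Multifunctor.ofFFunctor_isMultimodel w' w (modMap_isModel v' v _ _)⟩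

/-- The multifunctor to the `F`-category of `F`-functors underlying a multimodel to the sketch of
models. -/
noncomputable def toFun {v' v : Weakness} {ι : Type} [LinearOrder ι] [Finite ι]
    {S : ι → (FSK.{u} w' w).Obj} {X Z : Sketch.{u}}
    (M : (FSK w' w).Hom S (ModSketch v' v X Z)) :
    (FCAT w' w).Hom (fun i => (S i).cat) (Fun v' v X.cat Z.cat) :=
  (FCAT w' w).andThen (S := fun i => (S i).cat) (C := ModCat v' v X Z) M.1
    (.ofFFunctor w' w (modIncl v' v X Z))

end ClosedStructure

/-! The right-closed structure is currying of the last variable. With all earlier variables of a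
multifunctor `M` fixed at `x`, the partial functor in the last variable is an `F`-functor. For a
1-cell `f` in an earlier variable, the 1-cells `M(…, f, …, p)` together with the cells at the pairs
`(f, g)`, `g` in the last variable, form a loose `(w', w)`-natural transformation: this is the
naturality of the cells in their second variable. For a 2-cell in an earlier variable, naturality of
the cells in their first variable yields a modification, and the unit and composition laws in the
first variable say that `f` is sent functorially to its transformation. If `f` is tight, then so are
the components, and all cells at `f` are `w'`-cells, which is tightness of the transformation.

For two earlier variables, the cells of `M` at `(f, g)` have to be assembled, as `p` varies, into
one `w`-cell between composite transformations. The compatibility that this requires along a 1-cell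
in the last variable is exactly the cube axiom with the last variable as third direction. The other
axioms of the curried multifunctor are equations that can be checked at every `p`, where they are
axioms of `M`. Everything can be read backwards, because a `w`-cell between transformations is the
same as a compatible family of `w`-cells between their components (`WCell.ofApp`, `WCell.app_comm`,
`WCell.app_ext`), and because it is a `w'`-cell as soon as all of its components are
(`WCell.is_of_app`). The result is `Multifunctor.curryEquiv`.

The left-closed structure follows by reversal. A `w`-cell from `a` to `b` is a `w.bar`-cell from `b`
to `a`, so that transposing all squares turns a `(w', w)`-natural multifunctor into a `(w'.bar,
w.bar)`-natural one with its variables in the opposite order (`Multifunctor.revEquiv`). Reversing,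
currying the variable which is now last, and reversing the remaining variables gives
`Multifunctor.curryLeftEquiv`; the bars cancel except inside the internal hom.

Naturality is proved for the inverse bijections (`Multifunctor.uncurry_comp` and
`Multifunctor.uncurryLeft_comp`): both sides are then multifunctors with values in the same
`F`-category, and they are compared on objects, 1-cells, 2-cells and cells. On each of these both
sides amount to substituting into the inner multifunctors, evaluating, and applying the `F`-functor
between the codomains.

For sketches, the bijections restrict. The partial functor of an uncurried multifunctor in the new
variable is a value of the given multifunctor `N`, and the one in an old variable `i` is the `i`-th
partial functor of `N` followed by an evaluation. The cones of the sketch of models are by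
definition those which the evaluations send to cones, so the uncurried multifunctor is a multimodel
exactly if `N` takes values in models and is a multimodel to the sketch of models. Since models span
a full sub-`F`-category, the naturality can be tested after forgetting that values are models, where
it is the one already proved. -/

namespace WCell

/-! ### Cells between transformations, in terms of their components -/

section

variable {A : Type u} [Category.{v} A] {a b : A}

/-- The equality underlying an `s`-cell. -/
theorem eq : WCell .s a b → a = b
  | strict h => h

/-- The isomorphism underlying a `p`-cell. -/
def iso : WCell .p a b → (a ≅ b)
  | pseudo α => α

/-- The morphism underlying an `l`-cell. -/
def laxHom : WCell .l a b → (a ⟶ b)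
  | lax α => α

/-- The morphism underlying a `c`-cell. -/
def colaxHom : WCell .c a b → (b ⟶ a)
  | colax α => α

end

variable {w' w : Weakness} {A : FCat.{w₁, v₁, u₁}} {B : FCat.{w₂, v₂, u₂}}
  {F G : FFunctor A B} {φ ψ : WTrans w' w F G}

/-- Evaluation of transformations and modifications at an object. -/
abbrev _root_.Modif.eval (w' w : Weakness) (F G : FFunctor A B) (X : A) :
    WTrans w' w F G ⥤ (F.obj X ⟶ G.obj X) where
  obj φ := φ.app X
  map μ := Modif.app μ X

/-- The component at an object of a `w`-cell between transformations. -/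
def app {w₀ : Weakness} (x : WCell w₀ φ ψ) (X : A) : WCell w₀ (φ.app X) (ψ.app X) :=
  x.map (Modif.eval w' w F G X)

/-- By the definition of a modification, the cells `φ.cell f` form a family, indexed by the
transformations `φ`, which is natural with respect to modifications. `WCell.natural` extends this to
`w`-cells between transformations, the weakness being the same as that of the cells of the family.
-/
theorem app_comm (x : WCell w φ ψ) {X Y : A} (f : X ⟶ Y) :
    (x.app X ▹ G.map f) ⊚ ψ.cell f = φ.cell f ⊚ (F.map f ◃ x.app Y) := by
  unfold app WCell.whiskerLeft WCell.whiskerRight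
  rw [map_map, map_map]
  exact (WCell.natural (Modif.eval w' w F G X ⋙ postcomp _ (G.map f))
    (Modif.eval w' w F G Y ⋙ precomp _ (F.map f)) (fun φ => φ.cell f)
    (fun τ => Modif.comm τ f) x).symm

/-- A `w`-cell between transformations, given by compatible components. -/
def ofApp (x : ∀ X, WCell w (φ.app X) (ψ.app X)) (hx : ∀ (X Y : A) (f : X ⟶ Y),
    (x X ▹ G.map f) ⊚ ψ.cell f = φ.cell f ⊚ (F.map f ◃ x Y)) : WCell w φ ψ :=
  match w, φ, ψ, x, hx with
  -- Any two `s`-cells with the same ends are equal, so equality of the components is already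
  -- equality of the transformations.
  | .s, _, _, x, _ => strict (WTrans.ext' (fun X => (x X).eq) fun _ => Subsingleton.elim _ _)
  | .p, φ, ψ, x, hx => pseudo
    { hom := ⟨fun X => (x X).iso.hom, fun {X Y} f => by
        have h := hx X Y f
        revert h
        cases x X; cases x Y; cases φ.cell f; cases ψ.cell f
        exact fun h => congrArg Iso.hom (WCell.pseudo.inj h)⟩
      inv := ⟨fun X => (x X).iso.inv, fun {X Y} f => by
        have h := hx X Y f
        revert h
        cases x X with | pseudo P => ?_
        cases x Y with | pseudo Q => ?_
        cases φ.cell f with | pseudo α => ?_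
        cases ψ.cell f with | pseudo β => ?_
        intro h
        replace h : P.hom ▷ G.map f ≫ β.hom = α.hom ≫ F.map f ◁ Q.hom :=
          congrArg Iso.hom (WCell.pseudo.inj h)
        change P.inv ▷ G.map f ≫ α.hom = β.hom ≫ F.map f ◁ Q.inv
        -- After composition with the invertible 2-cell `F.map f ◁ Q.hom`, the condition for the
        -- inverses becomes the condition for the components themselves.
        rw [← cancel_mono (F.map f ◁ Q.hom), Category.assoc, ← h]
        simp⟩
      hom_inv_id := Modif.hom_ext fun X => (x X).iso.hom_inv_id
      inv_hom_id := Modif.hom_ext fun X => (x X).iso.inv_hom_id }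
  | .l, φ, ψ, x, hx => lax ⟨fun X => (x X).laxHom, fun {X Y} f => by
      have h := hx X Y f
      revert h
      cases x X; cases x Y; cases φ.cell f; cases ψ.cell f
      exact fun h => WCell.lax.inj h⟩
  -- The modification runs from `ψ` to `φ`, so that its compatibility is the given equation read
  -- from right to left.
  | .c, φ, ψ, x, hx => colax ⟨fun X => (x X).colaxHom, fun {X Y} f => by
      have h := hx X Y f
      revert h
      cases x X; cases x Y; cases φ.cell f; cases ψ.cell f
      exact fun h => (WCell.colax.inj h).symm⟩

@[simp] theorem ofApp_app (x : ∀ X, WCell w (φ.app X) (ψ.app X)) (hx : ∀ (X Y : A) (f : X ⟶ Y),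
    (x X ▹ G.map f) ⊚ ψ.cell f = φ.cell f ⊚ (F.map f ◃ x Y)) (X : A) :
    (ofApp x hx).app X = x X := by
  cases w
  · exact Subsingleton.elim _ _
  · change pseudo (Iso.mk _ _ _ _) = _
    generalize h : x X = y
    cases y
    exact congrArg pseudo (Iso.ext (congrArg (fun z : WCell .p _ _ => z.iso.hom) h))
  · change lax _ = _
    generalize h : x X = y
    cases y
    exact congrArg lax (congrArg laxHom h)
  · change colax _ = _
    generalize h : x X = y
    cases y
    exact congrArg colax (congrArg colaxHom h)

variable {w₀ w₀' : Weakness} {χ : WTrans w' w F G}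

theorem app_ext {x y : WCell w₀ φ ψ} (h : ∀ X, x.app X = y.app X) : x = y := by
  cases x with
  | strict => exact Subsingleton.elim _ _
  | pseudo α =>
    cases y with | pseudo β =>
    exact congrArg pseudo (Iso.ext (Modif.hom_ext fun X =>
      congrArg Iso.hom (WCell.pseudo.inj (h X))))
  | lax α =>
    cases y with | lax β =>
    exact congrArg lax (Modif.hom_ext fun X => WCell.lax.inj (h X))
  | colax α =>
    cases y with | colax β =>
    exact congrArg colax (Modif.hom_ext fun X => WCell.colax.inj (h X))

@[simp] theorem app_comp (x : WCell w₀ φ ψ) (y : WCell w₀ ψ χ) (X : A) :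
    (x ⊚ y).app X = x.app X ⊚ y.app X := map_comp _ _ _

@[simp] theorem app_ofEq (h : φ = ψ) (X : A) :
    (ofEq h : WCell w₀ φ ψ).app X = ofEq (by rw [h]) := map_ofEq _ _

theorem Is.app {x : WCell w₀ φ ψ} (h : x.Is w₀') (X : A) : (x.app X).Is w₀' := h.map _

/-- For `w' = s`: if all components are identities, then `app_comm` says that the cells of the two
transformations agree, so the transformations are equal. For `w' = p`: inverses of the components
are automatically compatible with the cells, hence assemble to an inverse by `ofApp`. This is what
makes the curried multifunctor have `w'`-cells where it should. -/
theorem is_of_app {x : WCell w φ ψ} (h : ∀ X, (x.app X).Is w₀') : x.Is w₀' := by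
  cases w₀'
  · have e : φ = ψ := WTrans.ext' (fun X => (h X).1) fun {X Y} f => by
      have := x.app_comm f
      obtain ⟨hX, eX⟩ := h X
      obtain ⟨hY, eY⟩ := h Y
      rw [eX, eY, ofEq_whiskerRight, whiskerLeft_ofEq] at this
      rw [← comp_ofEq_rfl rfl (φ.cell f)]
      have h' : F.map f ≫ φ.app Y = F.map f ≫ ψ.app Y := by rw [hY]
      rw [← comp_assoc, this]
      simp
    refine ⟨e, app_ext fun X => ?_⟩
    obtain ⟨_, eX⟩ := h X
    rw [eX, app_ofEq]
  · choose y hy hy' using h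
    refine ⟨ofApp y fun X Y f => ?_, app_ext fun X => ?_, app_ext fun X => ?_⟩
    · have := x.app_comm f
      -- Composing the compatibility of the components with their inverses on both sides gives the
      -- compatibility of the inverses.
      have h₁ := congrArg (fun z => (y X ▹ G.map f) ⊚ z ⊚ (F.map f ◃ y Y)) this
      simp only [comp_assoc] at h₁
      rw [← whiskerLeft_comp, hy, ← comp_assoc, ← comp_whiskerRight, hy'] at h₁
      simpa using h₁.symm
    · simpa using hy X
    · simpa using hy' X
  all_goals trivial

theorem commutes_of_app {φ' ψ' : WTrans w' w F G} {x : WCell w₀ φ ψ} {y : WCell w₀ φ' ψ'}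
    {P : φ ⟶ φ'} {Q : ψ ⟶ ψ'}
    (h : ∀ X, (x.app X).Commutes (y.app X) (Modif.app P X) (Modif.app Q X)) :
    x.Commutes y P Q := by
  cases x <;> cases y <;> refine Modif.hom_ext fun X => ?_
  · have := h X
    simp only [app, WCell.map, Commutes] at this
    simpa using this
  all_goals exact h X

theorem Commutes.app {φ' ψ' : WTrans w' w F G} {x : WCell w₀ φ ψ} {y : WCell w₀ φ' ψ'}
    {P : φ ⟶ φ'} {Q : ψ ⟶ ψ'} (h : x.Commutes y P Q) (X : A) :
    (x.app X).Commutes (y.app X) (Modif.app P X) (Modif.app Q X) :=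
  h.map (Modif.eval w' w F G X)

end WCell

/-! ### Evaluation of pasting diagrams in the `F`-category of `F`-functors -/

section

variable {w' w w₀ : Weakness} {A : FCat.{w₁, v₁, u₁}} {B : FCat.{w₂, v₂, u₂}}
  {F G H : Fun w' w A B}

/-- The component at an object of a `w`-cell in the `F`-category of `F`-functors. -/
def WCell.ev {φ ψ : F ⟶ G} (x : WCell w₀ φ ψ) (X : A) :
    WCell w₀ (WTrans.app φ X) (WTrans.app ψ X) := WCell.app x X

namespace WCell

theorem ev_ext {φ ψ : F ⟶ G} {x y : WCell w₀ φ ψ} (h : ∀ X, x.ev X = y.ev X) : x = y := app_ext h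

@[simp] theorem ev_comp {φ ψ χ : F ⟶ G} (x : WCell w₀ φ ψ) (y : WCell w₀ ψ χ) (X : A) :
    (x ⊚ y).ev X = x.ev X ⊚ y.ev X := app_comp _ _ _

@[simp] theorem ev_ofEq {φ ψ : F ⟶ G} (h : φ = ψ) (X : A) :
    (ofEq h : WCell w₀ φ ψ).ev X = ofEq (by rw [h]) := app_ofEq _ _

@[simp] theorem ev_whiskerLeft (φ : F ⟶ G) {ψ χ : G ⟶ H} (x : WCell w₀ ψ χ) (X : A) :
    (φ ◃ x).ev X = WTrans.app φ X ◃ x.ev X := by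
  cases x <;> rfl

@[simp] theorem ev_whiskerRight {φ ψ : F ⟶ G} (x : WCell w₀ φ ψ) (χ : G ⟶ H) (X : A) :
    (x ▹ χ).ev X = x.ev X ▹ WTrans.app χ X := by
  cases x <;> rfl

/-- Evaluation at an object preserves pastings. This lemma and the next have the shapes of the
composition laws for the cells of a multifunctor in the second and in the first variable. The
equalities of boundaries are hypotheses, so that they match whichever proofs occur there. -/
theorem ev_pasteRight {G' : Fun w' w A B} {a a' : F ⟶ G} {χ : G ⟶ H} {φ : F ⟶ G'}
    {b b' : G' ⟶ H} {s t : F ⟶ H} (h₁ : s = a ≫ χ) (x : WCell w₀ a a') (h₂ : a' ≫ χ = φ ≫ b)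
    (y : WCell w₀ b b') (h₃ : φ ≫ b' = t) (X : A) :
    WCell.ev (.ofEq h₁ ⊚ (x ▹ χ) ⊚ .ofEq h₂ ⊚ (φ ◃ y) ⊚ .ofEq h₃) X =
      .ofEq (congrArg (fun ψ => WTrans.app ψ X) h₁) ⊚ (x.ev X ▹ WTrans.app χ X) ⊚
      .ofEq (congrArg (fun ψ => WTrans.app ψ X) h₂) ⊚ (WTrans.app φ X ◃ y.ev X) ⊚
      .ofEq (congrArg (fun ψ => WTrans.app ψ X) h₃) := by
  simp only [ev_comp, ev_ofEq, ev_whiskerLeft, ev_whiskerRight]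
  rfl

theorem ev_pasteLeft {G' : Fun w' w A B} {a a' : F ⟶ G} {χ : G ⟶ H} {φ : F ⟶ G'}
    {b b' : G' ⟶ H} {s t : F ⟶ H} (h₁ : s = φ ≫ b) (y : WCell w₀ b b') (h₂ : φ ≫ b' = a ≫ χ)
    (x : WCell w₀ a a') (h₃ : a' ≫ χ = t) (X : A) :
    WCell.ev (.ofEq h₁ ⊚ (φ ◃ y) ⊚ .ofEq h₂ ⊚ (x ▹ χ) ⊚ .ofEq h₃) X =
      .ofEq (congrArg (fun ψ => WTrans.app ψ X) h₁) ⊚ (WTrans.app φ X ◃ y.ev X) ⊚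
      .ofEq (congrArg (fun ψ => WTrans.app ψ X) h₂) ⊚ (x.ev X ▹ WTrans.app χ X) ⊚
      .ofEq (congrArg (fun ψ => WTrans.app ψ X) h₃) := by
  simp only [ev_comp, ev_ofEq, ev_whiskerLeft, ev_whiskerRight]
  rfl

/-- The shapes here and in `ev_cubeRight` are the two sides of the cube axiom. -/
theorem ev_cubeLeft {G₁ G₂ G₃ : Fun w' w A B} {a a' : F ⟶ G₁} {χ : G₁ ⟶ H} {φ : F ⟶ G₂}
    {b b' : G₂ ⟶ H} {d d' : F ⟶ G₃} {ξ : G₃ ⟶ H} {s t : F ⟶ H} (h₁ : s = a ≫ χ)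
    (x : WCell w₀ a a') (h₂ : a' ≫ χ = φ ≫ b) (y : WCell w₀ b b') (h₃ : φ ≫ b' = d ≫ ξ)
    (z : WCell w₀ d d') (h₄ : d' ≫ ξ = t) (X : A) :
    WCell.ev (.ofEq h₁ ⊚ (x ▹ χ) ⊚ .ofEq h₂ ⊚ (φ ◃ y) ⊚ .ofEq h₃ ⊚ (z ▹ ξ) ⊚ .ofEq h₄) X =
      .ofEq (congrArg (fun ψ => WTrans.app ψ X) h₁) ⊚ (x.ev X ▹ WTrans.app χ X) ⊚
      .ofEq (congrArg (fun ψ => WTrans.app ψ X) h₂) ⊚ (WTrans.app φ X ◃ y.ev X) ⊚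
      .ofEq (congrArg (fun ψ => WTrans.app ψ X) h₃) ⊚ (z.ev X ▹ WTrans.app ξ X) ⊚
      .ofEq (congrArg (fun ψ => WTrans.app ψ X) h₄) := by
  simp only [ev_comp, ev_ofEq, ev_whiskerLeft, ev_whiskerRight]
  rfl

theorem ev_cubeRight {G₁ G₂ G₃ : Fun w' w A B} {φ : F ⟶ G₁} {a a' : G₁ ⟶ H}
    {b b' : F ⟶ G₂} {χ : G₂ ⟶ H} {ξ : F ⟶ G₃} {d d' : G₃ ⟶ H}
    (x : WCell w₀ a a') (h₁ : φ ≫ a' = b ≫ χ) (y : WCell w₀ b b') (h₂ : b' ≫ χ = ξ ≫ d)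
    (z : WCell w₀ d d') (X : A) :
    WCell.ev ((φ ◃ x) ⊚ .ofEq h₁ ⊚ (y ▹ χ) ⊚ .ofEq h₂ ⊚ (ξ ◃ z)) X =
      (WTrans.app φ X ◃ x.ev X) ⊚ .ofEq (congrArg (fun ψ => WTrans.app ψ X) h₁) ⊚
      (y.ev X ▹ WTrans.app χ X) ⊚ .ofEq (congrArg (fun ψ => WTrans.app ψ X) h₂) ⊚
      (WTrans.app ξ X ◃ z.ev X) := by
  simp only [ev_comp, ev_ofEq, ev_whiskerLeft, ev_whiskerRight]
  rfl

end WCell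

end

/-! ### Tuples with a last entry -/

section Glue

variable {ι : Type} {S : WithTop ι → FCat.{w₁, v₁, u₁}}

/-- The tuple with entries `x` and last entry `a`. -/
def glueTop (x : ∀ i : ι, S i) (a : S ⊤) : ∀ k, S k := WithTop.recTopCoe (C := fun k => S k) a x

theorem glueTop_surjective (z : ∀ k, S k) : ∃ (x : ∀ i : ι, S i) (a : S ⊤), z = glueTop x a :=
  ⟨fun i => z i, z ⊤, funext fun k => by cases k <;> rfl⟩

theorem Along.glueTop {i : ι} {x y : ∀ i : ι, S i} {a b : S i}
    (h : Along (S := fun i : ι => S i) i x y a b) (p : S ⊤) :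
    Along (i : WithTop ι) (glueTop x p) (glueTop y p) a b where
  src := h.src
  tgt := h.tgt
  eq k hk := by
    cases k with
    | top => rfl
    | coe k => exact h.eq k fun e => hk (congrArg _ e)

theorem Along.top (x : ∀ i : ι, S i) (a b : S ⊤) :
    Along ⊤ (_root_.glueTop x a) (_root_.glueTop x b) a b where
  src := rfl
  tgt := rfl
  eq k hk := by
    cases k with
    | top => exact absurd rfl hk
    | coe k => rfl

theorem Along.of_glueTop {i : ι} {x y : ∀ i : ι, S i} {a b : S i} {p q : S ⊤}
    (h : Along (i : WithTop ι) (_root_.glueTop x p) (_root_.glueTop y q) a b) :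
    Along (S := fun i : ι => S i) i x y a b :=
  ⟨h.src, h.tgt, fun k hk => h.eq k fun e => hk (WithTop.coe_injective e)⟩

theorem Along.last_eq {i : ι} {x y : ∀ i : ι, S i} {a b : S i} {p q : S ⊤}
    (h : Along (i : WithTop ι) (_root_.glueTop x p) (_root_.glueTop y q) a b) : p = q :=
  h.eq ⊤ WithTop.top_ne_coe

theorem Along.init_eq {x y : ∀ i : ι, S i} {a b p q : S ⊤}
    (h : Along ⊤ (_root_.glueTop x p) (_root_.glueTop y q) a b) : x = y :=
  funext fun k => h.eq k WithTop.coe_ne_top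

end Glue

/-- The five factors are those of the cell of a composite of two transformations. The rebracketing
passes between the cube axiom, in which all faces are on one level, and the compatibility of a
family of components with the cells of composite transformations. -/
theorem WCell.comp_assoc₅ {w : Weakness} {A : Type u} [Category.{v} A]
    {a₀ a₁ a₂ a₃ a₄ a₅ a₆ : A} (x₁ : WCell w a₀ a₁) (x₂ : WCell w a₁ a₂) (x₃ : WCell w a₂ a₃)
    (x₄ : WCell w a₃ a₄) (x₅ : WCell w a₄ a₅) (x₆ : WCell w a₅ a₆) :
    (x₁ ⊚ x₂ ⊚ x₃ ⊚ x₄ ⊚ x₅) ⊚ x₆ = x₁ ⊚ x₂ ⊚ x₃ ⊚ x₄ ⊚ x₅ ⊚ x₆ := by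
  simp

/-! ### Currying the last variable -/

namespace Multifunctor

variable {w' w : Weakness} {ι : Type} [LinearOrder ι]

section Curry

variable {S : WithTop ι → FCat.{w₁, v₁, u₁}}
  {C : FCat.{w₂, v₂, u₂}} (M : Multifunctor w' w S C)

/-- The partial `F`-functor in the last variable. -/
def lastSlot (x : ∀ i : ι, S i) : FFunctor (S ⊤) C where
  obj a := M.obj (glueTop x a)
  map f := M.map (.top x _ _) f
  map₂ σ := M.map₂ (.top x _ _) σ
  map₂_id f := M.map₂_id _ f
  map₂_comp σ τ := M.map₂_comp _ σ τ
  map_id _ := M.map_id _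
  map_comp f g := M.map_comp _ _ f g
  map₂_whisker_left f _ _ σ := M.map₂_whisker_left _ _ f σ
  map₂_whisker_right σ f := M.map₂_whisker_right _ _ σ f
  map_tight h := M.map_tight _ h

/-- The transformation between partial `F`-functors in the last variable. -/
def lastTrans {i : ι} {x y : ∀ i : ι, S i} {a b : S i}
    (h : Along (S := fun i : ι => S i) i x y a b) (f : a ⟶ b) :
    WTrans w' w (M.lastSlot x) (M.lastSlot y) where
  app p := M.map (h.glueTop p) f
  cell g := M.cell (WithTop.coe_lt_top i) (h.glueTop _) (.top y _ _) (.top x _ _) (h.glueTop _) f g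
  -- Here it is the last variable that is tight; the case in which `f` is tight gives the tightness
  -- of the transformation instead.
  cell_is g hg := M.cell_is _ _ _ _ _ f g (.inr hg)
  cell_id _ := M.cell_id_right _ _ _ _ f
  cell_comp g g' := M.cell_comp_right _ _ _ _ (h.glueTop _) _ _ _ f g g'
  cell_naturality τ := M.cell_naturality_right _ _ _ _ _ f τ

/-- The modification between partial `F`-functors in the last variable. -/
def lastModif {i : ι} {x y : ∀ i : ι, S i} {a b : S i}
    (h : Along (S := fun i : ι => S i) i x y a b) {f g : a ⟶ b} (σ : f ⟶ g) :
    M.lastTrans h f ⟶ M.lastTrans h g where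
  app p := M.map₂ (h.glueTop p) σ
  -- The modification axiom is the 2-cell naturality of the cells in their first variable.
  comm k := M.cell_naturality_left _ _ _ _ _ k σ

/-- The cells of a multifunctor, as cells between transformations. -/
def lastCell {i j : ι} (hij : i < j) {x y z t : ∀ i : ι, S i}
    {a a' : S i} {b b' : S j}
    (top : Along (S := fun i : ι => S i) i x y a a')
    (right : Along (S := fun i : ι => S i) j y t b b')
    (left : Along (S := fun i : ι => S i) j x z b b')
    (bottom : Along (S := fun i : ι => S i) i z t a a') (f : a ⟶ a') (g : b ⟶ b') :
    WCell w ((M.lastTrans top f).comp (M.lastTrans right g))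
      ((M.lastTrans left g).comp (M.lastTrans bottom f)) :=
  .ofApp (fun p => M.cell (WithTop.coe_lt_coe.2 hij) (top.glueTop p) (right.glueTop p)
    (left.glueTop p) (bottom.glueTop p) f g) fun p q h => by
    -- The cube in the directions `i < j < ⊤`, with `h : p ⟶ q` in the last one. The two faces in
    -- the directions `i`, `j` are the components at `p` and `q`, and the four others are cells of
    -- the transformations.
    have := M.cube (WithTop.coe_lt_coe.2 hij) (WithTop.coe_lt_top j) (top.glueTop p)
      (bottom.glueTop p) (top.glueTop q) (bottom.glueTop q) (left.glueTop p) (right.glueTop p)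
      (left.glueTop q) (right.glueTop q) (.top x p q) (.top y p q) (.top z p q) (.top t p q) f g h
    -- Cancelling the associativity at the start of one side leaves the required compatibility, up
    -- to brackets.
    have e := congrArg (fun c => .ofEq (Strict.assoc _ _ _) ⊚ c) this
    simp only [WCell.ofEq_comp_ofEq_assoc, WCell.ofEq_rfl_comp] at e
    exact e.trans (WCell.comp_assoc₅ _ _ _ _ _ _).symm

theorem lastCell_app {i j : ι} (hij : i < j) {x y z t : ∀ i : ι, S i}
    {a a' : S i} {b b' : S j}
    (top : Along (S := fun i : ι => S i) i x y a a')
    (right : Along (S := fun i : ι => S i) j y t b b')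
    (left : Along (S := fun i : ι => S i) j x z b b')
    (bottom : Along (S := fun i : ι => S i) i z t a a') (f : a ⟶ a') (g : b ⟶ b') (p : S ⊤) :
    WCell.app (M.lastCell hij top right left bottom f g) p =
      M.cell (WithTop.coe_lt_coe.2 hij) (top.glueTop p) (right.glueTop p)
        (left.glueTop p) (bottom.glueTop p) f g := WCell.ofApp_app _ _ p

/-- The multifunctor into the `F`-category of `F`-functors corresponding to a multifunctor. -/
def curry : Multifunctor w' w (fun i : ι => S i) (Fun w' w (S ⊤) C) where
  obj x := M.lastSlot x
  map h f := M.lastTrans h f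
  map₂ h f g σ := M.lastModif h σ
  -- Equality of transformations has a part on components and a part on cells. The first is
  -- functoriality of `M` in the variable `i`; the second, here and in the next field, is a law of
  -- the cells in their first variable.
  map_id h := WTrans.ext' (fun p => M.map_id _) fun k => by
    refine (M.cell_id_left _ _ _ _ k).trans ?_
    exact (WCell.ofEq_conj_ofEq _ _ _).symm
  map_comp h h' f g := WTrans.ext' (fun p => M.map_comp (h.glueTop p) (h'.glueTop p) f g)
    fun k => by
      refine (M.cell_comp_left (WithTop.coe_lt_top _) (h.glueTop _) (.top _ _ _) (.top _ _ _)
        (h.glueTop _) (h'.glueTop _) (.top _ _ _) (h'.glueTop _) f g k).trans ?_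
      exact (WCell.ofEq_conj _ _ _ _ _ _ _).symm
  map₂_id h f := Modif.hom_ext fun p => M.map₂_id _ f
  map₂_comp h _ _ _ σ τ := Modif.hom_ext fun p => M.map₂_comp _ σ τ
  map₂_whisker_left h h' f g k σ := Modif.hom_ext fun p =>
    (M.map₂_whisker_left (h.glueTop p) (h'.glueTop p) f σ).trans
      (Modif.conj_app (φ := M.lastTrans (h.trans h') (f ≫ g))
        (ψ := M.lastTrans (h.trans h') (f ≫ k)) (φ' := WTrans.comp _ _) (ψ' := WTrans.comp _ _) _ _
        (Modif.whiskerLeft (M.lastTrans h f) (M.lastModif h' σ)) p).symm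
  map₂_whisker_right h h' f g σ k := Modif.hom_ext fun p =>
    (M.map₂_whisker_right (h.glueTop p) (h'.glueTop p) σ k).trans
      (Modif.conj_app (φ := M.lastTrans (h.trans h') (f ≫ k))
        (ψ := M.lastTrans (h.trans h') (g ≫ k)) (φ' := WTrans.comp _ _) (ψ' := WTrans.comp _ _) _ _
        (Modif.whiskerRight (M.lastModif h σ) (M.lastTrans h' k)) p).symm
  -- Tightness of a transformation also asks that its cell at every `k`, tight or not, be a
  -- `w'`-cell; this holds since `f` is tight.
  map_tight h _ hf := ⟨fun p => M.map_tight _ hf, fun k => M.cell_is _ _ _ _ _ _ k (.inl hf)⟩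
  cell hij _ _ _ _ _ _ _ _ top right left bottom f g := M.lastCell hij top right left bottom f g
  cell_is hij _ _ _ _ _ _ _ _ top right left bottom f g h := WCell.is_of_app fun p => by
    refine (congrArg (WCell.Is · w') (M.lastCell_app hij top right left bottom f g p)).mpr ?_
    exact M.cell_is _ _ _ _ _ f g h
  -- This law and the following ones are checked at each entry `p` of the last variable, where they
  -- are the laws of `M` for earlier variables with `p` held constant.
  cell_id_right hij _ _ _ _ _ top right left f := WCell.ev_ext fun p => by
    refine (M.lastCell_app hij top right left top f (𝟙 _) p).trans ?_
    refine (M.cell_id_right _ _ _ _ f).trans ?_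
    symm
    refine (WCell.ev_ofEq _ p).trans ?_
    rfl
  cell_comp_right hij _ _ _ _ _ _ _ _ _ _ _ top right left middle right' left' bottom f g g' :=
    WCell.ev_ext fun p => by
      refine (M.lastCell_app hij top _ _ bottom f _ p).trans ?_
      refine (M.cell_comp_right _ _ (right.glueTop p) (left.glueTop p) (middle.glueTop p)
        (right'.glueTop p) (left'.glueTop p) _ f g g').trans ?_
      -- Written as components, the cells on the right make up the evaluation at `p` of the pasting
      -- which is to be recognised.
      rw [← M.lastCell_app hij top right left middle,
        ← M.lastCell_app hij middle right' left' bottom]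
      symm
      refine (WCell.ev_pasteRight _ _ _ _ _ p).trans ?_
      rfl
  cell_naturality_right hij _ _ _ _ _ _ _ _ top right left bottom f g g' τ :=
    WCell.commutes_of_app fun p => by
      have := M.cell_naturality_right (WithTop.coe_lt_coe.2 hij) (top.glueTop p) (right.glueTop p)
        (left.glueTop p) (bottom.glueTop p) f τ
      rw [← M.lastCell_app hij, ← M.lastCell_app hij] at this
      exact this
  cell_id_left hij _ _ _ _ _ top left bottom g := WCell.ev_ext fun p => by
    refine (M.lastCell_app hij top left left bottom (𝟙 _) g p).trans ?_
    refine (M.cell_id_left _ _ _ _ g).trans ?_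
    symm
    refine (WCell.ev_ofEq _ p).trans ?_
    rfl
  cell_comp_left hij _ _ _ _ _ _ _ _ _ _ _ top middle left bottom top' right bottom' f f' g :=
    WCell.ev_ext fun p => by
      refine (M.lastCell_app hij _ right left _ _ g p).trans ?_
      refine (M.cell_comp_left _ (top.glueTop p) (middle.glueTop p) (left.glueTop p)
        (bottom.glueTop p) (top'.glueTop p) _ (bottom'.glueTop p) f f' g).trans ?_
      rw [← M.lastCell_app hij top middle left bottom,
        ← M.lastCell_app hij top' right middle bottom']
      symm
      refine (WCell.ev_pasteLeft _ _ _ _ _ p).trans ?_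
      rfl
  cell_naturality_left hij _ _ _ _ _ _ _ _ top right left bottom f f' g σ :=
    WCell.commutes_of_app fun p => by
      have := M.cell_naturality_left (WithTop.coe_lt_coe.2 hij) (top.glueTop p) (right.glueTop p)
        (left.glueTop p) (bottom.glueTop p) g σ
      rw [← M.lastCell_app hij, ← M.lastCell_app hij] at this
      exact this
  cube hij hjk _ _ _ _ _ _ _ _ _ _ _ _ _ _ i₀₀ i₁₀ i₀₁ i₁₁ j₀₀ j₁₀ j₀₁ j₁₁ k₀₀ k₁₀ k₀₁ k₁₁
      f g h := WCell.ev_ext fun p => by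
    -- In contrast to the cube used for a single cell, all three directions are now earlier
    -- variables and the last entry does not move.
    have := M.cube (WithTop.coe_lt_coe.2 hij) (WithTop.coe_lt_coe.2 hjk) (i₀₀.glueTop p)
      (i₁₀.glueTop p) (i₀₁.glueTop p) (i₁₁.glueTop p)
      (j₀₀.glueTop p) (j₁₀.glueTop p) (j₀₁.glueTop p) (j₁₁.glueTop p) (k₀₀.glueTop p)
      (k₁₀.glueTop p) (k₀₁.glueTop p) (k₁₁.glueTop p) f g h
    rw [← M.lastCell_app hij i₀₀ j₁₀ j₀₀ i₁₀, ← M.lastCell_app hij i₀₁ j₁₁ j₀₁ i₁₁,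
      ← M.lastCell_app hjk j₀₀ k₀₁ k₀₀ j₀₁, ← M.lastCell_app hjk j₁₀ k₁₁ k₁₀ j₁₁,
      ← M.lastCell_app (hij.trans hjk) i₁₀ k₁₁ k₀₁ i₁₁,
      ← M.lastCell_app (hij.trans hjk) i₀₀ k₁₀ k₀₀ i₀₁] at this
    refine (WCell.ev_cubeLeft _ _ _ _ _ _ _ p).trans (Eq.trans this ?_)
    symm
    refine (WCell.ev_cubeRight _ _ _ _ _ p).trans ?_
    rfl

end Curry

end Multifunctor

/-! ### Uncurrying the last variable -/

section

variable {ι : Type} {S : WithTop ι → FCat.{w₁, v₁, u₁}}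

/-- A step in an earlier variable keeps the last entry. Together with `Along.eq_glueTop`, for steps
in the last variable, this allows one to replace all tuples in a diagram by glued ones, on which the
transports below are trivial. -/
theorem Along.exists_glueTop {i : ι} {x : ∀ i : ι, S i} {p : S ⊤} {y : ∀ k, S k} {a b : S i}
    (h : Along (i : WithTop ι) (_root_.glueTop x p) y a b) :
    ∃ y' : ∀ i : ι, S i, y = _root_.glueTop y' p := by
  obtain ⟨y, q, rfl⟩ := glueTop_surjective y
  obtain rfl := h.last_eq
  exact ⟨y, rfl⟩

theorem Along.eq_glueTop {x : ∀ i : ι, S i} {p : S ⊤} {y : ∀ k, S k} {a b : S ⊤}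
    (h : Along ⊤ (_root_.glueTop x p) y a b) : y = _root_.glueTop x b := by
  obtain ⟨y, q, rfl⟩ := glueTop_surjective y
  obtain rfl := h.init_eq
  obtain rfl : q = b := h.tgt
  rfl

end

theorem WTrans.cell_eq_of_eq {w' w : Weakness} {A : FCat.{w₁, v₁, u₁}} {B : FCat.{w₂, v₂, u₂}}
    {F G : FFunctor A B} {φ ψ : WTrans w' w F G} (h : φ = ψ) {X Y : A} (f : X ⟶ Y) :
    φ.cell f = .ofEq (by rw [h]) ⊚ ψ.cell f ⊚ .ofEq (by rw [h]) := by
  subst h; simp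

namespace Multifunctor

section Uncurry

variable {w' w : Weakness} {ι : Type} [LinearOrder ι] {S : WithTop ι → FCat.{w₁, v₁, u₁}}
  {C : FCat.{w₂, v₂, u₂}} (N : Multifunctor w' w (fun i : ι => S i) (Fun w' w (S ⊤) C))

/-- The `F`-functor given by a tuple of objects. -/
def fobj (x : ∀ i : ι, S i) : FFunctor (S ⊤) C := N.obj x

/-- The transformation given by a `1`-cell. -/
def ftrans {i : ι} {x y : ∀ i : ι, S i} {a b : S i}
    (h : Along (S := fun i : ι => S i) i x y a b) (f : a ⟶ b) :
    WTrans w' w (N.fobj x) (N.fobj y) := N.map h f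

/-- The modification given by a `2`-cell. -/
def fmodif {i : ι} {x y : ∀ i : ι, S i} {a b : S i}
    (h : Along (S := fun i : ι => S i) i x y a b) {f g : a ⟶ b} (σ : f ⟶ g) :
    N.ftrans h f ⟶ N.ftrans h g := N.map₂ h σ

/-- The component at `p` of a cell. -/
def fcell {i j : ι} (hij : i < j) {x y z t : ∀ i : ι, S i} {a a' : S i} {b b' : S j}
    (top : Along (S := fun i : ι => S i) i x y a a')
    (right : Along (S := fun i : ι => S i) j y t b b')
    (left : Along (S := fun i : ι => S i) j x z b b')
    (bottom : Along (S := fun i : ι => S i) i z t a a') (f : a ⟶ a') (g : b ⟶ b') (p : S ⊤) :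
    WCell w ((N.ftrans top f).app p ≫ (N.ftrans right g).app p)
      ((N.ftrans left g).app p ≫ (N.ftrans bottom f).app p) :=
  (N.cell hij top right left bottom f g).ev p

/-- The values of `uncurry` at tuples. -/
def uncurryObj (x : ∀ k, S k) : C := (N.fobj fun i => x i).obj (x ⊤)

/-- The values of `uncurry` at `1`-cells. -/
def uncurryMap : {k : WithTop ι} → {x y : ∀ k, S k} → {a b : S k} → Along k x y a b → (a ⟶ b) →
    (N.uncurryObj x ⟶ N.uncurryObj y)
  -- The tuple `y` agrees with `x` off the last variable, and its last entry is `b`, only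
  -- propositionally, whence the cast. For glued tuples the two types are definitionally equal and
  -- the cast disappears.
  | ⊤, x, y, a, b, h, f => cast (by
      obtain ⟨x, p, rfl⟩ := glueTop_surjective x
      obtain rfl := h.eq_glueTop
      obtain rfl : p = a := h.src
      rfl) ((N.fobj fun i => x i).map f)
  | (i : ι), x, y, a, b, h, f => cast (by
      obtain ⟨x, p, rfl⟩ := glueTop_surjective x
      obtain ⟨y, rfl⟩ := h.exists_glueTop
      rfl) ((N.ftrans (y := fun i => y i) ⟨h.src, h.tgt, fun k hk => h.eq k fun e =>
        hk (WithTop.coe_injective e)⟩ f).app (x ⊤))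

/-- The values of `uncurry` at `2`-cells. -/
def uncurryMap₂ : {k : WithTop ι} → {x y : ∀ k, S k} → {a b : S k} → (h : Along k x y a b) →
    {f g : a ⟶ b} → (f ⟶ g) → (N.uncurryMap h f ⟶ N.uncurryMap h g)
  | ⊤, x, y, a, b, h, f, g, σ => cast (by
      obtain ⟨x, p, rfl⟩ := glueTop_surjective x
      obtain rfl := h.eq_glueTop
      obtain rfl : p = a := h.src
      rfl) ((N.fobj fun i => x i).map₂ σ)
  | (i : ι), x, y, a, b, h, f, g, σ => cast (by
      obtain ⟨x, p, rfl⟩ := glueTop_surjective x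
      obtain ⟨y, rfl⟩ := h.exists_glueTop
      rfl) (Modif.app (N.fmodif (y := fun i => y i) ⟨h.src, h.tgt, fun k hk => h.eq k fun e =>
        hk (WithTop.coe_injective e)⟩ σ) (x ⊤))

/-- The cells of `uncurry`. -/
def uncurryCell : {k l : WithTop ι} → (hkl : k < l) → {x y z t : ∀ k, S k} → {a a' : S k} →
    {b b' : S l} → (top : Along k x y a a') → (right : Along l y t b b') →
    (left : Along l x z b b') → (bottom : Along k z t a a') → (f : a ⟶ a') → (g : b ⟶ b') →
    WCell w (N.uncurryMap top f ≫ N.uncurryMap right g) (N.uncurryMap left g ≫ N.uncurryMap bottom f)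
  | ⊤, _, h, _, _, _, _, _, _, _, _, _, _, _, _, _, _ => absurd h not_top_lt
  -- Against the last variable, the cell is one of those that belong to the transformation given by
  -- `f`. Between two earlier variables it is the component, at the last entry, of a cell of `N`.
  | (i : ι), ⊤, _, x, y, z, t, a, a', b, b', top, right, left, bottom, f, g => cast (by
      obtain ⟨x, p, rfl⟩ := glueTop_surjective x
      obtain ⟨y, rfl⟩ := top.exists_glueTop
      obtain rfl := right.eq_glueTop
      obtain rfl := left.eq_glueTop
      obtain rfl : p = b := left.src
      rfl) ((N.ftrans (x := fun i => x i) (y := fun i => y i) ⟨top.src, top.tgt, fun k hk =>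
        top.eq k fun e => hk (WithTop.coe_injective e)⟩ f).cell g)
  | (i : ι), (j : ι), hij, x, y, z, t, a, a', b, b', top, right, left, bottom, f, g => cast (by
      obtain ⟨x, p, rfl⟩ := glueTop_surjective x
      obtain ⟨y, rfl⟩ := top.exists_glueTop
      obtain ⟨z, rfl⟩ := left.exists_glueTop
      obtain ⟨t, rfl⟩ := bottom.exists_glueTop
      rfl) (N.fcell (WithTop.coe_lt_coe.1 hij) (x := fun i => x i) (y := fun i => y i)
        (z := fun i => z i) (t := fun i => t i)
        ⟨top.src, top.tgt, fun k hk => top.eq k fun e => hk (WithTop.coe_injective e)⟩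
        ⟨right.src, right.tgt, fun k hk => right.eq k fun e => hk (WithTop.coe_injective e)⟩
        ⟨left.src, left.tgt, fun k hk => left.eq k fun e => hk (WithTop.coe_injective e)⟩
        ⟨bottom.src, bottom.tgt, fun k hk => bottom.eq k fun e => hk (WithTop.coe_injective e)⟩
        f g (x ⊤))

/-- In the last variable this is a law of the `F`-functor `N.fobj x`; in an earlier one it is the
component at `p` of the corresponding law of `N`. All laws of 1-cells and 2-cells below follow this
pattern. -/
theorem uncurryMap_id {k : WithTop ι} {x : ∀ k, S k} {a : S k} (h : Along k x x a a) :
    N.uncurryMap h (𝟙 a) = 𝟙 (N.uncurryObj x) := by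
  obtain ⟨x, p, rfl⟩ := glueTop_surjective x
  cases k with
  | top =>
    obtain rfl : p = a := h.src
    exact (N.fobj x).map_id p
  | coe i => exact congrArg (fun φ => WTrans.app φ p) (N.map_id h.of_glueTop)

theorem uncurryMap_comp {k : WithTop ι} {x y z : ∀ k, S k} {a b d : S k} (h : Along k x y a b)
    (h' : Along k y z b d) (f : a ⟶ b) (g : b ⟶ d) :
    N.uncurryMap (h.trans h') (f ≫ g) = N.uncurryMap h f ≫ N.uncurryMap h' g := by
  obtain ⟨x, p, rfl⟩ := glueTop_surjective x
  cases k with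
  | top =>
    obtain rfl := h.eq_glueTop
    obtain rfl := h'.eq_glueTop
    obtain rfl : p = a := h.src
    exact (N.fobj x).map_comp f g
  | coe i =>
    obtain ⟨y, rfl⟩ := h.exists_glueTop
    obtain ⟨z, rfl⟩ := h'.exists_glueTop
    exact congrArg (fun φ => WTrans.app φ p) (N.map_comp h.of_glueTop h'.of_glueTop f g)

/-- The multifunctor corresponding to a multifunctor into the `F`-category of `F`-functors. -/
def uncurry : Multifunctor w' w S C where
  obj := N.uncurryObj
  map := N.uncurryMap
  map₂ := N.uncurryMap₂
  map_id := N.uncurryMap_id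
  map_comp := N.uncurryMap_comp
  map₂_id {k x y a b} h f := by
    obtain ⟨x, p, rfl⟩ := glueTop_surjective x
    cases k with
    | top =>
      obtain rfl := h.eq_glueTop
      obtain rfl : p = a := h.src
      exact (N.fobj x).map₂_id f
    | coe i =>
      obtain ⟨y, rfl⟩ := h.exists_glueTop
      exact congrArg (fun φ => Modif.app φ p) (N.map₂_id h.of_glueTop f)
  map₂_comp {k x y a b} h f g l σ τ := by
    obtain ⟨x, p, rfl⟩ := glueTop_surjective x
    cases k with
    | top =>
      obtain rfl := h.eq_glueTop
      obtain rfl : p = a := h.src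
      exact (N.fobj x).map₂_comp σ τ
    | coe i =>
      obtain ⟨y, rfl⟩ := h.exists_glueTop
      exact congrArg (fun φ => Modif.app φ p) (N.map₂_comp h.of_glueTop σ τ)
  map₂_whisker_left {k x y z a b d} h h' f g l σ := by
    obtain ⟨x, p, rfl⟩ := glueTop_surjective x
    cases k with
    | top =>
      obtain rfl := h.eq_glueTop
      obtain rfl := h'.eq_glueTop
      obtain rfl : p = a := h.src
      exact (N.fobj x).map₂_whisker_left f σ
    | coe i =>
      obtain ⟨y, rfl⟩ := h.exists_glueTop
      obtain ⟨z, rfl⟩ := h'.exists_glueTop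
      exact (congrArg (fun φ => Modif.app φ p)
        (N.map₂_whisker_left h.of_glueTop h'.of_glueTop f σ)).trans (Modif.conj_app _ _ _ p)
  map₂_whisker_right {k x y z a b d} h h' f g σ l := by
    obtain ⟨x, p, rfl⟩ := glueTop_surjective x
    cases k with
    | top =>
      obtain rfl := h.eq_glueTop
      obtain rfl := h'.eq_glueTop
      obtain rfl : p = a := h.src
      exact (N.fobj x).map₂_whisker_right σ l
    | coe i =>
      obtain ⟨y, rfl⟩ := h.exists_glueTop
      obtain ⟨z, rfl⟩ := h'.exists_glueTop
      exact (congrArg (fun φ => Modif.app φ p)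
        (N.map₂_whisker_right h.of_glueTop h'.of_glueTop σ l)).trans (Modif.conj_app _ _ _ p)
  map_tight {k x y a b} h f hf := by
    obtain ⟨x, p, rfl⟩ := glueTop_surjective x
    cases k with
    | top =>
      obtain rfl := h.eq_glueTop
      obtain rfl : p = a := h.src
      exact (N.fobj x).map_tight hf
    | coe i =>
      obtain ⟨y, rfl⟩ := h.exists_glueTop
      exact (N.map_tight h.of_glueTop hf).1 p
  cell := N.uncurryCell
  cell_is {k l} hkl x y z t a a' b b' top right left bottom f g hfg := by
    obtain ⟨x, p, rfl⟩ := glueTop_surjective x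
    cases k with
    | top => exact absurd hkl not_top_lt
    | coe i =>
    obtain ⟨y, rfl⟩ := top.exists_glueTop
    cases l with
    | top =>
      obtain rfl := right.eq_glueTop
      obtain rfl := left.eq_glueTop
      obtain rfl : p = b := left.src
      -- If `f` is tight, then `N` gives a tight transformation, all of whose cells are `w'`-cells;
      -- if `g` is tight, the axiom for loose transformations suffices.
      exact hfg.elim (fun h => (N.map_tight top.of_glueTop h).2 g)
        ((N.ftrans top.of_glueTop f).cell_is g)
    | coe j =>
      obtain ⟨z, rfl⟩ := left.exists_glueTop
      obtain ⟨t, rfl⟩ := bottom.exists_glueTop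
      exact WCell.Is.app (N.cell_is (WithTop.coe_lt_coe.1 hkl) top.of_glueTop right.of_glueTop
        left.of_glueTop bottom.of_glueTop f g hfg) p
  cell_id_right {k l} hkl x y a a' b top right left f := by
    obtain ⟨x, p, rfl⟩ := glueTop_surjective x
    cases k with
    | top => exact absurd hkl not_top_lt
    | coe i =>
    obtain ⟨y, rfl⟩ := top.exists_glueTop
    cases l with
    | top =>
      obtain rfl : p = b := left.src
      exact (N.ftrans top.of_glueTop f).cell_id p
    | coe j =>
      exact (congrArg (fun φ => WCell.ev φ p) (N.cell_id_right (WithTop.coe_lt_coe.1 hkl)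
        top.of_glueTop right.of_glueTop left.of_glueTop f)).trans (WCell.ev_ofEq _ p)
  cell_comp_right {k l} hkl x y z t x' y' a a' b b' b'' top right left middle right' left' bottom
      f g g' := by
    obtain ⟨x, p, rfl⟩ := glueTop_surjective x
    cases k with
    | top => exact absurd hkl not_top_lt
    | coe i =>
    obtain ⟨y, rfl⟩ := top.exists_glueTop
    cases l with
    | top =>
      obtain rfl := right.eq_glueTop
      obtain rfl := left.eq_glueTop
      obtain rfl := right'.eq_glueTop
      obtain rfl := left'.eq_glueTop
      obtain rfl : p = b := left.src
      exact (N.ftrans top.of_glueTop f).cell_comp g g'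
    | coe j =>
      obtain ⟨z, rfl⟩ := left.exists_glueTop
      obtain ⟨t, rfl⟩ := middle.exists_glueTop
      obtain ⟨x', rfl⟩ := left'.exists_glueTop
      obtain ⟨y', rfl⟩ := bottom.exists_glueTop
      exact (congrArg (fun φ => WCell.ev φ p) (N.cell_comp_right (WithTop.coe_lt_coe.1 hkl)
        top.of_glueTop right.of_glueTop left.of_glueTop middle.of_glueTop right'.of_glueTop
        left'.of_glueTop bottom.of_glueTop f g g')).trans (WCell.ev_pasteRight _ _ _ _ _ p)
  cell_naturality_right {k l} hkl x y z t a a' b b' top right left bottom f g g' τ := by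
    obtain ⟨x, p, rfl⟩ := glueTop_surjective x
    cases k with
    | top => exact absurd hkl not_top_lt
    | coe i =>
    obtain ⟨y, rfl⟩ := top.exists_glueTop
    cases l with
    | top =>
      obtain rfl := right.eq_glueTop
      obtain rfl := left.eq_glueTop
      obtain rfl : p = b := left.src
      exact (N.ftrans top.of_glueTop f).cell_naturality τ
    | coe j =>
      obtain ⟨z, rfl⟩ := left.exists_glueTop
      obtain ⟨t, rfl⟩ := bottom.exists_glueTop
      exact WCell.Commutes.app (N.cell_naturality_right (WithTop.coe_lt_coe.1 hkl) top.of_glueTop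
        right.of_glueTop left.of_glueTop bottom.of_glueTop f τ) p
  cell_id_left {k l} hkl x y a b b' top left bottom g := by
    obtain ⟨x, p, rfl⟩ := glueTop_surjective x
    cases k with
    | top => exact absurd hkl not_top_lt
    | coe i =>
    cases l with
    | top =>
      obtain rfl := left.eq_glueTop
      obtain rfl : p = b := left.src
      -- `N.map_id` is an equality of transformations, and besides the components it determines the
      -- cells, which is what the unit law in the first variable needs. The composition law in the
      -- first variable is obtained from `N.map_comp` in the same way.
      refine (WTrans.cell_eq_of_eq (N.map_id top.of_glueTop) g).trans ?_
      exact WCell.ofEq_conj_ofEq _ _ _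
    | coe j =>
      obtain ⟨y, rfl⟩ := left.exists_glueTop
      exact (congrArg (fun φ => WCell.ev φ p) (N.cell_id_left (WithTop.coe_lt_coe.1 hkl)
        top.of_glueTop left.of_glueTop bottom.of_glueTop g)).trans (WCell.ev_ofEq _ p)
  cell_comp_left {k l} hkl x y z t x' y' a a' a'' b b' top middle left bottom top' right bottom'
      f f' g := by
    obtain ⟨x, p, rfl⟩ := glueTop_surjective x
    cases k with
    | top => exact absurd hkl not_top_lt
    | coe i =>
    obtain ⟨y, rfl⟩ := top.exists_glueTop
    obtain ⟨x', rfl⟩ := top'.exists_glueTop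
    cases l with
    | top =>
      obtain rfl := left.eq_glueTop
      obtain rfl := middle.eq_glueTop
      obtain rfl := right.eq_glueTop
      obtain rfl : p = b := left.src
      refine (WTrans.cell_eq_of_eq (N.map_comp top.of_glueTop top'.of_glueTop f f') g).trans ?_
      exact WCell.ofEq_conj _ _ _ _ _ _ _
    | coe j =>
      obtain ⟨z, rfl⟩ := left.exists_glueTop
      obtain ⟨t, rfl⟩ := bottom.exists_glueTop
      obtain ⟨y', rfl⟩ := bottom'.exists_glueTop
      exact (congrArg (fun φ => WCell.ev φ p) (N.cell_comp_left (WithTop.coe_lt_coe.1 hkl)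
        top.of_glueTop middle.of_glueTop left.of_glueTop bottom.of_glueTop top'.of_glueTop
        right.of_glueTop bottom'.of_glueTop f f' g)).trans (WCell.ev_pasteLeft _ _ _ _ _ p)
  cell_naturality_left {k l} hkl x y z t a a' b b' top right left bottom f f' g σ := by
    obtain ⟨x, p, rfl⟩ := glueTop_surjective x
    cases k with
    | top => exact absurd hkl not_top_lt
    | coe i =>
    obtain ⟨y, rfl⟩ := top.exists_glueTop
    cases l with
    | top =>
      obtain rfl := right.eq_glueTop
      obtain rfl := left.eq_glueTop
      obtain rfl : p = b := left.src
      -- Naturality of the cells against the last variable is the axiom of the modification given by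
      -- `σ`.
      exact Modif.comm (N.fmodif top.of_glueTop σ) g
    | coe j =>
      obtain ⟨z, rfl⟩ := left.exists_glueTop
      obtain ⟨t, rfl⟩ := bottom.exists_glueTop
      exact WCell.Commutes.app (N.cell_naturality_left (WithTop.coe_lt_coe.1 hkl) top.of_glueTop
        right.of_glueTop left.of_glueTop bottom.of_glueTop g σ) p
  cube {i j k} hij hjk a a' b b' d d' x₀₀₀ x₁₀₀ x₀₁₀ x₁₁₀ x₀₀₁ x₁₀₁ x₀₁₁ x₁₁₁ i₀₀ i₁₀ i₀₁ i₁₁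
      j₀₀ j₁₀ j₀₁ j₁₁ k₀₀ k₁₀ k₀₁ k₁₁ f g h := by
    obtain ⟨x₀₀₀, p, rfl⟩ := glueTop_surjective x₀₀₀
    cases i with
    | top => exact absurd hij not_top_lt
    | coe i =>
    cases j with
    | top => exact absurd hjk not_top_lt
    | coe j =>
    obtain ⟨x₁₀₀, rfl⟩ := i₀₀.exists_glueTop
    obtain ⟨x₀₁₀, rfl⟩ := j₀₀.exists_glueTop
    obtain ⟨x₁₁₀, rfl⟩ := i₁₀.exists_glueTop
    cases k with
    | top =>
      obtain rfl := k₀₀.eq_glueTop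
      obtain rfl := k₁₀.eq_glueTop
      obtain rfl := k₀₁.eq_glueTop
      obtain rfl := k₁₁.eq_glueTop
      obtain rfl : p = d := k₀₀.src
      -- If the third direction is the last variable, the cube is the compatibility of the
      -- components of a cell of `N` with the cells of its source and target. This is the converse
      -- of the use of the cube in currying.
      have := WCell.app_comm (N.cell (WithTop.coe_lt_coe.1 hij) i₀₀.of_glueTop j₁₀.of_glueTop
        j₀₀.of_glueTop i₁₀.of_glueTop f g) h
      have e := congrArg (fun c => .ofEq (Strict.assoc _ _ _).symm ⊚ c)
        (this.trans (WCell.comp_assoc₅ _ _ _ _ _ _))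
      refine Eq.trans ?_ (e.trans ?_)
      · rfl
      · refine (WCell.ofEq_comp_ofEq_assoc _ _ _).trans ?_
        exact WCell.ofEq_rfl_comp _ _
    | coe k =>
      obtain ⟨x₀₀₁, rfl⟩ := k₀₀.exists_glueTop
      obtain ⟨x₁₀₁, rfl⟩ := k₁₀.exists_glueTop
      obtain ⟨x₀₁₁, rfl⟩ := k₀₁.exists_glueTop
      obtain ⟨x₁₁₁, rfl⟩ := k₁₁.exists_glueTop
      -- With three earlier directions, the cube is the component at `p` of a cube of `N`.
      exact (WCell.ev_cubeLeft _ _ _ _ _ _ _ p).symm.trans ((congrArg (fun φ => WCell.ev φ p)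
        (N.cube (WithTop.coe_lt_coe.1 hij) (WithTop.coe_lt_coe.1 hjk) i₀₀.of_glueTop
        i₁₀.of_glueTop i₀₁.of_glueTop i₁₁.of_glueTop j₀₀.of_glueTop j₁₀.of_glueTop
        j₀₁.of_glueTop j₁₁.of_glueTop k₀₀.of_glueTop k₁₀.of_glueTop k₀₁.of_glueTop
        k₁₁.of_glueTop f g h)).trans (WCell.ev_cubeRight _ _ _ _ _ p))

end Uncurry

end Multifunctor

/-! ### Currying and uncurrying are mutually inverse -/

namespace Multifunctor

variable {w' w : Weakness} {ι : Type} [LinearOrder ι] {S : WithTop ι → FCat.{w₁, v₁, u₁}}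
  {C : FCat.{w₂, v₂, u₂}}

/-- On glued tuples everything agrees by definition, except for the cells in two earlier variables:
these were assembled to a cell between transformations, and `lastCell_app` recovers the components.
-/
theorem uncurry_curry (M : Multifunctor w' w S C) : M.curry.uncurry = M := by
  refine ext_heq (funext fun x => ?_) ?_ ?_ ?_
  · obtain ⟨x, p, rfl⟩ := glueTop_surjective x
    rfl
  · intro k x y a b h f
    obtain ⟨x, p, rfl⟩ := glueTop_surjective x
    cases k with
    | top =>
      obtain rfl := h.eq_glueTop
      obtain rfl : p = a := h.src
      rfl
    | coe i =>
      obtain ⟨y, rfl⟩ := h.exists_glueTop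
      rfl
  · intro k x y a b h f g σ
    obtain ⟨x, p, rfl⟩ := glueTop_surjective x
    cases k with
    | top =>
      obtain rfl := h.eq_glueTop
      obtain rfl : p = a := h.src
      rfl
    | coe i =>
      obtain ⟨y, rfl⟩ := h.exists_glueTop
      rfl
  · intro k l hkl x y z t a a' b b' top right left bottom f g
    obtain ⟨x, p, rfl⟩ := glueTop_surjective x
    cases k with
    | top => exact absurd hkl not_top_lt
    | coe i =>
    obtain ⟨y, rfl⟩ := top.exists_glueTop
    cases l with
    | top =>
      obtain rfl := right.eq_glueTop
      obtain rfl := left.eq_glueTop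
      obtain rfl : p = b := left.src
      rfl
    | coe j =>
      obtain ⟨z, rfl⟩ := left.exists_glueTop
      obtain ⟨t, rfl⟩ := bottom.exists_glueTop
      exact heq_of_eq (M.lastCell_app (WithTop.coe_lt_coe.1 hkl) top.of_glueTop right.of_glueTop
        left.of_glueTop bottom.of_glueTop f g p)

/-- All data agree by definition except for the cells, which are determined by their components. -/
theorem curry_uncurry (N : Multifunctor w' w (fun i : ι => S i) (Fun w' w (S ⊤) C)) :
    N.uncurry.curry = N := by
  refine ext_heq rfl (fun _ _ => HEq.rfl) (fun _ _ _ _ => HEq.rfl) ?_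
  intro i j hij x y z t a a' b b' top right left bottom f g
  exact heq_of_eq (WCell.ev_ext fun p => N.uncurry.lastCell_app hij top right left bottom f g p)

/-- Multifunctors in one more last variable correspond to multifunctors into the `F`-category of
`F`-functors in that variable. -/
def curryEquiv (w' w : Weakness) (S : WithTop ι → FCat.{w₁, v₁, u₁}) (C : FCat.{w₂, v₂, u₂}) :
    Multifunctor w' w S C ≃ Multifunctor w' w (fun i : ι => S i) (Fun w' w (S ⊤) C) where
  toFun := curry
  invFun := uncurry
  left_inv := uncurry_curry
  right_inv := curry_uncurry

end Multifunctor

/-! ### Reversing cells -/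

theorem Weakness.bar_bar (w : Weakness) : w = w.bar.bar := by cases w <;> rfl

namespace WCell

variable {w v : Weakness} {A : Type u} [Category.{v₁} A] {B : Type u₁} [Category.{v₂} B]

/-- A `w`-cell, regarded as a `w.bar`-cell in the opposite direction. -/
def flip : {w v : Weakness} → (v = w.bar) → {a b : A} → WCell w a b → WCell v b a
  -- The target weakness is a variable `v` with `v = w.bar`, so that a second flip can return to `w`
  -- itself instead of `w.bar.bar`; `Weakness.bar_bar` is oriented to serve as the equation for the
  -- way back.
  | _, _, rfl, _, _, strict h => strict h.symm
  | _, _, rfl, _, _, pseudo α => pseudo α.symm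
  | _, _, rfl, _, _, lax α => colax α
  | _, _, rfl, _, _, colax α => lax α

variable (h : v = w.bar)

@[simp] theorem flip_comp {a b d : A} (x : WCell w a b) (y : WCell w b d) :
    (x ⊚ y).flip h = y.flip h ⊚ x.flip h := by
  subst h; cases x <;> cases y <;> rfl

@[simp] theorem flip_ofEq {a b : A} (e : a = b) :
    (ofEq e : WCell w a b).flip h = ofEq e.symm := by
  subst h e
  cases w
  · rfl
  · exact congrArg pseudo (Iso.ext rfl)
  · rfl
  · rfl

@[simp] theorem flip_map (F : A ⥤ B) {a b : A} (x : WCell w a b) :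
    (x.map F).flip h = (x.flip h).map F := by
  subst h; cases x <;> rfl

@[simp] theorem flip_flip (h' : w = v.bar) {a b : A} (x : WCell w a b) :
    (x.flip h).flip h' = x := by
  subst h; cases x <;> rfl

theorem Is.flip {w' v' : Weakness} (h' : v' = w'.bar) {a b : A} {x : WCell w a b} (hx : x.Is w') :
    (x.flip h).Is v' := by
  subst h'
  cases w'
  · obtain ⟨e, rfl⟩ := hx
    exact ⟨e.symm, flip_ofEq h e⟩
  · obtain ⟨y, e, e'⟩ := hx
    exact ⟨y.flip h, by rw [← flip_comp, e', flip_ofEq], by rw [← flip_comp, e, flip_ofEq]⟩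
  all_goals trivial

/-- For lax and colax cells the two equations are literally the same, since only the naming of
source and target changes. For pseudo cells one passes to inverses on both sides. -/
theorem Commutes.flip {a b a' b' : A} {x : WCell w a b} {y : WCell w a' b'} {P : a ⟶ a'}
    {Q : b ⟶ b'} (e : Commutes x y P Q) : Commutes (x.flip h) (y.flip h) Q P := by
  subst h
  cases x with
  | strict p =>
    cases y with | strict q => ?_
    subst p q
    simpa [Commutes, WCell.flip] using e.symm
  | pseudo α =>
    cases y with | pseudo β => ?_
    change Q ≫ β.inv = α.inv ≫ P
    rw [Iso.comp_inv_eq, Category.assoc, show P ≫ β.hom = α.hom ≫ Q from e, Iso.inv_hom_id_assoc]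
  | lax α => cases y; exact e
  | colax α => cases y; exact e

variable {B : Type u} [Bicategory.{w₁, v₁} B] {X Y Z : B}

@[simp] theorem flip_whiskerLeft (f : X ⟶ Y) {a b : Y ⟶ Z} (x : WCell w a b) :
    (f ◃ x).flip h = f ◃ x.flip h := flip_map h _ x

@[simp] theorem flip_whiskerRight {a b : X ⟶ Y} (x : WCell w a b) (g : Y ⟶ Z) :
    (x ▹ g).flip h = x.flip h ▹ g := flip_map h _ x

end WCell

/-! ### Reversing the order of the variables, and currying the first one -/

namespace Multifunctor

variable {w' w v' v : Weakness} {ι : Type} (o' o : LinearOrder ι)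
  {S : ι → FCat.{w₁, v₁, u₁}} {C : FCat.{w₂, v₂, u₂}}

/-- A multifunctor, regarded as a multifunctor with the order of the variables reversed. -/
def rev (h' : v' = w'.bar) (h : v = w.bar) (ho : ∀ {i j : ι}, o'.lt i j → o.lt j i)
    (M : @Multifunctor w' w ι o S C) : @Multifunctor v' v ι o' S C :=
  -- Two orders on the same index type occur at once, so they are passed explicitly. The partial
  -- functors do not depend on the order and are unchanged.
  @Multifunctor.mk v' v ι o' S C M.obj M.map M.map₂ M.map_id M.map_comp M.map₂_id M.map₂_comp
    M.map₂_whisker_left M.map₂_whisker_right M.map_tight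
    -- Transposing a square exchanges top with left and right with bottom, and therefore reverses
    -- the direction of the cell. Accordingly, in the fields below the laws in the first variable
    -- are obtained from those in the second one and conversely.
    (fun hij _ _ _ _ _ _ _ _ top right left bottom f g =>
      (M.cell (ho hij) left bottom top right g f).flip h)
    (fun hij _ _ _ _ _ _ _ _ top right left bottom f g hfg =>
      (M.cell_is (ho hij) left bottom top right g f hfg.symm).flip h h')
    (fun hij _ _ _ _ _ top right left f => by
      rw [M.cell_id_left (ho hij) left top right f, WCell.flip_ofEq])
    (fun hij _ _ _ _ _ _ _ _ _ _ _ top right left middle right' left' bottom f g g' => by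
      rw [M.cell_comp_left (ho hij) left middle top right left' bottom right' g g' f]
      simp)
    (fun hij _ _ _ _ _ _ _ _ top right left bottom f g g' τ =>
      (M.cell_naturality_left (ho hij) left bottom top right f τ).flip h)
    (fun hij _ _ _ _ _ top left bottom g => by
      rw [M.cell_id_right (ho hij) left bottom top g, WCell.flip_ofEq])
    (fun hij _ _ _ _ _ _ _ _ _ _ _ top middle left bottom top' right bottom' f f' g => by
      rw [M.cell_comp_right (ho hij) left bottom top middle bottom' top' right g f f']
      simp)
    (fun hij _ _ _ _ _ _ _ _ top right left bottom f f' g σ =>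
      (M.cell_naturality_right (ho hij) left bottom top right g σ).flip h)
    (fun hij hjk _ _ _ _ _ _ _ _ _ _ _ _ _ _ i₀₀ i₁₀ i₀₁ i₁₁ j₀₀ j₁₀ j₀₁ j₁₁ k₀₀ k₁₀ k₀₁ k₁₁
        f g l => by
      -- The cube of `M` with the first and third directions exchanged. Flipping reverses the order
      -- in each of the two pastings, and each side of the identity becomes the same side for the
      -- reversed multifunctor.
      have := congrArg (WCell.flip h) (M.cube (ho hjk) (ho hij) k₀₀ k₀₁ k₁₀ k₁₁ j₀₀ j₀₁ j₁₀ j₁₁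
        i₀₀ i₀₁ i₁₀ i₁₁ l g f)
      simpa using this)

/-- Reversing the order of the variables of multifunctors. -/
def revEquiv (h' : v' = w'.bar) (h : v = w.bar) (ho : ∀ {i j : ι}, o'.lt i j ↔ o.lt j i) :
    @Multifunctor w' w ι o S C ≃ @Multifunctor v' v ι o' S C where
  toFun := rev o' o h' h ho.1
  invFun := rev o o' (by subst h'; exact w'.bar_bar) (by subst h; exact w.bar_bar) ho.2
  left_inv M := @ext_heq _ _ _ o _ _ _ _ rfl (fun _ _ => HEq.rfl) (fun _ _ _ _ => HEq.rfl)
    fun _ _ _ _ _ _ _ _ _ _ _ _ _ _ _ => heq_of_eq (WCell.flip_flip _ _ _)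
  right_inv M := @ext_heq _ _ _ o' _ _ _ _ rfl (fun _ _ => HEq.rfl) (fun _ _ _ _ => HEq.rfl)
    fun _ _ _ _ _ _ _ _ _ _ _ _ _ _ _ => heq_of_eq (WCell.flip_flip _ _ _)

/-- `WithTop ιᵒᵈ` and `WithBot ι` have definitionally the same elements, with the added element last
in the one and first in the other. The orders are opposite, so that reversal needs no reindexing. -/
theorem _root_.WithTop.orderDual_lt_iff {ι : Type} [LinearOrder ι] {i j : WithBot ι} :
    (inferInstance : LinearOrder (WithTop ιᵒᵈ)).lt i j ↔ j < i := by
  cases i with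
  | bot =>
    refine iff_of_false ?_ not_lt_bot
    exact not_top_lt (α := WithTop ιᵒᵈ)
  | coe i =>
    cases j with
    | bot =>
      refine iff_of_true ?_ (WithBot.bot_lt_coe i)
      exact WithTop.coe_lt_top (α := ιᵒᵈ) i
    | coe j =>
      exact Iff.trans (b := j < i) (WithTop.coe_lt_coe (α := ιᵒᵈ)) WithBot.coe_lt_coe.symm

/-- Multifunctors in one more first variable correspond to multifunctors into the `F`-category of
`F`-functors in that variable. -/
def curryLeftEquiv {ι : Type} [o : LinearOrder ι] (w' w : Weakness)
    (S : WithBot ι → FCat.{w₁, v₁, u₁}) (C : FCat.{w₂, v₂, u₂}) :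
    Multifunctor w' w S C ≃
      Multifunctor w' w (fun i : ι => S i) (Fun w'.bar w.bar (S ⊥) C) :=
  -- Reverse, curry the variable which has become last, and reverse the remaining variables.
  -- Currying happens while the weaknesses are barred, hence the bars in the internal hom; those of
  -- the multifunctor itself are removed by the second reversal.
  ((revEquiv (inferInstance : LinearOrder (WithTop ιᵒᵈ)) (inferInstance : LinearOrder (WithBot ι))
    rfl rfl (WithTop.orderDual_lt_iff (ι := ι))).trans (curryEquiv (ι := ιᵒᵈ) w'.bar w.bar S C)).trans
    (@revEquiv w'.bar w.bar w' w ι o (inferInstance : LinearOrder ιᵒᵈ) (fun i : ι => S i)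
      (Fun w'.bar w.bar (S ⊥) C) w'.bar_bar w.bar_bar Iff.rfl)

end Multifunctor

/-! ### Components, images of squares and flips up to heterogeneous equality -/

section

variable {w' w w₀ : Weakness} {A : FCat.{w₁, v₁, u₁}} {B : FCat.{w₂, v₂, u₂}}
  {F G : Fun w' w A B}

/-- Composites of multifunctors are known on 2-cells and on cells only up to propositional equality
of the boundaries. This lemma and the following ones carry such heterogeneous equalities through the
operations that occur in currying. -/
theorem Modif.app_heq {φ ψ φ' ψ' : F ⟶ G} {μ : φ ⟶ ψ} {ν : φ' ⟶ ψ'} (h : φ = φ') (h' : ψ = ψ')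
    (e : HEq μ ν) (X : A) : HEq (Modif.app μ X) (Modif.app ν X) := by
  subst h h'
  obtain rfl := eq_of_heq e
  rfl

theorem WCell.ev_heq {φ ψ φ' ψ' : F ⟶ G} {x : WCell w₀ φ ψ} {y : WCell w₀ φ' ψ'} (h : φ = φ')
    (h' : ψ = ψ') (e : HEq x y) (X : A) : HEq (x.ev X) (y.ev X) := by
  subst h h'
  obtain rfl := _root_.eq_of_heq e
  rfl

theorem WTrans.cell_heq {φ ψ : F ⟶ G} (h : φ = ψ) {X Y : A} (f : X ⟶ Y) :
    HEq (WTrans.cell φ f) (WTrans.cell ψ f) := by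
  subst h; rfl

theorem FFunctor.map₂_heq (K : FFunctor A B) {X Y : A} {f g f' g' : X ⟶ Y} {σ : f ⟶ g}
    {τ : f' ⟶ g'} (h : f = f') (h' : g = g') (e : HEq σ τ) : HEq (K.map₂ σ) (K.map₂ τ) := by
  subst h h'
  obtain rfl := eq_of_heq e
  rfl

theorem FFunctor.mapSq_heq (K : FFunctor A B) {X Y Z V : A} {p p' : X ⟶ Y} {q q' : Y ⟶ V}
    {r r' : X ⟶ Z} {t t' : Z ⟶ V} {x : WCell w (p ≫ q) (r ≫ t)} {y : WCell w (p' ≫ q') (r' ≫ t')}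
    (hp : p = p') (hq : q = q') (hr : r = r') (ht : t = t') (e : HEq x y) :
    HEq (K.mapSq x) (K.mapSq y) := by
  subst hp hq hr ht
  obtain rfl := eq_of_heq e
  rfl

theorem WCell.flip_conj {A : Type u} [Category.{v} A] {w v : Weakness} (h : v = w.bar)
    {a b a' b' : A} (e : a' = a) (x : WCell w a b) (e' : b = b') :
    (.ofEq e ⊚ x ⊚ .ofEq e' : WCell w a' b').flip h = .ofEq e'.symm ⊚ x.flip h ⊚ .ofEq e.symm := by
  simp

/-- Used for currying on the left: the cells against the first variable are flipped cells of
transformations, and `K` has to be applied inside the flip. -/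
theorem FFunctor.mapSq_flip (K : FFunctor A B) {v : Weakness} (h : v = w.bar) {X Y Z V : A}
    {p : X ⟶ Y} {q : Y ⟶ V} {r : X ⟶ Z} {t : Z ⟶ V} (x : WCell w (p ≫ q) (r ≫ t)) :
    (K.mapSq x).flip h = K.mapSq (x.flip h) :=
  (WCell.flip_conj h _ _ _).trans
    (congrArg (fun c => .ofEq (K.map_comp _ _).symm ⊚ c ⊚ .ofEq (K.map_comp _ _))
      (WCell.flip_map h _ x))

theorem WCell.flip_ev {v₀ : Weakness} (h : v₀ = w₀.bar) {φ ψ : F ⟶ G} (x : WCell w₀ φ ψ) (X : A) :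
    (x.ev X).flip h = (x.flip h).ev X := WCell.flip_map h _ x

theorem WTrans.flip_cell_heq {v : Weakness} (h : v = w.bar) {φ ψ : F ⟶ G} (e : φ = ψ) {X Y : A}
    (f : X ⟶ Y) : HEq ((WTrans.cell φ f).flip h) ((WTrans.cell ψ f).flip h) := by
  subst e; rfl

theorem WCell.ev_conj {φ ψ φ' ψ' : F ⟶ G} (h : φ' = φ) (x : WCell w₀ φ ψ) (h' : ψ = ψ') (X : A) :
    WCell.ev (.ofEq h ⊚ x ⊚ .ofEq h') X = .ofEq (congrArg (fun φ => WTrans.app φ X) h) ⊚ x.ev X ⊚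
      .ofEq (congrArg (fun φ => WTrans.app φ X) h') := by
  simp

/-- Evaluation commutes with `FFunctor.funMap`. -/
theorem WCell.ev_mapSq {A' : FCat.{w₃, v₃, u₃}} {B' : FCat.{w₄, v₄, u₄}} (p : FFunctor A' A)
    (k : FFunctor B B') {F G H L : Fun w' w A B} {φ : F ⟶ G} {ψ : G ⟶ L} {χ : F ⟶ H} {ξ : H ⟶ L}
    (x : WCell w₀ (φ ≫ ψ) (χ ≫ ξ)) (X : A') :
    WCell.ev ((FFunctor.funMap p k w' w).mapSq x) X = k.mapSq (x.ev (p.obj X)) := by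
  refine (WCell.ev_conj _ _ _ X).trans ?_
  have e : WCell.ev ((FFunctor.funMap p k w' w).mapCell x) X = k.mapCell (x.ev (p.obj X)) := by
    cases x <;> rfl
  exact congrArg (fun c => .ofEq (k.map_comp _ _).symm ⊚ c ⊚ .ofEq (k.map_comp _ _)) e

end

/-! ### Composing a multifunctor with an `F`-functor -/

namespace Multifunctor

variable {w' w : Weakness} {ι : Type} [LinearOrder ι] {S : ι → FCat.{w₁, v₁, u₁}}
  {C : FCat.{w₂, v₂, u₂}} {D : FCat.{w₃, v₃, u₃}}

/-- With a single variable there are no pairs `i < j`, so no cells, and a tuple is its only entry.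
Hence unary multifunctors can be handled as `F`-functors throughout. -/
theorem ofFFunctor_toFFunctor (k : Multifunctor w' w (fun _ : Unit => C) D) :
    ofFFunctor w' w k.toFFunctor = k := by
  refine ext_heq rfl ?_ ?_ fun hij => absurd hij (lt_irrefl _)
  · intro i x y a b h f
    obtain ⟨rfl, rfl, _⟩ := h
    rfl
  · intro i x y a b h f g σ
    obtain ⟨rfl, rfl, _⟩ := h
    rfl

/-- The composite of a multifunctor with an `F`-functor. -/
noncomputable def post (M : Multifunctor w' w S C) (K : FFunctor C D) : Multifunctor w' w S D :=
  (ofFFunctor w' w K).comp (LexSum.single ι) (S := S) fun _ => M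

variable (M : Multifunctor w' w S C) (K : FFunctor C D)

theorem post_map {i : ι} {x y : ∀ i, S i} {a b : S i} (h : Along i x y a b) (f : a ⟶ b) :
    (M.post K).map h f = K.map (M.map h f) :=
  comp_map (LexSum.single ι) (S := S) (ofFFunctor w' w K) (fun _ => M) (j := ()) (i := i) h f

theorem post_map₂ {i : ι} {x y : ∀ i, S i} {a b : S i} (h : Along i x y a b) {f g : a ⟶ b}
    (σ : f ⟶ g) : HEq ((M.post K).map₂ h σ) (K.map₂ (M.map₂ h σ)) :=
  comp_map₂ (LexSum.single ι) (S := S) (ofFFunctor w' w K) (fun _ => M) (j := ()) (i := i) h σ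

theorem mapFunctor_ofFFunctor_heq (K : FFunctor C D) {x y : Unit → C} {a b : C}
    (h : Along (S := fun _ : Unit => C) () x y a b) {f g : a ⟶ b} (c : WCell w f g) :
    HEq (c.map ((ofFFunctor w' w K).mapFunctor h)) (K.mapCell c) := by
  obtain ⟨rfl, rfl, _⟩ := h
  rfl

/-- All variables of `M` lie in the one block of this composition, so the cell is the image of a
cell of `M`; `mapSq` only adds the equalities for the preservation of the sides' composites. -/
theorem post_cell {i j : ι} (hij : i < j) {x y z t : ∀ i, S i} {a a' : S i} {b b' : S j}
    (top : Along i x y a a') (right : Along j y t b b')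
    (left : Along j x z b b') (bottom : Along i z t a a') (f : a ⟶ a') (g : b ⟶ b') :
    HEq ((M.post K).cell hij top right left bottom f g)
      (K.mapSq (M.cell hij top right left bottom f g)) := by
  refine (comp_cell_same (LexSum.single ι) (S := S) (ofFFunctor w' w K) (fun _ => M) (j := ())
    (i := i) (i' := j) hij hij top right left bottom f g).trans ?_
  refine (mapFunctor_ofFFunctor_heq K _ _).trans ?_
  exact (WCell.heq (K.map_comp _ _).symm (K.map_comp _ _) rfl).symm

end Multifunctor

/-! ### Naturality of currying the last variable -/

namespace Multifunctor

section

variable {w' w : Weakness} {κ : Type} [LinearOrder κ] {I : κ → Type} [∀ j, LinearOrder (I j)]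
  {ι : Type} [LinearOrder ι] (e : LexSum I ≃o ι) {S : ι → FCat.{w₁, v₁, u₁}}
  {T : κ → FCat.{w₂, v₂, u₂}} {C : FCat.{w₃, v₃, u₃}} (G : Multifunctor w' w T C)
  (F : ∀ j, Multifunctor w' w (fun i : I j => S (e ⟨j, i⟩)) (T j))

/-- `comp_map` for a parallel side of a square. -/
theorem comp_map_of_square {j j' : κ} (hj : j ≠ j') {i : I j} {i' : I j'} {x y z t : ∀ i, S i}
    {a a' : S (e ⟨j, i⟩)} {b b' : S (e ⟨j', i'⟩)} (h : Along (e ⟨j, i⟩) x y a a')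
    (h' : Along (e ⟨j, i⟩) z t a a') (k : Along (e ⟨j', i'⟩) x z b b')
    (k' : Along (e ⟨j', i'⟩) y t b b') (f : a ⟶ a') :
    (G.comp e F).map h' f = G.map (h'.right' e F (k.rest e F hj).symm (k'.rest e F hj).symm)
      ((F j).map (h.left e) f) := by
  -- The two other sides of the square move an entry in another block, so that the entries in block
  -- `j` are the same along both parallel sides.
  have hne (l : I j) : e ⟨j, l⟩ ≠ e ⟨j', i'⟩ := fun h => hj (LexSum.mk.inj (e.injective h)).1
  exact (comp_map e G F h' f).trans (G.map_eq _ _ (inner_map_heq' e F h' h f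
    (fun _ => (k.eq _ (hne _)).symm) fun _ => (k'.eq _ (hne _)).symm))

end

section

variable {w' w : Weakness} {κ : Type} [LinearOrder κ] {I : κ → Type} [∀ j, LinearOrder (I j)]
  {ι : Type} [LinearOrder ι] (e : LexSum I ≃o ι) {S : WithTop ι → FCat.{w₁, v₁, u₁}}
  {T : WithTop κ → FCat.{w₂, v₂, u₂}} {C : FCat.{w₃, v₃, u₃}} {D : FCat.{w₄, v₄, u₄}}

/-- A family of multifunctors, extended by a multifunctor in one more last variable. -/
abbrev snoc (G : ∀ j : κ, Multifunctor w' w (fun i : I j => S (e ⟨j, i⟩)) (T j))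
    (G₁ : Multifunctor w' w (fun _ : Unit => S ⊤) (T ⊤)) (j : WithTop κ) :
    Multifunctor w' w (fun i : LexSum.TopFam I j => S (LexSum.withTop e ⟨j, i⟩)) (T j) :=
  WithTop.recTopCoe (C := fun j => Multifunctor w' w
    (fun i : LexSum.TopFam I j => S (LexSum.withTop e ⟨j, i⟩)) (T j)) G₁ G j

variable (N : Multifunctor w' w (fun j : κ => T j) (Fun w' w (T ⊤) C))
  (G : ∀ j : κ, Multifunctor w' w (fun i : I j => S (e ⟨j, i⟩)) (T j))
  (G₁ : Multifunctor w' w (fun _ : Unit => S ⊤) (T ⊤)) (K : FFunctor C D)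

/-- Evaluating `N` at the value of `G₁` on `p` is the same as substituting `G₁` into the last
variable of `N.uncurry`. -/
theorem uncurry_comp_map {i : ι} {x y : ∀ i : ι, S i} {a b : S i}
    (h : Along (S := fun i : ι => S i) i x y a b) (f : a ⟶ b) (p : S ⊤) :
    WTrans.app ((N.comp e (S := fun i : ι => S i) G).map h f) (G₁.toFFunctor.obj p) =
      (N.uncurry.comp (LexSum.withTop e) (S := S) (snoc e G G₁)).map (h.glueTop p) f := by
  obtain ⟨⟨j, i⟩, rfl⟩ := e.surjective i
  exact (congrArg (fun φ => WTrans.app φ (G₁.toFFunctor.obj p))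
    (comp_map e (S := fun i : ι => S i) N G h f)).trans (comp_map (LexSum.withTop e) (S := S)
      N.uncurry (snoc e G G₁) (j := (j : WithTop κ)) (i := i) (h.glueTop p) f).symm

theorem ev_map_mapFunctor {j : κ} {x y : ∀ j : κ, T j} {a b : T j}
    (h : Along (S := fun j : κ => T j) j x y a b) {f g : a ⟶ b} (c : WCell w f g) (p : T ⊤) :
    WCell.ev (c.map (N.mapFunctor h)) p = c.map (N.uncurry.mapFunctor (h.glueTop p)) := by
  cases c <;> rfl

/-- Adding a last block leaves the block structure of the earlier variables as it is, so both sides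
fall under the same formula: a cell of the outer multifunctor if the variables are in different
blocks, and the image of a cell of an inner multifunctor if they are in the same block. -/
theorem uncurry_comp_cell {k l : ι} (hkl : k < l) {x y z t : ∀ i : ι, S i}
    {a a' : S k} {b b' : S l} (top : Along (S := fun i : ι => S i) k x y a a')
    (right : Along (S := fun i : ι => S i) l y t b b')
    (left : Along (S := fun i : ι => S i) l x z b b')
    (bottom : Along (S := fun i : ι => S i) k z t a a') (f : a ⟶ a') (g : b ⟶ b') (p : S ⊤) :
    HEq (WCell.ev ((N.comp e (S := fun i : ι => S i) G).cell hkl top right left bottom f g)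
      (G₁.toFFunctor.obj p))
      ((N.uncurry.comp (LexSum.withTop e) (S := S) (snoc e G G₁)).cell (WithTop.coe_lt_coe.2 hkl)
        (top.glueTop p) (right.glueTop p) (left.glueTop p) (bottom.glueTop p) f g) := by
  obtain ⟨⟨j, i⟩, rfl⟩ := e.surjective k
  obtain ⟨⟨j', i'⟩, rfl⟩ := e.surjective l
  have m {j : κ} {i : I j} {x y : ∀ i : ι, S i} {a b : S ((e ⟨j, i⟩ : ι))}
      (h : Along (S := fun i : ι => S i) (e ⟨j, i⟩) x y a b) (f : a ⟶ b) :=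
    comp_map e (S := fun i : ι => S i) N G h f
  obtain hj | ⟨rfl, hi⟩ := LexSum.lt_cases (e.lt_iff_lt.1 hkl)
  · refine HEq.trans ?_ (comp_cell_diff' (LexSum.withTop e) (S := S) N.uncurry (snoc e G G₁)
      (j := (j : WithTop κ)) (j' := (j' : WithTop κ)) (i := i) (i' := i')
      (WithTop.coe_lt_coe.2 hj) (WithTop.coe_lt_coe.2 hkl) (top.glueTop p) (right.glueTop p)
      (left.glueTop p) (bottom.glueTop p) f g).symm
    -- Heterogeneous equality of the cells passes to the components only once their boundaries are
    -- known to be equal; for the second of two parallel sides this is `comp_map_of_square`.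
    exact WCell.ev_heq (congrArg₂ (· ≫ ·) (m top f) (comp_map_of_square e (S := fun i : ι => S i) N
      G hj.ne' left right top bottom g)) (congrArg₂ (· ≫ ·) (m left g)
        (comp_map_of_square e (S := fun i : ι => S i) N G hj.ne top bottom left right f))
      (comp_cell_diff' e (S := fun i : ι => S i) N G hj hkl top right left bottom f g)
      (G₁.toFFunctor.obj p)
  · replace hi : i < i' := hi
    refine HEq.trans ?_ (comp_cell_same (LexSum.withTop e) (S := S) N.uncurry (snoc e G G₁)
      (j := (j : WithTop κ)) (i := i) (i' := i') hi (WithTop.coe_lt_coe.2 hkl) (top.glueTop p)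
      (right.glueTop p) (left.glueTop p) (bottom.glueTop p) f g).symm
    refine (WCell.ev_heq ((congrArg₂ (· ≫ ·) (m top f) (m right g)).trans (N.map_comp _ _ _ _).symm)
      ((congrArg₂ (· ≫ ·) (m left g) (m bottom f)).trans (N.map_comp _ _ _ _).symm)
      (comp_cell_same e (S := fun i : ι => S i) N G hi hkl top right left bottom f g)
      (G₁.toFFunctor.obj p)).trans ?_
    exact heq_of_eq (N.ev_map_mapFunctor _ _ _)

/-- Naturality of currying in all variables at once, in uncurried form. An earlier variable acts on
both sides through `G` and `N`, followed by evaluation at the value of `G₁` and then `K`; the last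
variable acts through `G₁`, then through the `F`-functor given by `N`, then through `K`. The cases
are distinguished by which of the variables involved is the last. -/
theorem uncurry_comp : uncurry ((N.comp e (S := fun i : ι => S i) G).post
    (FFunctor.funMap G₁.toFFunctor K w' w)) =
      (N.uncurry.comp (LexSum.withTop e) (S := S) (snoc e G G₁)).post K := by
  refine ext_heq ?_ ?_ ?_ ?_
  · rfl
  · intro k x y a b h f
    refine HEq.trans ?_ (heq_of_eq (post_map _ K h f)).symm
    obtain ⟨x, p, rfl⟩ := glueTop_surjective x
    cases k with
    | top =>
      obtain rfl := h.eq_glueTop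
      obtain rfl : p = a := h.src
      exact heq_of_eq (congrArg K.map (comp_map (LexSum.withTop e) (S := S) N.uncurry (snoc e G G₁)
        (j := ⊤) (i := ()) h f).symm)
    | coe i =>
      obtain ⟨y, rfl⟩ := h.exists_glueTop
      obtain ⟨⟨j, i⟩, rfl⟩ := e.surjective i
      have h₁ := (post_map (N.comp e (S := fun i : ι => S i) G)
        (FFunctor.funMap G₁.toFFunctor K w' w) h.of_glueTop f).trans (congrArg _
          (comp_map e (S := fun i : ι => S i) N G h.of_glueTop f))
      have h₂ := comp_map (LexSum.withTop e) (S := S) N.uncurry (snoc e G G₁)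
        (j := (j : WithTop κ)) (i := i) h f
      exact heq_of_eq ((congrArg (fun φ => WTrans.app φ p) h₁).trans (congrArg K.map h₂).symm)
  · intro k x y a b h f g σ
    refine HEq.trans ?_ (post_map₂ _ K h σ).symm
    obtain ⟨x, p, rfl⟩ := glueTop_surjective x
    cases k with
    | top =>
      obtain rfl := h.eq_glueTop
      obtain rfl : p = a := h.src
      have h₂ (f) := comp_map (LexSum.withTop e) (S := S) N.uncurry (snoc e G G₁)
        (j := ⊤) (i := ()) h f
      exact K.map₂_heq (h₂ f).symm (h₂ g).symm (comp_map₂ (LexSum.withTop e) (S := S) N.uncurry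
        (snoc e G G₁) (j := ⊤) (i := ()) h σ).symm
    | coe i =>
      obtain ⟨y, rfl⟩ := h.exists_glueTop
      obtain ⟨⟨j, i⟩, rfl⟩ := e.surjective i
      have h₁ (f) := comp_map e (S := fun i : ι => S i) N G h.of_glueTop f
      have h₀ (f) := post_map (N.comp e (S := fun i : ι => S i) G)
        (FFunctor.funMap G₁.toFFunctor K w' w) h.of_glueTop f
      have h₂ (f) := comp_map (LexSum.withTop e) (S := S) N.uncurry (snoc e G G₁)
        (j := (j : WithTop κ)) (i := i) h f
      refine (Modif.app_heq (h₀ f) (h₀ g) (post_map₂ _ _ h.of_glueTop σ) p).trans ?_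
      refine HEq.trans (K.map₂_heq ?_ ?_ (Modif.app_heq (h₁ f) (h₁ g) (comp_map₂ e
        (S := fun i : ι => S i) N G h.of_glueTop σ) (G₁.toFFunctor.obj p))) ?_
      · exact congrArg (fun φ => WTrans.app φ (G₁.toFFunctor.obj p)) (h₁ f)
      · exact congrArg (fun φ => WTrans.app φ (G₁.toFFunctor.obj p)) (h₁ g)
      · exact K.map₂_heq (h₂ f).symm (h₂ g).symm (comp_map₂ (LexSum.withTop e) (S := S) N.uncurry
          (snoc e G G₁) (j := (j : WithTop κ)) (i := i) h σ).symm
  · intro k l hkl x y z t a a' b b' top right left bottom f g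
    refine HEq.trans ?_ (post_cell _ K hkl top right left bottom f g).symm
    obtain ⟨x, p, rfl⟩ := glueTop_surjective x
    cases k with
    | top => exact absurd hkl not_top_lt
    | coe i =>
    obtain ⟨y, rfl⟩ := top.exists_glueTop
    cases l with
    | top =>
      obtain rfl := right.eq_glueTop
      obtain rfl := left.eq_glueTop
      obtain rfl : p = b := left.src
      obtain ⟨⟨j, i⟩, rfl⟩ := e.surjective i
      -- An earlier variable against the last one: both sides are the image under `K` of the cell,
      -- at the value of `G₁` on `g`, of the transformation which `N` assigns to the value of `G` on
      -- `f`. In the composite the last variable is a block of its own, so the formula for different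
      -- blocks applies.
      refine (WTrans.cell_heq ((post_map (N.comp e (S := fun i : ι => S i) G)
        (FFunctor.funMap G₁.toFFunctor K w' w) top.of_glueTop f).trans (congrArg _
        (comp_map e (S := fun i : ι => S i) N G top.of_glueTop f))) g).trans ?_
      refine K.mapSq_heq ?_ ?_ ?_ ?_ (comp_cell_diff' (LexSum.withTop e) (S := S) N.uncurry
        (snoc e G G₁) (j := (j : WithTop κ)) (j' := ⊤) (i := i) (i' := ()) (WithTop.coe_lt_top j)
        hkl top right left bottom f g).symm
      · exact (comp_map (LexSum.withTop e) (S := S) N.uncurry (snoc e G G₁)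
          (j := (j : WithTop κ)) (i := i) top f).symm
      · exact (comp_map (LexSum.withTop e) (S := S) N.uncurry (snoc e G G₁)
          (j := ⊤) (i := ()) right g).symm
      · exact (comp_map (LexSum.withTop e) (S := S) N.uncurry (snoc e G G₁)
          (j := ⊤) (i := ()) left g).symm
      · exact (comp_map (LexSum.withTop e) (S := S) N.uncurry (snoc e G G₁)
          (j := (j : WithTop κ)) (i := i) bottom f).symm
    | coe j =>
      obtain ⟨z, rfl⟩ := left.exists_glueTop
      obtain ⟨t, rfl⟩ := bottom.exists_glueTop
      have m {i : ι} {x y : ∀ i : ι, S i} {a b : S i}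
          (h : Along (S := fun i : ι => S i) i x y a b) (f : a ⟶ b) :=
        post_map (N.comp e (S := fun i : ι => S i) G) (FFunctor.funMap G₁.toFFunctor K w' w) h f
      refine (WCell.ev_heq (congrArg₂ (· ≫ ·) (m _ f) (m _ g)) (congrArg₂ (· ≫ ·) (m _ g) (m _ f))
        (post_cell _ _ (WithTop.coe_lt_coe.1 hkl) top.of_glueTop right.of_glueTop left.of_glueTop
          bottom.of_glueTop f g) p).trans ?_
      -- Whiskering with `G₁` and `K` and then evaluating at `p` is evaluating at the value of `G₁`
      -- on `p` and then applying `K`.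
      refine (heq_of_eq (WCell.ev_mapSq _ _ _ p)).trans ?_
      exact K.mapSq_heq (uncurry_comp_map ..) (uncurry_comp_map ..) (uncurry_comp_map ..)
        (uncurry_comp_map ..) (uncurry_comp_cell e N G G₁ (WithTop.coe_lt_coe.1 hkl) top.of_glueTop
          right.of_glueTop left.of_glueTop bottom.of_glueTop f g p)

end

end Multifunctor

/-! ### Tuples with a first entry -/

section Glue

variable {ι : Type} {S : WithBot ι → FCat.{w₁, v₁, u₁}}

/-- The tuple with entries `x` and first entry `a`. -/
def glueBot (x : ∀ i : ι, S i) (a : S ⊥) : ∀ k, S k := WithBot.recBotCoe (C := fun k => S k) a x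

theorem glueBot_surjective (z : ∀ k, S k) : ∃ (x : ∀ i : ι, S i) (a : S ⊥), z = glueBot x a :=
  ⟨fun i => z i, z ⊥, funext fun k => by cases k <;> rfl⟩

theorem Along.glueBot {i : ι} {x y : ∀ i : ι, S i} {a b : S i}
    (h : Along (S := fun i : ι => S i) i x y a b) (p : S ⊥) :
    Along (i : WithBot ι) (glueBot x p) (glueBot y p) a b where
  src := h.src
  tgt := h.tgt
  eq k hk := by
    cases k with
    | bot => rfl
    | coe k => exact h.eq k fun e => hk (congrArg _ e)

theorem Along.bot (x : ∀ i : ι, S i) (a b : S ⊥) :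
    Along ⊥ (_root_.glueBot x a) (_root_.glueBot x b) a b where
  src := rfl
  tgt := rfl
  eq k hk := by
    cases k with
    | bot => exact absurd rfl hk
    | coe k => rfl

theorem Along.of_glueBot {i : ι} {x y : ∀ i : ι, S i} {a b : S i} {p q : S ⊥}
    (h : Along (i : WithBot ι) (_root_.glueBot x p) (_root_.glueBot y q) a b) :
    Along (S := fun i : ι => S i) i x y a b :=
  ⟨h.src, h.tgt, fun k hk => h.eq k fun e => hk (WithBot.coe_injective e)⟩

theorem Along.head_eq {i : ι} {x y : ∀ i : ι, S i} {a b : S i} {p q : S ⊥}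
    (h : Along (i : WithBot ι) (_root_.glueBot x p) (_root_.glueBot y q) a b) : p = q :=
  h.eq ⊥ WithBot.bot_ne_coe

theorem Along.tail_eq {x y : ∀ i : ι, S i} {a b p q : S ⊥}
    (h : Along ⊥ (_root_.glueBot x p) (_root_.glueBot y q) a b) : x = y :=
  funext fun k => h.eq k WithBot.coe_ne_bot

theorem Along.exists_glueBot {i : ι} {x : ∀ i : ι, S i} {p : S ⊥} {y : ∀ k, S k} {a b : S i}
    (h : Along (i : WithBot ι) (_root_.glueBot x p) y a b) :
    ∃ y' : ∀ i : ι, S i, y = _root_.glueBot y' p := by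
  obtain ⟨y, q, rfl⟩ := glueBot_surjective y
  obtain rfl := h.head_eq
  exact ⟨y, rfl⟩

theorem Along.eq_glueBot {x : ∀ i : ι, S i} {p : S ⊥} {y : ∀ k, S k} {a b : S ⊥}
    (h : Along ⊥ (_root_.glueBot x p) y a b) : y = _root_.glueBot x b := by
  obtain ⟨y, q, rfl⟩ := glueBot_surjective y
  obtain rfl := h.tail_eq
  obtain rfl : q = b := h.tgt
  rfl

end Glue

/-! ### Naturality of currying the first variable -/

namespace Multifunctor

section

variable {w' w : Weakness} {ι : Type} [LinearOrder ι] {S : WithBot ι → FCat.{w₁, v₁, u₁}}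
  {C : FCat.{w₂, v₂, u₂}} (N : Multifunctor w' w (fun i : ι => S i) (Fun w'.bar w.bar (S ⊥) C))

/-- The multifunctor corresponding to a multifunctor into the `F`-category of `F`-functors in a
first variable. -/
def uncurryLeft : Multifunctor w' w S C := (curryLeftEquiv w' w S C).symm N

/-- A cell in two old variables is flipped by both of the reversals in `curryLeftEquiv`. Evaluation
commutes with flips, and the two flips cancel. -/
theorem uncurryLeft_cell_coe {i j : ι} (hij : i < j) {x y z t : ∀ i : ι, S i}
    {a a' : S i} {b b' : S j} (top : Along (S := fun i : ι => S i) i x y a a')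
    (right : Along (S := fun i : ι => S i) j y t b b')
    (left : Along (S := fun i : ι => S i) j x z b b')
    (bottom : Along (S := fun i : ι => S i) i z t a a') (f : a ⟶ a') (g : b ⟶ b') (p : S ⊥) :
    N.uncurryLeft.cell (WithBot.coe_lt_coe.2 hij) (top.glueBot p) (right.glueBot p)
      (left.glueBot p) (bottom.glueBot p) f g = WCell.ev (N.cell hij top right left bottom f g) p :=
  (WCell.flip_ev w.bar_bar ((N.cell hij top right left bottom f g).flip rfl) p).trans
    (congrArg (fun c => WCell.ev c p) (WCell.flip_flip rfl w.bar_bar _))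

end

section

variable {w' w : Weakness} {κ : Type} [LinearOrder κ] {I : κ → Type} [∀ j, LinearOrder (I j)]
  {ι : Type} [LinearOrder ι] (e : LexSum I ≃o ι) {S : WithBot ι → FCat.{w₁, v₁, u₁}}
  {T : WithBot κ → FCat.{w₂, v₂, u₂}} {C : FCat.{w₃, v₃, u₃}} {D : FCat.{w₄, v₄, u₄}}

/-- A family of multifunctors, extended by a multifunctor in one more first variable. -/
abbrev cons (G₀ : Multifunctor w' w (fun _ : Unit => S ⊥) (T ⊥))
    (G : ∀ j : κ, Multifunctor w' w (fun i : I j => S (e ⟨j, i⟩)) (T j)) (j : WithBot κ) :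
    Multifunctor w' w (fun i : LexSum.BotFam I j => S (LexSum.withBot e ⟨j, i⟩)) (T j) :=
  WithBot.recBotCoe (C := fun j => Multifunctor w' w
    (fun i : LexSum.BotFam I j => S (LexSum.withBot e ⟨j, i⟩)) (T j)) G₀ G j

variable (N : Multifunctor w' w (fun j : κ => T j) (Fun w'.bar w.bar (T ⊥) C))
  (G : ∀ j : κ, Multifunctor w' w (fun i : I j => S (e ⟨j, i⟩)) (T j))
  (G₀ : Multifunctor w' w (fun _ : Unit => S ⊥) (T ⊥)) (K : FFunctor C D)

theorem uncurryLeft_comp_map {i : ι} {x y : ∀ i : ι, S i} {a b : S i}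
    (h : Along (S := fun i : ι => S i) i x y a b) (f : a ⟶ b) (p : S ⊥) :
    WTrans.app ((N.comp e (S := fun i : ι => S i) G).map h f) (G₀.toFFunctor.obj p) =
      (N.uncurryLeft.comp (LexSum.withBot e) (S := S) (cons e G₀ G)).map (h.glueBot p) f := by
  obtain ⟨⟨j, i⟩, rfl⟩ := e.surjective i
  exact (congrArg (fun φ => WTrans.app φ (G₀.toFFunctor.obj p))
    (comp_map e (S := fun i : ι => S i) N G h f)).trans (comp_map (LexSum.withBot e) (S := S)
      N.uncurryLeft (cons e G₀ G) (j := (j : WithBot κ)) (i := i) (h.glueBot p) f).symm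

theorem ev_map_mapFunctor_left {j : κ} {x y : ∀ j : κ, T j} {a b : T j}
    (h : Along (S := fun j : κ => T j) j x y a b) {f g : a ⟶ b} (c : WCell w f g) (p : T ⊥) :
    WCell.ev (c.map (N.mapFunctor h)) p = c.map (N.uncurryLeft.mapFunctor (h.glueBot p)) := by
  cases c <;> rfl

theorem uncurryLeft_comp_cell {k l : ι} (hkl : k < l) {x y z t : ∀ i : ι, S i}
    {a a' : S k} {b b' : S l} (top : Along (S := fun i : ι => S i) k x y a a')
    (right : Along (S := fun i : ι => S i) l y t b b')
    (left : Along (S := fun i : ι => S i) l x z b b')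
    (bottom : Along (S := fun i : ι => S i) k z t a a') (f : a ⟶ a') (g : b ⟶ b') (p : S ⊥) :
    HEq (WCell.ev ((N.comp e (S := fun i : ι => S i) G).cell hkl top right left bottom f g)
      (G₀.toFFunctor.obj p))
      ((N.uncurryLeft.comp (LexSum.withBot e) (S := S) (cons e G₀ G)).cell (WithBot.coe_lt_coe.2 hkl)
        (top.glueBot p) (right.glueBot p) (left.glueBot p) (bottom.glueBot p) f g) := by
  obtain ⟨⟨j, i⟩, rfl⟩ := e.surjective k
  obtain ⟨⟨j', i'⟩, rfl⟩ := e.surjective l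
  have m {j : κ} {i : I j} {x y : ∀ i : ι, S i} {a b : S ((e ⟨j, i⟩ : ι))}
      (h : Along (S := fun i : ι => S i) (e ⟨j, i⟩) x y a b) (f : a ⟶ b) :=
    comp_map e (S := fun i : ι => S i) N G h f
  obtain hj | ⟨rfl, hi⟩ := LexSum.lt_cases (e.lt_iff_lt.1 hkl)
  · refine HEq.trans ?_ (comp_cell_diff' (LexSum.withBot e) (S := S) N.uncurryLeft (cons e G₀ G)
      (j := (j : WithBot κ)) (j' := (j' : WithBot κ)) (i := i) (i' := i')
      (WithBot.coe_lt_coe.2 hj) (WithBot.coe_lt_coe.2 hkl) (top.glueBot p) (right.glueBot p)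
      (left.glueBot p) (bottom.glueBot p) f g).symm
    refine HEq.trans ?_ (heq_of_eq (N.uncurryLeft_cell_coe hj _ _ _ _ _ _ _).symm)
    exact WCell.ev_heq (congrArg₂ (· ≫ ·) (m top f) (comp_map_of_square e (S := fun i : ι => S i) N
      G hj.ne' left right top bottom g)) (congrArg₂ (· ≫ ·) (m left g)
        (comp_map_of_square e (S := fun i : ι => S i) N G hj.ne top bottom left right f))
      (comp_cell_diff' e (S := fun i : ι => S i) N G hj hkl top right left bottom f g)
      (G₀.toFFunctor.obj p)
  · replace hi : i < i' := hi
    refine HEq.trans ?_ (comp_cell_same (LexSum.withBot e) (S := S) N.uncurryLeft (cons e G₀ G)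
      (j := (j : WithBot κ)) (i := i) (i' := i') hi (WithBot.coe_lt_coe.2 hkl) (top.glueBot p)
      (right.glueBot p) (left.glueBot p) (bottom.glueBot p) f g).symm
    refine (WCell.ev_heq ((congrArg₂ (· ≫ ·) (m top f) (m right g)).trans (N.map_comp _ _ _ _).symm)
      ((congrArg₂ (· ≫ ·) (m left g) (m bottom f)).trans (N.map_comp _ _ _ _).symm)
      (comp_cell_same e (S := fun i : ι => S i) N G hi hkl top right left bottom f g)
      (G₀.toFFunctor.obj p)).trans ?_
    exact heq_of_eq (N.ev_map_mapFunctor_left _ _ _)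

/-- The comparison is the one made for `uncurry_comp`, with the distinguished variable first. It
differs only on cells: those in two old variables have been flipped twice, and those against the
first variable once. -/
theorem uncurryLeft_comp : uncurryLeft ((N.comp e (S := fun i : ι => S i) G).post
    (FFunctor.funMap G₀.toFFunctor K w'.bar w.bar)) =
      (N.uncurryLeft.comp (LexSum.withBot e) (S := S) (cons e G₀ G)).post K := by
  refine ext_heq ?_ ?_ ?_ ?_
  · rfl
  · intro k x y a b h f
    refine HEq.trans ?_ (heq_of_eq (post_map _ K h f)).symm
    obtain ⟨x, p, rfl⟩ := glueBot_surjective x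
    cases k with
    | bot =>
      obtain rfl := h.eq_glueBot
      obtain rfl : p = a := h.src
      exact heq_of_eq (congrArg K.map (comp_map (LexSum.withBot e) (S := S) N.uncurryLeft (cons e G₀ G)
        (j := ⊥) (i := ()) h f).symm)
    | coe i =>
      obtain ⟨y, rfl⟩ := h.exists_glueBot
      obtain ⟨⟨j, i⟩, rfl⟩ := e.surjective i
      have h₁ := (post_map (N.comp e (S := fun i : ι => S i) G)
        (FFunctor.funMap G₀.toFFunctor K w'.bar w.bar) h.of_glueBot f).trans (congrArg _
          (comp_map e (S := fun i : ι => S i) N G h.of_glueBot f))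
      have h₂ := comp_map (LexSum.withBot e) (S := S) N.uncurryLeft (cons e G₀ G)
        (j := (j : WithBot κ)) (i := i) h f
      exact heq_of_eq ((congrArg (fun φ => WTrans.app φ p) h₁).trans (congrArg K.map h₂).symm)
  · intro k x y a b h f g σ
    refine HEq.trans ?_ (post_map₂ _ K h σ).symm
    obtain ⟨x, p, rfl⟩ := glueBot_surjective x
    cases k with
    | bot =>
      obtain rfl := h.eq_glueBot
      obtain rfl : p = a := h.src
      have h₂ (f) := comp_map (LexSum.withBot e) (S := S) N.uncurryLeft (cons e G₀ G)
        (j := ⊥) (i := ()) h f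
      exact K.map₂_heq (h₂ f).symm (h₂ g).symm (comp_map₂ (LexSum.withBot e) (S := S) N.uncurryLeft
        (cons e G₀ G) (j := ⊥) (i := ()) h σ).symm
    | coe i =>
      obtain ⟨y, rfl⟩ := h.exists_glueBot
      obtain ⟨⟨j, i⟩, rfl⟩ := e.surjective i
      have h₁ (f) := comp_map e (S := fun i : ι => S i) N G h.of_glueBot f
      have h₀ (f) := post_map (N.comp e (S := fun i : ι => S i) G)
        (FFunctor.funMap G₀.toFFunctor K w'.bar w.bar) h.of_glueBot f
      have h₂ (f) := comp_map (LexSum.withBot e) (S := S) N.uncurryLeft (cons e G₀ G)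
        (j := (j : WithBot κ)) (i := i) h f
      refine (Modif.app_heq (h₀ f) (h₀ g) (post_map₂ _ _ h.of_glueBot σ) p).trans ?_
      refine HEq.trans (K.map₂_heq ?_ ?_ (Modif.app_heq (h₁ f) (h₁ g) (comp_map₂ e
        (S := fun i : ι => S i) N G h.of_glueBot σ) (G₀.toFFunctor.obj p))) ?_
      · exact congrArg (fun φ => WTrans.app φ (G₀.toFFunctor.obj p)) (h₁ f)
      · exact congrArg (fun φ => WTrans.app φ (G₀.toFFunctor.obj p)) (h₁ g)
      · exact K.map₂_heq (h₂ f).symm (h₂ g).symm (comp_map₂ (LexSum.withBot e) (S := S) N.uncurryLeft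
          (cons e G₀ G) (j := (j : WithBot κ)) (i := i) h σ).symm
  · intro k l hkl x y z t a a' b b' top right left bottom f g
    refine HEq.trans ?_ (post_cell _ K hkl top right left bottom f g).symm
    obtain ⟨x, p, rfl⟩ := glueBot_surjective x
    cases l with
    | bot => exact absurd hkl not_lt_bot
    | coe i =>
    obtain ⟨z, rfl⟩ := left.exists_glueBot
    cases k with
    | bot =>
      obtain rfl := top.eq_glueBot
      obtain rfl := bottom.eq_glueBot
      obtain rfl : p = a := top.src
      obtain ⟨⟨j, i⟩, rfl⟩ := e.surjective i
      -- The cell against the first variable is the flip of the cell, at `f`, of the transformation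
      -- given by `g`; the equality of transformations is applied under the flip.
      refine (WTrans.flip_cell_heq w.bar_bar ((post_map
        (N.comp e (S := fun i : ι => S i) G) (FFunctor.funMap G₀.toFFunctor K w'.bar w.bar)
        left.of_glueBot g).trans (congrArg _
          (comp_map e (S := fun i : ι => S i) N G left.of_glueBot g))) f).trans ?_
      refine (heq_of_eq (K.mapSq_flip w.bar_bar _)).trans ?_
      refine K.mapSq_heq ?_ ?_ ?_ ?_ (comp_cell_diff' (LexSum.withBot e) (S := S) N.uncurryLeft
        (cons e G₀ G) (j := ⊥) (j' := (j : WithBot κ)) (i := ()) (i' := i) (WithBot.bot_lt_coe j)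
        hkl top right left bottom f g).symm
      · exact (comp_map (LexSum.withBot e) (S := S) N.uncurryLeft (cons e G₀ G)
          (j := ⊥) (i := ()) top f).symm
      · exact (comp_map (LexSum.withBot e) (S := S) N.uncurryLeft (cons e G₀ G)
          (j := (j : WithBot κ)) (i := i) right g).symm
      · exact (comp_map (LexSum.withBot e) (S := S) N.uncurryLeft (cons e G₀ G)
          (j := (j : WithBot κ)) (i := i) left g).symm
      · exact (comp_map (LexSum.withBot e) (S := S) N.uncurryLeft (cons e G₀ G)
          (j := ⊥) (i := ()) bottom f).symm
    | coe j =>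
      obtain ⟨y, rfl⟩ := top.exists_glueBot
      obtain ⟨t, rfl⟩ := bottom.exists_glueBot
      refine (heq_of_eq (uncurryLeft_cell_coe _ (WithBot.coe_lt_coe.1 hkl) top.of_glueBot
        right.of_glueBot left.of_glueBot bottom.of_glueBot f g p)).trans ?_
      have m {i : ι} {x y : ∀ i : ι, S i} {a b : S i}
          (h : Along (S := fun i : ι => S i) i x y a b) (f : a ⟶ b) :=
        post_map (N.comp e (S := fun i : ι => S i) G) (FFunctor.funMap G₀.toFFunctor K w'.bar w.bar) h f
      refine (WCell.ev_heq (congrArg₂ (· ≫ ·) (m _ f) (m _ g)) (congrArg₂ (· ≫ ·) (m _ g) (m _ f))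
        (post_cell _ _ (WithBot.coe_lt_coe.1 hkl) top.of_glueBot right.of_glueBot left.of_glueBot
          bottom.of_glueBot f g) p).trans ?_
      refine (heq_of_eq (WCell.ev_mapSq _ _ _ p)).trans ?_
      exact K.mapSq_heq (uncurryLeft_comp_map ..) (uncurryLeft_comp_map ..) (uncurryLeft_comp_map ..)
        (uncurryLeft_comp_map ..) (uncurryLeft_comp_cell e N G G₀ (WithBot.coe_lt_coe.1 hkl) top.of_glueBot
          right.of_glueBot left.of_glueBot bottom.of_glueBot f g p)

end

end Multifunctor

/-! ### Functoriality of the `F`-categories of `F`-functors -/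

section

variable {w' w : Weakness} {A : FCat.{w₁, v₁, u₁}} {B : FCat.{w₂, v₂, u₂}}

theorem Modif.heq {F G : Fun w' w A B} {φ ψ φ' ψ' : F ⟶ G} {μ : φ ⟶ ψ} {ν : φ' ⟶ ψ'} (h : φ = φ')
    (h' : ψ = ψ') (e : ∀ X, HEq (Modif.app μ X) (Modif.app ν X)) : HEq μ ν := by
  subst h h'
  exact heq_of_eq (Modif.hom_ext fun X => eq_of_heq (e X))

theorem WCell.conj_conj {A : Type u} [Category.{v} A] {a b d e d' e' : A} (h₁ : a = b)
    (h₂ : b = d) (x : WCell w d e) (h₃ : e = e') (h₄ : e' = d') :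
    .ofEq h₁ ⊚ (.ofEq h₂ ⊚ x ⊚ .ofEq h₃) ⊚ .ofEq h₄ =
      .ofEq (h₁.trans h₂) ⊚ x ⊚ .ofEq (h₃.trans h₄) := by
  simp

namespace FFunctor

theorem mapSq_id {X Y Z V : A} {p : X ⟶ Y} {q : Y ⟶ V} {r : X ⟶ Z} {t : Z ⟶ V}
    (x : WCell w (p ≫ q) (r ≫ t)) : (FFunctor.id A).mapSq x = x :=
  (WCell.ofEq_rfl_comp _ _).trans ((WCell.comp_ofEq_rfl _ _).trans (by cases x <;> rfl))

theorem mapSq_comp {C : FCat.{w₃, v₃, u₃}} (k : FFunctor A B) (l : FFunctor B C) {X Y Z V : A}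
    {p : X ⟶ Y} {q : Y ⟶ V} {r : X ⟶ Z} {t : Z ⟶ V} (x : WCell w (p ≫ q) (r ≫ t)) :
    (k.comp l).mapSq x = l.mapSq (k.mapSq x) := by
  have e₁ := l.mapCell_comp (.ofEq (k.map_comp p q).symm)
    (k.mapCell x ⊚ .ofEq (k.map_comp r t))
  have e₂ := l.mapCell_comp (k.mapCell x) (.ofEq (k.map_comp r t))
  have e : l.mapCell (k.mapCell x) = (k.comp l).mapCell x := WCell.map_map _ _ _
  refine Eq.symm ((congrArg (fun c => .ofEq (l.map_comp _ _).symm ⊚ c ⊚ .ofEq (l.map_comp _ _))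
    (e₁.trans (congrArg₂ WCell.comp (l.mapCell_ofEq _) (e₂.trans
      (congrArg₂ WCell.comp e (l.mapCell_ofEq _)))))).trans ?_)
  exact WCell.conj_conj _ _ _ _ _

/-- Components are unchanged by definition; the cells of a whiskered transformation are images of
squares, so the claim rests on `mapSq_id`. `funMap_comp` rests on `mapSq_comp` in the same way.
Modifications are compared only after the 1-cells between which they run. -/
theorem funMap_id : funMap (FFunctor.id A) (FFunctor.id B) w' w = FFunctor.id (Fun w' w A B) := by
  have e {F G : Fun w' w A B} (φ : F ⟶ G) : (funMap (FFunctor.id A) (FFunctor.id B) w' w).map φ = φ :=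
    WTrans.ext' (fun _ => rfl) fun f => (mapSq_id _).trans
      ((WCell.ofEq_rfl_comp _ _).trans (WCell.comp_ofEq_rfl _ _)).symm
  exact ext_heq (fun _ => rfl) (fun φ => heq_of_eq (e φ))
    fun μ => Modif.heq (e _) (e _) fun _ => HEq.rfl

theorem funMap_comp {A' : FCat.{w₃, v₃, u₃}} {A'' : FCat.{w₄, v₄, u₄}} {B' B'' : FCat.{w, v, u}}
    (p' : FFunctor A'' A') (p : FFunctor A' A) (k : FFunctor B B') (k' : FFunctor B' B'')
    (w' w : Weakness) :
    funMap (p'.comp p) (k.comp k') w' w = (funMap p k w' w).comp (funMap p' k' w' w) := by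
  have e {F G : Fun w' w A B} (φ : F ⟶ G) : (funMap (p'.comp p) (k.comp k') w' w).map φ =
      ((funMap p k w' w).comp (funMap p' k' w' w)).map φ :=
    WTrans.ext' (fun _ => rfl) fun f => (mapSq_comp k k' _).trans
      ((WCell.ofEq_rfl_comp _ _).trans (WCell.comp_ofEq_rfl _ _)).symm
  exact ext_heq (fun _ => rfl) (fun φ => heq_of_eq (e φ))
    fun μ => Modif.heq (e _) (e _) fun _ => HEq.rfl

end FFunctor

end

/-! ### Composition with unary multifunctors -/

namespace Multifunctor

variable {w' w : Weakness} {ι : Type} [LinearOrder ι] {S : ι → FCat.{w₁, v₁, u₁}}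
  {A : FCat.{w₁, v₁, u₁}} {B : FCat.{w₂, v₂, u₂}} {C : FCat.{w₃, v₃, u₃}}

/-- Since every unary multifunctor comes from an `F`-functor, composition with it falls under
`post`. -/
theorem comp_single_eq_post (M : Multifunctor w' w S B) (k : Multifunctor w' w (fun _ : Unit => B) C) :
    k.comp (LexSum.single ι) (S := S) (fun _ => M) = M.post k.toFFunctor := by
  rw [post, ofFFunctor_toFFunctor]

theorem toFFunctor_post (f : Multifunctor w' w (fun _ : Unit => A) B) (K : FFunctor B C) :
    (f.post K).toFFunctor = f.toFFunctor.comp K :=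
  FFunctor.ext_heq (fun _ => rfl)
    (fun {X Y} g => heq_of_eq (post_map f K (i := ()) (x := fun _ => X) (y := fun _ => Y)
      ⟨rfl, rfl, fun _ h => (h rfl).elim⟩ g))
    fun {X Y _ _} σ => post_map₂ f K (i := ()) (x := fun _ => X) (y := fun _ => Y)
      ⟨rfl, rfl, fun _ h => (h rfl).elim⟩ σ

theorem post_ofFFunctor (K : FFunctor A B) (L : FFunctor B C) :
    (ofFFunctor w' w K).post L = ofFFunctor w' w (K.comp L) := by
  rw [← ofFFunctor_toFFunctor ((ofFFunctor w' w K).post L), toFFunctor_post]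
  rfl

end Multifunctor

/-! ### The closed structures on the multicategory of `F`-categories -/

section

variable {w' w v' v : Weakness}

theorem andThen_eq_post {ι : Type} [LinearOrder ι] [Finite ι] {S : ι → (FCAT.{u} w' w).Obj}
    {C D : (FCAT.{u} w' w).Obj} (f : (FCAT.{u} w' w).Hom S C)
    (k : (FCAT.{u} w' w).Hom (fun _ : Unit => C) D) :
    (FCAT w' w).andThen f k = Multifunctor.post f (Multifunctor.toFFunctor k) :=
  Multifunctor.comp_single_eq_post _ _

theorem funHom_id (X Z : (FCAT.{u} w' w).Obj) :
    funHom v' v ((FCAT w' w).id X) ((FCAT w' w).id Z) = (FCAT w' w).id (Fun v' v X Z) :=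
  congrArg (Multifunctor.ofFFunctor w' w) FFunctor.funMap_id

/-- Both sides come from `F`-functors, on which the claim is `FFunctor.funMap_comp`. -/
theorem funHom_comp {X X' X'' Z Z' Z'' : (FCAT.{u} w' w).Obj}
    (f' : (FCAT w' w).Hom (fun _ : Unit => X'') X') (f : (FCAT w' w).Hom (fun _ : Unit => X') X)
    (k : (FCAT w' w).Hom (fun _ : Unit => Z) Z') (k' : (FCAT w' w).Hom (fun _ : Unit => Z') Z'') :
    funHom v' v ((FCAT w' w).andThen f' f) ((FCAT w' w).andThen k k') =
      (FCAT w' w).andThen (funHom v' v f k) (funHom v' v f' k') := by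
  refine Eq.trans ?_ ((andThen_eq_post _ _).trans (Multifunctor.post_ofFFunctor _ _)).symm
  refine congrArg (Multifunctor.ofFFunctor w' w)
    (Eq.trans ?_ (FFunctor.funMap_comp _ _ _ _ v' v))
  exact congrArg₂ (fun p k => FFunctor.funMap p k v' v)
    ((congrArg Multifunctor.toFFunctor (andThen_eq_post f' f)).trans
      (Multifunctor.toFFunctor_post _ _))
    ((congrArg Multifunctor.toFFunctor (andThen_eq_post k k')).trans
      (Multifunctor.toFFunctor_post _ _))

/-- The right-closed structure on `FCAT w' w`. -/
noncomputable def rightClosed (w' w : Weakness) :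
    (FCAT.{u} w' w).RightClosed (Fun w' w) (funHom w' w) where
  ihomMap_id := funHom_id
  ihomMap_comp := funHom_comp
  curry S Z := Multifunctor.curryEquiv w' w S Z
  curry_comp e S T Z Z' h f f₁ k := by
    -- Moving the bijection to the other side turns naturality of currying into that of uncurrying.
    -- There `uncurry_comp` applies to `curry h`, the uncurrying of which is `h`.
    refine (Multifunctor.curryEquiv w' w S Z').eq_symm_apply.1 ?_
    refine (andThen_eq_post _ _).trans (Eq.trans ?_ (congrArg Multifunctor.uncurry
      (andThen_eq_post _ _)).symm)
    refine Eq.trans ?_ (Multifunctor.uncurry_comp e (Multifunctor.curry h) f f₁ _).symm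
    exact congrArg (fun M => Multifunctor.post (Multifunctor.comp (LexSum.withTop e) (S := S) M
      (Multifunctor.snoc e f f₁)) (Multifunctor.toFFunctor k)) (Multifunctor.uncurry_curry h).symm

/-- The left-closed structure on `FCAT w' w`. -/
noncomputable def leftClosed (w' w : Weakness) :
    (FCAT.{u} w' w).LeftClosed (Fun w'.bar w.bar) (funHom w'.bar w.bar) where
  ihomMap_id := funHom_id
  ihomMap_comp := funHom_comp
  curry S Z := Multifunctor.curryLeftEquiv w' w S Z
  curry_comp e S T Z Z' h f₀ f k := by
    -- Likewise, naturality is moved to the inverse bijection, where it is `uncurryLeft_comp`.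
    refine (Multifunctor.curryLeftEquiv w' w S Z').eq_symm_apply.1 ?_
    refine (andThen_eq_post _ _).trans (Eq.trans ?_ (congrArg Multifunctor.uncurryLeft
      (andThen_eq_post _ _)).symm)
    refine Eq.trans ?_ (Multifunctor.uncurryLeft_comp e (Multifunctor.curryLeftEquiv w' w T Z h) f f₀
      _).symm
    exact congrArg (fun M => Multifunctor.post (Multifunctor.comp (LexSum.withBot e) (S := S) M
      (Multifunctor.cons e f₀ f)) (Multifunctor.toFFunctor k))
      ((Multifunctor.curryLeftEquiv w' w T Z).symm_apply_apply h).symm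

end

/-! ### Multifunctors into a full sub-`F`-category -/

theorem FCat.mapSq_fullIncl {w : Weakness} {C : FCat.{w₁, v₁, u₁}} {P : C → Prop}
    {X Y Z V : C.full P} {p : X ⟶ Y} {q : Y ⟶ V} {r : X ⟶ Z} {t : Z ⟶ V}
    (x : WCell w (p ≫ q) (r ≫ t)) : (C.fullIncl P).mapSq x = x :=
  (WCell.ofEq_rfl_comp _ _).trans ((WCell.comp_ofEq_rfl _ _).trans (by cases x <;> rfl))

namespace Multifunctor

variable {w' w : Weakness} {ι : Type} [LinearOrder ι] {S : ι → FCat.{w₁, v₁, u₁}}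
  {C : FCat.{w₂, v₂, u₂}} {P : C → Prop}

/-- A multifunctor with values in a full sub-`F`-category. -/
def lift (M : Multifunctor w' w S C) (hM : ∀ x, P (M.obj x)) : Multifunctor w' w S (C.full P) where
  obj x := ⟨M.obj x, hM x⟩
  map h f := M.map h f
  map₂ h _ _ σ := M.map₂ h σ
  map_id := M.map_id
  map_comp := M.map_comp
  map₂_id := M.map₂_id
  map₂_comp := M.map₂_comp
  map₂_whisker_left := M.map₂_whisker_left
  map₂_whisker_right := M.map₂_whisker_right
  map_tight h _ hf := M.map_tight h hf
  cell hij _ _ _ _ _ _ _ _ top right left bottom f g := M.cell hij top right left bottom f g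
  cell_is := M.cell_is
  cell_id_right := M.cell_id_right
  cell_comp_right := M.cell_comp_right
  cell_naturality_right := M.cell_naturality_right
  cell_id_left := M.cell_id_left
  cell_comp_left := M.cell_comp_left
  cell_naturality_left := M.cell_naturality_left
  cube := M.cube

/-- The composite of a multifunctor with the inclusion of a full sub-`F`-category. -/
def unlift (N : Multifunctor w' w S (C.full P)) : Multifunctor w' w S C where
  obj x := (N.obj x).1
  map h f := N.map h f
  map₂ h _ _ σ := N.map₂ h σ
  map_id := N.map_id
  map_comp := N.map_comp
  map₂_id := N.map₂_id
  map₂_comp := N.map₂_comp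
  map₂_whisker_left := N.map₂_whisker_left
  map₂_whisker_right := N.map₂_whisker_right
  map_tight h _ hf := N.map_tight h hf
  cell hij _ _ _ _ _ _ _ _ top right left bottom f g := N.cell hij top right left bottom f g
  cell_is := N.cell_is
  cell_id_right := N.cell_id_right
  cell_comp_right := N.cell_comp_right
  cell_naturality_right := N.cell_naturality_right
  cell_id_left := N.cell_id_left
  cell_comp_left := N.cell_comp_left
  cell_naturality_left := N.cell_naturality_left
  cube := N.cube

theorem lift_congr {M M' : Multifunctor w' w S C} (h : M = M') (hM : ∀ x, P (M.obj x))
    (hM' : ∀ x, P (M'.obj x)) : M.lift hM = M'.lift hM' := by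
  subst h; rfl

/-- A multifunctor into the full sub-`F`-category is definitionally the lift of its own `unlift`,
and a lift depends only on the multifunctor that is lifted. -/
theorem unlift_injective : Function.Injective (unlift : Multifunctor w' w S (C.full P) → _) :=
  fun N N' h => lift_congr h (fun x => (N.obj x).2) fun x => (N'.obj x).2

/-- The composite in the multicategory is defined through blocks and reindexing, whereas `unlift`
reuses the data as they are. The identification makes later comparisons hold by definition. -/
theorem post_fullIncl (N : Multifunctor w' w S (C.full P)) :
    N.post (C.fullIncl P) = N.unlift := by
  refine ext_heq rfl (fun h f => heq_of_eq (post_map N _ h f)) (fun h _ _ σ => post_map₂ N _ h σ) ?_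
  intro i j hij x y z t a a' b b' top right left bottom f g
  refine (post_cell N _ hij top right left bottom f g).trans ?_
  exact heq_of_eq (FCat.mapSq_fullIncl _)

end Multifunctor

/-! ### The partial `F`-functors of an uncurried multifunctor -/

section Slot

theorem update_glueTop_top {ι : Type} [DecidableEq (WithTop ι)] {S : WithTop ι → FCat.{w₁, v₁, u₁}}
    (x : ∀ i : ι, S i) (p a : S ⊤) : Function.update (glueTop x p) ⊤ a = glueTop x a := by
  funext k
  cases k with
  | top => exact Function.update_self ..
  | coe k => exact Function.update_of_ne WithTop.coe_ne_top _ _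

theorem update_glueTop_coe {ι : Type} [DecidableEq (WithTop ι)] [DecidableEq ι]
    {S : WithTop ι → FCat.{w₁, v₁, u₁}} (x : ∀ i : ι, S i) (p : S ⊤) (i : ι) (a : S i) :
    Function.update (glueTop x p) (i : WithTop ι) a =
      glueTop (Function.update (β := fun i : ι => S i) x i a) p := by
  funext k
  cases k with
  | top => exact Function.update_of_ne WithTop.top_ne_coe _ _
  | coe k =>
    by_cases h : k = i
    · subst h
      exact (Function.update_self ..).trans (Function.update_self (β := fun i : ι => S i) ..).symm
    · exact (Function.update_of_ne (fun e => h (WithTop.coe_injective e)) _ _).trans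
        (Function.update_of_ne (β := fun i : ι => S i) h _ _).symm

theorem update_glueBot_bot {ι : Type} [DecidableEq (WithBot ι)] {S : WithBot ι → FCat.{w₁, v₁, u₁}}
    (x : ∀ i : ι, S i) (p a : S ⊥) : Function.update (glueBot x p) ⊥ a = glueBot x a := by
  funext k
  cases k with
  | bot => exact Function.update_self ..
  | coe k => exact Function.update_of_ne WithBot.coe_ne_bot _ _

theorem update_glueBot_coe {ι : Type} [DecidableEq (WithBot ι)] [DecidableEq ι]
    {S : WithBot ι → FCat.{w₁, v₁, u₁}} (x : ∀ i : ι, S i) (p : S ⊥) (i : ι) (a : S i) :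
    Function.update (glueBot x p) (i : WithBot ι) a =
      glueBot (Function.update (β := fun i : ι => S i) x i a) p := by
  funext k
  cases k with
  | bot => exact Function.update_of_ne WithBot.bot_ne_coe _ _
  | coe k =>
    by_cases h : k = i
    · subst h
      exact (Function.update_self ..).trans (Function.update_self (β := fun i : ι => S i) ..).symm
    · exact (Function.update_of_ne (fun e => h (WithBot.coe_injective e)) _ _).trans
        (Function.update_of_ne (β := fun i : ι => S i) h _ _).symm

namespace Multifunctor

variable {w' w : Weakness} {ι : Type} [LinearOrder ι]

/-- The entry `p` is overwritten in the partial functor, and what remains of the tuple is `x`. -/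
theorem slot_uncurry_top {S : WithTop ι → FCat.{w₁, v₁, u₁}} {C : FCat.{w₂, v₂, u₂}}
    (N : Multifunctor w' w (fun i : ι => S i) (Fun w' w (S ⊤) C)) (x : ∀ i : ι, S i) (p : S ⊤) :
    N.uncurry.slot (glueTop x p) ⊤ = N.obj x := by
  refine FFunctor.ext_heq (fun a => ?_) (fun {a b} f => ?_) (fun {a b f g} σ => ?_)
  · exact congrArg N.uncurry.obj (update_glueTop_top x p a)
  · exact N.uncurry.map_heq (.update _ a b) (.top x a b) (update_glueTop_top x p a) (update_glueTop_top x p b)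
      HEq.rfl
  · exact N.uncurry.map₂_heq (.update _ a b) (.top x a b) (update_glueTop_top x p a) (update_glueTop_top x p b)
      HEq.rfl HEq.rfl (HEq.refl σ)

/-- Changing an earlier entry leaves the last entry `p` in place, and the uncurried multifunctor
takes components at this entry. -/
theorem slot_uncurry_coe {S : WithTop ι → FCat.{w₁, v₁, u₁}} {C : FCat.{w₂, v₂, u₂}}
    (N : Multifunctor w' w (fun i : ι => S i) (Fun w' w (S ⊤) C)) (x : ∀ i : ι, S i) (p : S ⊤)
    (i : ι) : N.uncurry.slot (glueTop x p) i = (N.slot x i).comp (evaluation w' w C p) := by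
  refine FFunctor.ext_heq (fun a => ?_) (fun {a b} f => ?_) (fun {a b f g} σ => ?_)
  · exact congrArg N.uncurry.obj (update_glueTop_coe x p i a)
  · exact N.uncurry.map_heq (.update _ a b) ((Along.update (S := fun i : ι => S i) x a b).glueTop p)
      (update_glueTop_coe x p i a) (update_glueTop_coe x p i b) HEq.rfl
  · exact N.uncurry.map₂_heq (.update _ a b) ((Along.update (S := fun i : ι => S i) x a b).glueTop p)
      (update_glueTop_coe x p i a) (update_glueTop_coe x p i b) HEq.rfl HEq.rfl (HEq.refl σ)

/-- Reversal of the variables affects cells only, and partial functors do not see these; so the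
computation is as for the last variable. -/
theorem slot_uncurryLeft_bot {S : WithBot ι → FCat.{w₁, v₁, u₁}} {C : FCat.{w₂, v₂, u₂}}
    (N : Multifunctor w' w (fun i : ι => S i) (Fun w'.bar w.bar (S ⊥) C)) (x : ∀ i : ι, S i)
    (p : S ⊥) : N.uncurryLeft.slot (glueBot x p) ⊥ = N.obj x := by
  refine FFunctor.ext_heq (fun a => ?_) (fun {a b} f => ?_) (fun {a b f g} σ => ?_)
  · exact congrArg N.uncurryLeft.obj (update_glueBot_bot x p a)
  · exact N.uncurryLeft.map_heq (.update _ a b) (.bot x a b) (update_glueBot_bot x p a)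
      (update_glueBot_bot x p b) HEq.rfl
  · exact N.uncurryLeft.map₂_heq (.update _ a b) (.bot x a b) (update_glueBot_bot x p a)
      (update_glueBot_bot x p b) HEq.rfl HEq.rfl (HEq.refl σ)

theorem slot_uncurryLeft_coe {S : WithBot ι → FCat.{w₁, v₁, u₁}} {C : FCat.{w₂, v₂, u₂}}
    (N : Multifunctor w' w (fun i : ι => S i) (Fun w'.bar w.bar (S ⊥) C)) (x : ∀ i : ι, S i)
    (p : S ⊥) (i : ι) :
    N.uncurryLeft.slot (glueBot x p) i = (N.slot x i).comp (evaluation w'.bar w.bar C p) := by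
  refine FFunctor.ext_heq (fun a => ?_) (fun {a b} f => ?_) (fun {a b f g} σ => ?_)
  · exact congrArg N.uncurryLeft.obj (update_glueBot_coe x p i a)
  · exact N.uncurryLeft.map_heq (.update _ a b) ((Along.update (S := fun i : ι => S i) x a b).glueBot p)
      (update_glueBot_coe x p i a) (update_glueBot_coe x p i b) HEq.rfl
  · exact N.uncurryLeft.map₂_heq (.update _ a b) ((Along.update (S := fun i : ι => S i) x a b).glueBot p)
      (update_glueBot_coe x p i a) (update_glueBot_coe x p i b) HEq.rfl HEq.rfl (HEq.refl σ)

end Multifunctor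

end Slot

/-! ### Multimodels and the sketch of models -/

/-- This holds by the choice of the cones in the sketch of models as those detected by all
evaluations, together with the functoriality of images of cones. -/
theorem isModel_modSketch_iff {v' v : Weakness} {S X Z : Sketch.{u}}
    (K : FFunctor S.cat (ModCat v' v X Z)) : IsModel S (ModSketch v' v X Z) K ↔
      ∀ p, IsModel S Z ((K.comp (modIncl v' v X Z)).comp (evaluation v' v Z.cat p)) := by
  have e (p : X.cat) (c : WeightedCone S.cat) :
      c.map ((K.comp (modIncl v' v X Z)).comp (evaluation v' v Z.cat p)) =
        (c.map K).map ((modIncl v' v X Z).comp (evaluation v' v Z.cat p)) :=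
    c.map_comp K ((modIncl v' v X Z).comp (evaluation v' v Z.cat p))
  exact ⟨fun h p c hc => (e p c).symm ▸ h c hc p, fun h c hc p => e p c ▸ h p c hc⟩

namespace Multifunctor

variable {w' w v' v : Weakness} {ι : Type} [LinearOrder ι]

theorem isMultimodel_modSketch_iff {S : ι → Sketch.{u}} {X Z : Sketch.{u}}
    (N : Multifunctor w' w (fun i => (S i).cat) (ModCat v' v X Z)) :
    N.IsMultimodel (C := ModSketch v' v X Z) ↔ ∀ x i p, IsModel (S i) Z
      ((N.unlift.slot x i).comp (evaluation v' v Z.cat p)) :=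
  forall_congr' fun x => forall_congr' fun i => isModel_modSketch_iff (N.slot x i)

/-- Every tuple is a glued one, and the partial functors there are computed by `slot_uncurry_top`
and `slot_uncurry_coe`. The entry `p` is quantified also for the condition on `N.obj x`, since a
partial functor of the uncurried multifunctor is taken at a full tuple, which includes a last entry.
-/
theorem uncurry_isMultimodel_iff {S : WithTop ι → Sketch.{u}} {Z : Sketch.{u}}
    (N : Multifunctor w' w (fun i : ι => (S i).cat) (Fun w' w (S ⊤).cat Z.cat)) :
    (uncurry (S := fun i => (S i).cat) N).IsMultimodel ↔ ∀ (x : ∀ i : ι, (S i).cat)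
      (p : (S ⊤).cat), IsModel (S ⊤) Z (N.obj x) ∧
        ∀ i : ι, IsModel (S i) Z ((N.slot x i).comp (evaluation w' w Z.cat p)) := by
  constructor
  · intro h x p
    refine ⟨?_, fun i => ?_⟩
    · have := h (glueTop (S := fun i => (S i).cat) x p) ⊤
      rwa [slot_uncurry_top] at this
    · have := h (glueTop (S := fun i => (S i).cat) x p) i
      rwa [slot_uncurry_coe] at this
  · intro h x k
    obtain ⟨x, p, rfl⟩ := glueTop_surjective (S := fun i => (S i).cat) x
    cases k with
    | top =>
      rw [slot_uncurry_top]
      exact (h x p).1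
    | coe i =>
      rw [slot_uncurry_coe]
      exact (h x p).2 i

theorem uncurryLeft_isMultimodel_iff {S : WithBot ι → Sketch.{u}} {Z : Sketch.{u}}
    (N : Multifunctor w' w (fun i : ι => (S i).cat) (Fun w'.bar w.bar (S ⊥).cat Z.cat)) :
    (uncurryLeft (S := fun i => (S i).cat) N).IsMultimodel ↔ ∀ (x : ∀ i : ι, (S i).cat)
      (p : (S ⊥).cat), IsModel (S ⊥) Z (N.obj x) ∧
        ∀ i : ι, IsModel (S i) Z ((N.slot x i).comp (evaluation w'.bar w.bar Z.cat p)) := by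
  constructor
  · intro h x p
    refine ⟨?_, fun i => ?_⟩
    · have := h (glueBot (S := fun i => (S i).cat) x p) ⊥
      rwa [slot_uncurryLeft_bot] at this
    · have := h (glueBot (S := fun i => (S i).cat) x p) i
      rwa [slot_uncurryLeft_coe] at this
  · intro h x k
    obtain ⟨x, p, rfl⟩ := glueBot_surjective (S := fun i => (S i).cat) x
    cases k with
    | bot =>
      rw [slot_uncurryLeft_bot]
      exact (h x p).1
    | coe i =>
      rw [slot_uncurryLeft_coe]
      exact (h x p).2 i

end Multifunctor

/-! ### The closed structures on the multicategory of sketches -/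

section

variable {w' w v' v : Weakness}

namespace Multifunctor

variable {ι : Type} [LinearOrder ι] {S : ι → FCat.{u, u, u}} {X Z : Sketch.{u}}

/-- A multifunctor to `F`-functors whose values are models, as a multifunctor to models. -/
def liftModel (N : Multifunctor w' w S (Fun v' v X.cat Z.cat))
    (h : ∀ x, IsModel X Z (N.obj x)) : Multifunctor w' w S (ModCat v' v X Z) :=
  lift (C := Fun v' v X.cat Z.cat) N h

/-- The multifunctor to `F`-functors underlying a multifunctor to models. -/
def unliftModel (N : Multifunctor w' w S (ModCat v' v X Z)) :
    Multifunctor w' w S (Fun v' v X.cat Z.cat) :=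
  unlift N

theorem unliftModel_injective : Function.Injective
    (unliftModel : Multifunctor w' w S (ModCat v' v X Z) → _) :=
  unlift_injective

end Multifunctor

/-- The bijection between multimodels given by a bijection between multifunctors, under which models
in the first family of variables correspond to models in the second, with values in models. -/
def modelEquiv {κ ι : Type} [LinearOrder κ] [LinearOrder ι] {T : κ → Sketch.{u}}
    {S : ι → Sketch.{u}} {X Z : Sketch.{u}} (E : Multifunctor w' w (fun k => (T k).cat) Z.cat ≃
      Multifunctor w' w (fun i => (S i).cat) (Fun v' v X.cat Z.cat))
    (hE : ∀ N, (E.symm N).IsMultimodel ↔ ∀ (x : ∀ i, (S i).cat) (p : X.cat),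
      IsModel X Z (N.obj x) ∧ ∀ i, IsModel (S i) Z ((N.slot x i).comp (evaluation v' v Z.cat p))) :
    {M : Multifunctor w' w (fun k => (T k).cat) Z.cat // M.IsMultimodel} ≃
      {N : Multifunctor w' w (fun i => (S i).cat) (ModSketch v' v X Z).cat // N.IsMultimodel} where
  toFun M :=
    have h := (hE (E M.1)).1 ((E.symm_apply_apply M.1).symm ▸ M.2)
    -- The hypothesis on `E` says that the values are models only in the presence of an object of
    -- `X.cat`. The apex of the cone under consideration is such an object.
    ⟨(E M.1).liftModel fun x c hc => (h x c.X).1 c hc,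
      (Multifunctor.isMultimodel_modSketch_iff _).2 fun x i p => (h x p).2 i⟩
  invFun N := ⟨E.symm (Multifunctor.unliftModel N.1), (hE _).2 fun x p =>
    ⟨(N.1.obj x).2, fun i => (Multifunctor.isMultimodel_modSketch_iff N.1).1 N.2 x i p⟩⟩
  left_inv M := Subtype.ext (E.symm_apply_apply M.1)
  right_inv N := Subtype.ext (Multifunctor.unliftModel_injective
    (E.apply_symm_apply (Multifunctor.unliftModel N.1)))

/-- The condition on objects depends on `K`, so that the equality is stated for a variable `K`,
which can be substituted. The same applies to the next lemma. -/
theorem FFunctor.fullMap_eq_id {C : FCat.{w₁, v₁, u₁}} {P : C → Prop} {K : FFunctor C C}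
    (e : K = FFunctor.id C) (h : ∀ X, P X → P (K.obj X)) :
    K.fullMap h = FFunctor.id (C.full P) := by
  subst e; rfl

theorem FFunctor.fullMap_eq_comp {C : FCat.{w₁, v₁, u₁}} {D : FCat.{w₂, v₂, u₂}}
    {E : FCat.{w₃, v₃, u₃}} {P : C → Prop} {Q : D → Prop} {R : E → Prop} {K : FFunctor C E}
    {K₁ : FFunctor C D} {K₂ : FFunctor D E} (e : K = K₁.comp K₂) (h : ∀ X, P X → R (K.obj X))
    (h₁ : ∀ X, P X → Q (K₁.obj X)) (h₂ : ∀ X, Q X → R (K₂.obj X)) :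
    K.fullMap h = (K₁.fullMap h₁).comp (K₂.fullMap h₂) := by
  subst e; rfl

theorem modHom_id (X Z : (FSK.{u} w' w).Obj) :
    modHom v' v ((FSK w' w).id X) ((FSK w' w).id Z) = (FSK w' w).id (ModSketch v' v X Z) :=
  Subtype.ext (congrArg (Multifunctor.ofFFunctor w' w)
    (FFunctor.fullMap_eq_id FFunctor.funMap_id _))

theorem andThen_val {ι : Type} [LinearOrder ι] [Finite ι] {S : ι → (FSK.{u} w' w).Obj}
    {C D : (FSK.{u} w' w).Obj} (f : (FSK.{u} w' w).Hom S C)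
    (k : (FSK.{u} w' w).Hom (fun _ : Unit => C) D) :
    ((FSK w' w).andThen f k).1 = Multifunctor.post f.1 (Multifunctor.toFFunctor k.1) :=
  Multifunctor.comp_single_eq_post _ _

theorem toFFunctor_andThen {X Y Z : (FSK.{u} w' w).Obj} (f : (FSK w' w).Hom (fun _ : Unit => X) Y)
    (k : (FSK w' w).Hom (fun _ : Unit => Y) Z) :
    Multifunctor.toFFunctor ((FSK w' w).andThen f k).1 =
      (Multifunctor.toFFunctor f.1).comp (Multifunctor.toFFunctor k.1) :=
  (congrArg Multifunctor.toFFunctor (andThen_val f k)).trans (Multifunctor.toFFunctor_post _ _)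

theorem modHom_comp {X X' X'' Z Z' Z'' : (FSK.{u} w' w).Obj}
    (f' : (FSK w' w).Hom (fun _ : Unit => X'') X') (f : (FSK w' w).Hom (fun _ : Unit => X') X)
    (k : (FSK w' w).Hom (fun _ : Unit => Z) Z') (k' : (FSK w' w).Hom (fun _ : Unit => Z') Z'') :
    modHom v' v ((FSK w' w).andThen f' f) ((FSK w' w).andThen k k') =
      (FSK w' w).andThen (modHom v' v f k) (modHom v' v f' k') := by
  refine Subtype.ext (Eq.trans ?_ ((andThen_val _ _).trans
    (Multifunctor.post_ofFFunctor _ _)).symm)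
  refine congrArg (Multifunctor.ofFFunctor w' w) (FFunctor.fullMap_eq_comp ?_
    (funMap_isModel (toFFunctor_isModel _) (toFFunctor_isModel _))
    (funMap_isModel (toFFunctor_isModel f) (toFFunctor_isModel k))
    (funMap_isModel (toFFunctor_isModel f') (toFFunctor_isModel k')))
  refine Eq.trans ?_ (FFunctor.funMap_comp _ _ _ _ v' v)
  exact congrArg₂ (fun p k => FFunctor.funMap p k v' v) (toFFunctor_andThen _ _)
    (toFFunctor_andThen _ _)

/-- Composition with the inclusion of the models only forgets that the values are models. Through
this, the compatibility of the bijections for sketches with those for `F`-categories holds by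
construction. -/
theorem toFun_eq_unlift {ι : Type} [LinearOrder ι] [Finite ι] {S : ι → (FSK.{u} w' w).Obj}
    {X Z : Sketch.{u}} (M : (FSK w' w).Hom S (ModSketch v' v X Z)) :
    toFun M = Multifunctor.unliftModel M.1 :=
  (andThen_eq_post (S := fun i => (S i).cat) (C := ModCat v' v X Z) M.1
    (.ofFFunctor w' w (modIncl v' v X Z))).trans (Multifunctor.post_fullIncl _)

/-- The action on models is the restriction of the action on all `F`-functors, so the two agree once
the models are forgotten. -/
theorem unliftModel_andThen_modHom {ι : Type} [LinearOrder ι] [Finite ι] {S : ι → Sketch.{u}}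
    {X X' Z Z' : Sketch.{u}} (N : (FSK w' w).Hom S (ModSketch v' v X Z))
    (f : (FSK w' w).Hom (fun _ : Unit => X') X) (k : (FSK w' w).Hom (fun _ : Unit => Z) Z') :
    Multifunctor.unliftModel ((FSK w' w).andThen N (modHom v' v f k)).1 =
      (FCAT w' w).andThen (S := fun i => (S i).cat) (C := Fun v' v X.cat Z.cat)
        (Multifunctor.unliftModel N.1) (funHom v' v f.1 k.1) :=
  (congrArg Multifunctor.unliftModel (andThen_val N (modHom v' v f k))).trans
    (andThen_eq_post (S := fun i => (S i).cat) (C := Fun v' v X.cat Z.cat)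
      (Multifunctor.unliftModel N.1) (funHom v' v f.1 k.1)).symm

/-- The underlying multifunctor of `N` enters as a separate `N'`, which will be the currying of an
underlying multifunctor. -/
theorem unliftModel_andThen_comp {κ : Type} [LinearOrder κ] [Finite κ] {I : κ → Type}
    [∀ j, LinearOrder (I j)] [∀ j, Finite (I j)] {ι : Type} [LinearOrder ι] [Finite ι]
    (e : LexSum I ≃o ι) {S : ι → Sketch.{u}} {T : κ → Sketch.{u}} {X X' Z Z' : Sketch.{u}}
    (N : (FSK w' w).Hom T (ModSketch v' v X Z))
    {N' : Multifunctor w' w (fun j => (T j).cat) (Fun v' v X.cat Z.cat)}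
    (hN : Multifunctor.unliftModel N.1 = N') (F : ∀ j, (FSK w' w).Hom (fun i : I j => S (e ⟨j, i⟩)) (T j))
    (f : (FSK w' w).Hom (fun _ : Unit => X') X) (k : (FSK w' w).Hom (fun _ : Unit => Z) Z') :
    Multifunctor.unliftModel ((FSK w' w).andThen ((FSK w' w).comp e N F) (modHom v' v f k)).1 =
      (FCAT w' w).andThen (S := fun i => (S i).cat) (C := Fun v' v X.cat Z.cat)
        (Multifunctor.comp e (S := fun i => (S i).cat) (T := fun j => (T j).cat) N'
          fun j => (F j).1) (funHom v' v f.1 k.1) :=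
  hN ▸ unliftModel_andThen_modHom ((FSK w' w).comp e N F) f k

/-- The family `F'` is only required to agree with the underlying multifunctors at each index. For a
family extended at a new index, extending and forgetting the models agree only after a case
distinction on the index. -/
theorem andThen_comp_val {κ : Type} [LinearOrder κ] [Finite κ] {I : κ → Type}
    [∀ j, LinearOrder (I j)] [∀ j, Finite (I j)] {ι : Type} [LinearOrder ι] [Finite ι]
    (e : LexSum I ≃o ι) {S : ι → Sketch.{u}} {T : κ → Sketch.{u}} {Z Z' : Sketch.{u}}
    (h : (FSK w' w).Hom T Z) (F : ∀ j, (FSK w' w).Hom (fun i : I j => S (e ⟨j, i⟩)) (T j))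
    {F' : ∀ j, Multifunctor w' w (fun i : I j => (S (e ⟨j, i⟩)).cat) (T j).cat}
    (hF : ∀ j, (F j).1 = F' j) (k : (FSK w' w).Hom (fun _ : Unit => Z) Z') :
    ((FSK w' w).andThen ((FSK w' w).comp e h F) k).1 =
      (FCAT w' w).andThen (S := fun i => (S i).cat) (C := Z.cat)
        (Multifunctor.comp e (S := fun i => (S i).cat) (T := fun j => (T j).cat) h.1 F') k.1 := by
  obtain rfl : (fun j => (F j).1) = F' := funext hF
  rfl

/-- Currying the last variable of a multimodel. -/
def curryModel (w' w : Weakness) {ι : Type} [LinearOrder ι] [Finite ι] (S : WithTop ι → Sketch.{u})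
    (Z : Sketch.{u}) :
    (FSK w' w).Hom S Z ≃ (FSK w' w).Hom (fun i : ι => S i) (ModSketch w' w (S ⊤) Z) :=
  modelEquiv (v' := w') (v := w) (T := S) (S := fun i : ι => S i) (X := S ⊤) (Z := Z)
    (Multifunctor.curryEquiv w' w (fun i => (S i).cat) Z.cat)
    fun N => Multifunctor.uncurry_isMultimodel_iff N

/-- Definitional, because `modelEquiv` lifts the values of the bijection between multifunctors. With
`toFun_eq_unlift` it is the restriction property on the right. -/
theorem unliftModel_curryModel {ι : Type} [LinearOrder ι] [Finite ι] {S : WithTop ι → Sketch.{u}}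
    {Z : Sketch.{u}} (M : (FSK w' w).Hom S Z) : Multifunctor.unliftModel (curryModel w' w S Z M).1 =
      Multifunctor.curryEquiv w' w (fun i => (S i).cat) Z.cat M.1 := rfl

/-- Currying the first variable of a multimodel. -/
def curryLeftModel (w' w : Weakness) {ι : Type} [LinearOrder ι] [Finite ι]
    (S : WithBot ι → Sketch.{u}) (Z : Sketch.{u}) :
    (FSK w' w).Hom S Z ≃ (FSK w' w).Hom (fun i : ι => S i) (ModSketch w'.bar w.bar (S ⊥) Z) :=
  modelEquiv (v' := w'.bar) (v := w.bar) (T := S) (S := fun i : ι => S i) (X := S ⊥) (Z := Z)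
    (Multifunctor.curryLeftEquiv w' w (fun i => (S i).cat) Z.cat)
    fun N => Multifunctor.uncurryLeft_isMultimodel_iff N

theorem unliftModel_curryLeftModel {ι : Type} [LinearOrder ι] [Finite ι]
    {S : WithBot ι → Sketch.{u}} {Z : Sketch.{u}} (M : (FSK w' w).Hom S Z) :
    Multifunctor.unliftModel (curryLeftModel w' w S Z M).1 =
      Multifunctor.curryLeftEquiv w' w (fun i => (S i).cat) Z.cat M.1 := rfl

/-- The right-closed structure on `FSK w' w`. -/
noncomputable def modRightClosed (w' w : Weakness) :
    (FSK.{u} w' w).RightClosed (ModSketch w' w) (modHom w' w) where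
  ihomMap_id := modHom_id
  ihomMap_comp := modHom_comp
  curry S Z := curryModel w' w S Z
  curry_comp {κ} _ _ {I} _ _ {ι} _ _ e S T Z Z' h f f₁ k := by
    -- Multimodels to the sketch of models are determined by the underlying multifunctors to
    -- `F`-functors. For these, the equation is the naturality already established in `rightClosed`.
    refine Subtype.ext (Multifunctor.unliftModel_injective ?_)
    have r := unliftModel_andThen_comp e (S := fun i : ι => S i) (T := fun j : κ => T j)
      (curryModel w' w T Z h) (unliftModel_curryModel h) f f₁ k
    refine (unliftModel_curryModel _).trans ((congrArg
      (Multifunctor.curryEquiv w' w (fun i => (S i).cat) Z'.cat)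
      (andThen_comp_val (LexSum.withTop e) h _ ?_ k)).trans (((rightClosed w' w).curry_comp e
      (S := fun i => (S i).cat) (T := fun j => (T j).cat) h.1 (fun j => (f j).1) f₁.1 k.1).trans r.symm))
    -- It remains to see that forgetting the models commutes with extending the family by `f₁`: at
    -- the new index and at each old one this is definitional.
    intro j
    cases j <;> rfl

/-- The left-closed structure on `FSK w' w`. -/
noncomputable def modLeftClosed (w' w : Weakness) :
    (FSK.{u} w' w).LeftClosed (ModSketch w'.bar w.bar) (modHom w'.bar w.bar) where
  ihomMap_id := modHom_id
  ihomMap_comp := modHom_comp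
  curry S Z := curryLeftModel w' w S Z
  curry_comp {κ} _ _ {I} _ _ {ι} _ _ e S T Z Z' h f₀ f k := by
    -- As on the right, the equation reduces to underlying multifunctors, where it is the naturality
    -- in `leftClosed`.
    refine Subtype.ext (Multifunctor.unliftModel_injective ?_)
    have r := unliftModel_andThen_comp e (S := fun i : ι => S i) (T := fun j : κ => T j)
      (curryLeftModel w' w T Z h) (unliftModel_curryLeftModel h) f f₀ k
    refine (unliftModel_curryLeftModel _).trans ((congrArg
      (Multifunctor.curryLeftEquiv w' w (fun i => (S i).cat) Z'.cat)
      (andThen_comp_val (LexSum.withBot e) h _ ?_ k)).trans (((leftClosed w' w).curry_comp e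
      (S := fun i => (S i).cat) (T := fun j => (T j).cat) h.1 f₀.1 (fun j => (f j).1) k.1).trans r.symm))
    intro j
    cases j <;> rfl

end

theorem mainTheorem4 (w' w : Weakness) (h : w' ≤ w) :
    ∃ (L : (FCAT.{u} w' w).LeftClosed (Fun w'.bar w.bar) (funHom w'.bar w.bar))
      (R : (FCAT.{u} w' w).RightClosed (Fun w' w) (funHom w' w))
      (L' : (FSK.{u} w' w).LeftClosed (ModSketch w'.bar w.bar) (modHom w'.bar w.bar))
      (R' : (FSK.{u} w' w).RightClosed (ModSketch w' w) (modHom w' w)),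
      (∀ {ι : Type} [LinearOrder ι] [Finite ι] (S : WithBot ι → Sketch.{u}) (Z : Sketch.{u})
        (M : (FSK w' w).Hom S Z),
        toFun (L'.curry S Z M) = L.curry (fun i => (S i).cat) Z.cat M.1) ∧
      (∀ {ι : Type} [LinearOrder ι] [Finite ι] (S : WithTop ι → Sketch.{u}) (Z : Sketch.{u})
        (M : (FSK w' w).Hom S Z),
        toFun (R'.curry S Z M) = R.curry (fun i => (S i).cat) Z.cat M.1) :=
  ⟨leftClosed w' w, rightClosed w' w, modLeftClosed w' w, modRightClosed w' w,
    -- Forgetting the models in a curried multimodel gives, by definition, the currying of the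
    -- underlying multifunctor.
    fun _ _ _ => toFun_eq_unlift _, fun _ _ _ => toFun_eq_unlift _⟩
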